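/- Let $\mu>0$, $\alpha>0$ and $k\in\mathbb R$ with $k+\alpha>0$. For $\tau_0\in\mathbb R$ let $\tau(x)=\tau_0e^{-x^2}$ and $$f(x)=\frac{\mu-\alpha\tau(x)}{1+\alpha\tau(x)^2/2},\qquad g(x)=\frac{(k+\alpha)x}{1+\alpha\tau(x)^2/2},\qquad F(x)=\int_0^x f(s)\,ds .$$ Consider the retarded oscillator $\ddot x+\mu\dot x+kx+\alpha\,x(t-\tau(x))=0$ and its second-order truncation, in which $x(t-\tau(x))$ is replaced by $x-\tau(x)\dot x+\tfrac12\tau(x)^2\ddot x$. The critical delay is $\tau_c=\mu/\alpha$. A *cycle* is the orbit of a nonconstant periodic solution; a *limit cycle* is a cycle which is the $\omega$- or $\alpha$-limit set of some trajectory other than itself. A set is *(Lyapunov) stable* if trajectories starting close enough to it exist for all positive times and stay close to it, and *asymptotically stable* if, moreover, all trajectories starting close enough to it tend to it as $t\to+\infty$. Then: 1. For every $\tau_0$ and every $x\in C^2(\mathbb R)$, at each time $t$ the truncated equation is equivalent to the Liénard equation $\ddot x+f(x)\dot x+g(x)=0$, and to the planar system $\dot x=y$, $\dot y=-f(x)y-g(x)$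 for $(x,y)=(x,\dot x)$. The origin is the only equilibrium of this planar system. 2. For every $\tau_0$, $F'(0)=(\mu-\alpha\tau_0)/(1+\alpha\tau_0^2/2)$. The hypotheses of Liénard's theorem, namely: $F,g\in C^1(\mathbb R)$ are odd, $xg(x)>0$ for $x\ne0$, $F(0)=0$, $F'(0)<0$, $F$ has exactly one positive root $a$, is strictly increasing on $[a,\infty)$, and $F(x)\to\infty$ as $x\to\infty$; are satisfied if and only if $\tau_0>\mu/\alpha$. 3. If $\tau_0>\mu/\alpha$, the origin is not Lyapunov stable, and the planar system has a limit cycle $\Gamma$ which is asymptotically stable and is the only cycle of the system; in particular there is exactly one limit cycle, and it is stable. 4. If $0\le\tau_0\le\mu/\alpha$, the planar system has no cycle. If $0\le\tau_0<\mu/\alpha$, the origin is asymptotically stable. 5. The limit cycle appears at $\tau_0=\mu/\alpha$ through a Hopf bifurcation: for $\tau_0$ near $\mu/\alpha$ the eigenvalues of the linearization of the planar system at the origin are a pair $\lambda(\tau_0),\overline{\lambda(\tau_0)}$ with $\operatorname{Re}\lambda(\mu/\alpha)=0$, $\operatorname{Im}\lambda(\mu/\alpha)>0$, and $\operatorname{Re}\lambda$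 is differentiable at $\mu/\alpha$ with positive derivative there; and for every $\varepsilon>0$, for all $\tau_0>\mu/\alpha$ close enough to $\mu/\alpha$, every cycle lies in the open $\varepsilon$-ball (in the maximum norm) about the origin. 6. For $\mu=0.1$ and $\alpha=1/2$ the critical delay is $\mu/\alpha=1/5$. -/

import Mathlib

open Set Filter Topology MeasureTheory
open scoped ComplexConjugate

noncomputable section

/-! ### Planar autonomous vector fields -/

/-- `γ` solves `γ' = v(γ)` on `[0, ∞)` and starts at `p`. -/
def IsForwardTrajectory (v : ℝ × ℝ → ℝ × ℝ) (p : ℝ × ℝ) (γ : ℝ → ℝ × ℝ) : Prop :=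
  γ 0 = p ∧ IsIntegralCurveOn γ (fun _ => v) (Ici 0)

/-- `γ` solves `γ' = v(γ)` on `(-∞, 0]` and ends at `p`. -/
def IsBackwardTrajectory (v : ℝ × ℝ → ℝ × ℝ) (p : ℝ × ℝ) (γ : ℝ → ℝ × ℝ) : Prop :=
  γ 0 = p ∧ IsIntegralCurveOn γ (fun _ => v) (Iic 0)

/-- `Γ` is a cycle: the orbit of a nonconstant periodic solution. -/
def IsCycle (v : ℝ × ℝ → ℝ × ℝ) (Γ : Set (ℝ × ℝ)) : Prop :=
  ∃ (γ : ℝ → ℝ × ℝ) (T : ℝ), 0 < T ∧ IsIntegralCurve γ (fun _ => v) ∧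
    Function.Periodic γ T ∧ (∃ t, γ t ≠ γ 0) ∧ Γ = range γ

/-- `Γ` is a limit cycle: a cycle which is the `ω`-limit set or the `α`-limit set
of some trajectory other than `Γ` itself. -/
def IsLimitCycle (v : ℝ × ℝ → ℝ × ℝ) (Γ : Set (ℝ × ℝ)) : Prop :=
  IsCycle v Γ ∧ ∃ (p : ℝ × ℝ) (γ : ℝ → ℝ × ℝ), p ∉ Γ ∧
    ((IsForwardTrajectory v p γ ∧ Γ = {q | MapClusterPt q atTop γ}) ∨
      (IsBackwardTrajectory v p γ ∧ Γ = {q | MapClusterPt q atBot γ}))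

/-- Lyapunov stability of the set `S`: trajectories starting sufficiently close to `S`
exist for all positive times and stay close to `S`. -/
def IsLyapunovStable (v : ℝ × ℝ → ℝ × ℝ) (S : Set (ℝ × ℝ)) : Prop :=
  ∀ ε > 0, ∃ δ > 0, ∀ p ∈ Metric.thickening δ S,
    (∃ γ, IsForwardTrajectory v p γ) ∧
      ∀ γ, IsForwardTrajectory v p γ → ∀ t, 0 ≤ t → γ t ∈ Metric.thickening ε S

/-- Asymptotic stability of the set `S`: `S` is Lyapunov stable, and every trajectory
starting sufficiently close to `S` tends to `S`. -/
def IsAsymptoticallyStable (v : ℝ × ℝ → ℝ × ℝ) (S : Set (ℝ × ℝ)) : Prop :=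
  IsLyapunovStable v S ∧ ∃ δ > 0, ∀ p ∈ Metric.thickening δ S, ∀ γ,
    IsForwardTrajectory v p γ → Tendsto (fun t => Metric.infDist (γ t) S) atTop (𝓝 0)

/-- The complex eigenvalues, with multiplicity, of the linearization of `v` at `p`. -/
def linearizationEigenvalues (v : ℝ × ℝ → ℝ × ℝ) (p : ℝ × ℝ) : Multiset ℂ :=
  ((LinearMap.charpoly (fderiv ℝ v p : ℝ × ℝ →ₗ[ℝ] ℝ × ℝ)).map (algebraMap ℝ ℂ)).roots

/-! ### Liénard systems -/

/-- The hypotheses of Liénard's theorem, in terms of `F = ∫ f` and `g`. -/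
structure LienardHypotheses (F g : ℝ → ℝ) : Prop where
  contDiff_F : ContDiff ℝ 1 F
  contDiff_g : ContDiff ℝ 1 g
  odd_F : Function.Odd F
  odd_g : Function.Odd g
  mul_pos : ∀ x, x ≠ 0 → 0 < x * g x
  map_zero : F 0 = 0
  deriv_neg : deriv F 0 < 0
  single_root : ∃ a, 0 < a ∧ F a = 0 ∧ (∀ x, 0 < x → F x = 0 → x = a) ∧
    StrictMonoOn F (Ici a) ∧ Tendsto F atTop atTop

/-- The phase-plane field `(x, y) ↦ (y, -f(x) y - g(x))` of `x'' + f(x) x' + g(x) = 0`. -/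
def lienardField (f g : ℝ → ℝ) (p : ℝ × ℝ) : ℝ × ℝ :=
  (p.2, -(f p.1) * p.2 - g p.1)

/-! ### The retarded oscillator `x'' + μ x' + k x + α x(t - τ(x)) = 0` -/

/-- The state-dependent delay `τ(x) = τ₀ exp(-x²)`. -/
def delay (τ₀ x : ℝ) : ℝ := τ₀ * Real.exp (-x ^ 2)

/-- The left-hand side, at time `t`, of the retarded equation in which
`s ↦ x(s)`, evaluated at `t - τ(x(t))`, is replaced by its second-order Taylor polynomial at `t`. -/
def truncatedEquation (μ k α τ₀ : ℝ) (x : ℝ → ℝ) (t : ℝ) : ℝ :=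
  deriv (deriv x) t + μ * deriv x t + k * x t
    + α * taylorWithinEval x 2 univ t (t - delay τ₀ (x t))

/-- `f(x) = (μ - α τ(x)) / (1 + α τ(x)² / 2)`. -/
def dampingCoeff (μ α τ₀ x : ℝ) : ℝ :=
  (μ - α * delay τ₀ x) / (1 + α * delay τ₀ x ^ 2 / 2)

/-- `g(x) = (k + α) x / (1 + α τ(x)² / 2)`. -/
def restoringForce (k α τ₀ x : ℝ) : ℝ :=
  (k + α) * x / (1 + α * delay τ₀ x ^ 2 / 2)

/-- `F(x) = ∫₀ˣ f(s) ds`. -/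
def dampingPrimitive (μ α τ₀ x : ℝ) : ℝ :=
  ∫ s in (0 : ℝ)..x, dampingCoeff μ α τ₀ s

/-- The phase-plane field of the truncated oscillator. -/
def oscillatorField (μ k α τ₀ : ℝ) : ℝ × ℝ → ℝ × ℝ :=
  lienardField (dampingCoeff μ α τ₀) (restoringForce k α τ₀)

/-- The critical delay `μ / α`. -/
def criticalDelay (μ α : ℝ) : ℝ := μ / α

end

/-! In the Liénard coordinates `(x, v)`, `v = y + F(x)`, the system reads `x' = v - F(x)`, `v' =
-g(x)`. For the coefficients at hand this field is globally Lipschitz, so it has a global flow, and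
it is odd, so the half-orbits in `x > 0` determine everything. The solution from `(0, v)`, `v > 0`,
returns to the axis at some `(0, -P(v))` (`exists_halfOrbit`), and the half-return map `P` is
increasing because distinct half-orbits are disjoint (`p_lt_p`).

Above the critical delay, `f` is first negative and then positive on `x > 0`; hence `F` is negative
on `(0, a)` and increasing beyond. The energy `v² / 2 + ∫ g` changes at the rate `-g F`: it is
gained while `x < a` and lost while `x > a`. Comparing two nested half-orbits, at equal abscissa
over `[0, a]` and at equal height beyond, shows that `P(v)² - v²` strictly decreases once `x = a` is
reached (`energy_gain_lt`). Small half-orbits gain energy. Large ones lose amplitude, because `F - μ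
x` and `(k + α) x - g` are bounded and the system is there a perturbed damped linear oscillator
(`exists_dissipation`). So `P` has exactly one fixed point `w`, and it moves every other `v` towards
`w` without overshooting. By oddness `w` gives a cycle. Exponential Lipschitz bounds turn the
behaviour of `P` into orbital asymptotic stability. Any cycle must cross `x = 0`, and its crossing
heights force it to pass through `(0, w)` or `(0, -w)`.

For `0 ≤ τ₀ ≤ μ / α` the damping is positive off `x = 0`, so the energy cannot be periodic along a
nonconstant solution. The stability of the origin follows the sign of `f 0`, through a quadratic
Lyapunov function with a cross term.

At the Hopf point the eigenvalues have real part `-f(0) / 2`. Cycles shrink to the origin for two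
reasons: they lie in one ball for bounded delays (`exists_cycle_bound`), and the energy at the
critical delay, corrected by a small quartic, has negative derivative off a neighbourhood of the
origin, a property that survives small changes of `τ₀` (`eventually_isCycle_subset_ball`). -/

/-! ### Flows of globally Lipschitz vector fields -/

section Flow

variable {E : Type*} [NormedAddCommGroup E] [NormedSpace ℝ E]

open scoped Manifold in
/-- A globally Lipschitz vector field of class `C¹` has a global integral curve through each
point. -/
theorem exists_isIntegralCurve_of_lipschitzWith [CompleteSpace E] {v : E → E} {K : NNReal}
    (hv : LipschitzWith K v) (hv' : ContDiff ℝ 1 v) (x : E) :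
    ∃ γ : ℝ → E, γ 0 = x ∧ IsIntegralCurve γ (fun _ => v) := by
  have hloc : ∀ x : E, ∃ γ : ℝ → E, γ 0 = x ∧
      IsMIntegralCurveOn (I := 𝓘(ℝ, E)) γ v (Ioo (-(1 / (K + 1 : ℝ))) (1 / (K + 1 : ℝ))) := by
    intro x
    have hK : (0 : ℝ) < K + 1 := by positivity
    -- On the ball of radius `‖v x‖` about `x` the speed is at most `(K + 1) ‖v x‖`, so a solution
    -- cannot leave it before time `1 / (K + 1)`. This lifetime does not depend on `x`, which is
    -- what allows local curves to be glued into a global one.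
    set ε : ℝ := 1 / (K + 1 : ℝ) with hε
    have hεpos : 0 < ε := by positivity
    have hpl : IsPicardLindelof (fun _ => v) (tmin := -ε) (tmax := ε)
        ⟨0, by constructor <;> linarith⟩ x (‖v x‖₊) 0 (K * ‖v x‖₊ + ‖v x‖₊) K := by
      apply IsPicardLindelof.of_time_independent
      · intro y hy
        rw [Metric.mem_closedBall] at hy
        have h1 := hv.dist_le_mul y x
        have h2 : ‖v y‖ ≤ dist (v y) (v x) + ‖v x‖ := by
          rw [dist_eq_norm]
          simpa using norm_add_le (v y - v x) (v x)
        have h3 : (K : ℝ) * dist y x ≤ K * ‖v x‖ := by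
          gcongr
          simpa using hy
        push_cast
        linarith
      · exact hv.lipschitzOnWith
      · push_cast
        simp only [sub_zero, zero_sub, neg_neg, max_self]
        rw [hε]
        apply le_of_eq
        field_simp
    obtain ⟨γ, h0, h⟩ := hpl.exists_eq_forall_mem_Icc_hasDerivWithinAt₀
    refine ⟨γ, h0, fun t ht => ?_⟩
    have h1 := ((h t (Ioo_subset_Icc_self ht)).mono Ioo_subset_Icc_self).hasFDerivWithinAt
    exact h1.hasMFDerivWithinAt
  obtain ⟨γ, h0, hγ⟩ := exists_isMIntegralCurve_of_isMIntegralCurveOn (I := 𝓘(ℝ, E))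
    (contMDiff_vectorSpace_iff_contDiff.2 hv') (by positivity) hloc x
  refine ⟨γ, h0, fun t => ?_⟩
  have h1 : HasFDerivAt γ ((1 : ℝ →L[ℝ] ℝ).smulRight (v (γ t))) t := (hγ t).hasFDerivAt
  simpa using h1.hasDerivAt

/-- `φ` is the global flow of `v`, with exponential Lipschitz bounds. -/
structure IsFlow (v : E → E) (K : ℝ) (φ : ℝ → E → E) : Prop where
  zero : ∀ p, φ 0 p = p
  isIntegralCurve : ∀ p, IsIntegralCurve (fun t => φ t p) (fun _ => v)
  eq_of_isIntegralCurve : ∀ γ, IsIntegralCurve γ (fun _ => v) → ∀ t, γ t = φ t (γ 0)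
  eq_of_forward : ∀ γ, IsIntegralCurveOn γ (fun _ => v) (Ici 0) → ∀ t, 0 ≤ t → γ t = φ t (γ 0)
  dist_le : ∀ t p q, dist (φ t p) (φ t q) ≤ dist p q * Real.exp (K * |t|)

theorem dist_le_of_isIntegralCurve {v : E → E} {K : NNReal} (hv : LipschitzWith K v)
    {γ₁ γ₂ : ℝ → E} (h₁ : IsIntegralCurve γ₁ (fun _ => v)) (h₂ : IsIntegralCurve γ₂ (fun _ => v))
    {t : ℝ} (ht : 0 ≤ t) :
    dist (γ₁ t) (γ₂ t) ≤ dist (γ₁ 0) (γ₂ 0) * Real.exp (K * t) := by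
  have h := dist_le_of_trajectories_ODE (v := fun _ => v) (fun _ => hv) (a := 0) (b := t)
    h₁.continuous.continuousOn (fun s _ => (h₁ s).hasDerivWithinAt)
    h₂.continuous.continuousOn (fun s _ => (h₂ s).hasDerivWithinAt) le_rfl t ⟨ht, le_rfl⟩
  simpa using h

theorem exists_isFlow [CompleteSpace E] {v : E → E} {K : NNReal}
    (hv : LipschitzWith K v) (hv' : ContDiff ℝ 1 v) : ∃ φ, IsFlow v K φ := by
  choose φ hφ0 hφ using exists_isIntegralCurve_of_lipschitzWith hv hv'
  refine ⟨fun t p => φ p t, hφ0, hφ, fun γ hγ t => ?_, fun γ hγ t ht => ?_, fun t p q => ?_⟩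
  · have := ODE_solution_unique_univ (v := fun _ => v) (s := fun _ => univ) (K := K) (t₀ := 0)
      (fun _ => hv.lipschitzOnWith) (fun s => ⟨hγ s, trivial⟩)
      (fun s => ⟨hφ (γ 0) s, trivial⟩) (hφ0 _).symm
    exact congrFun this t
  · refine ODE_solution_unique (v := fun _ => v) (K := K) (a := 0) (b := t) (fun _ => hv)
      (hγ.continuousOn.mono Icc_subset_Ici_self)
      (fun s hs => (hγ s hs.1).mono (Ici_subset_Ici.2 hs.1))
      (hφ (γ 0)).continuous.continuousOn (fun s hs => (hφ (γ 0) s).hasDerivWithinAt)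
      (hφ0 _).symm ⟨ht, le_rfl⟩
  · rcases le_total 0 t with ht | ht
    · have := dist_le_of_isIntegralCurve hv (hφ p) (hφ q) ht
      rwa [hφ0, hφ0, show K * t = K * |t| by rw [abs_of_nonneg ht]] at this
    -- Negative times: reversed curves solve the equation of `-v`, which has the same Lipschitz
    -- constant.
    · have hrev : ∀ p, IsIntegralCurve (fun s => φ p (-s)) (fun _ => -v) := by
        intro p s
        have := (hφ p (-s)).scomp s (hasDerivAt_neg s)
        simpa [Function.comp_def] using this
      have := dist_le_of_isIntegralCurve (v := -v) (K := K) (by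
        intro x y
        simpa using hv x y) (hrev p) (hrev q) (neg_nonneg.2 ht)
      simp only [neg_neg, neg_zero, hφ0] at this
      rwa [abs_of_nonpos ht]

namespace IsFlow

variable {v : E → E} {K : ℝ} {φ : ℝ → E → E} (h : IsFlow v K φ)
include h

theorem add (s t : ℝ) (p : E) : φ (s + t) p = φ s (φ t p) := by
  have h1 : IsIntegralCurve (fun r => φ (r + t) p) (fun _ => v) :=
    (h.isIntegralCurve p).comp_add t
  have := h.eq_of_isIntegralCurve _ h1 s
  simpa using this

theorem continuous (p : E) : Continuous fun t => φ t p := (h.isIntegralCurve p).continuous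

theorem hasDerivAt (p : E) (t : ℝ) : HasDerivAt (fun t => φ t p) (v (φ t p)) t :=
  h.isIntegralCurve p t

theorem neg_cancel (t : ℝ) (p : E) : φ (-t) (φ t p) = p := by
  rw [← h.add, neg_add_cancel, h.zero]

/-- For an odd field `-φ` is again an integral curve. This symmetry reduces the study of full turns
to that of half-turns in `x > 0`. -/
theorem map_neg (hv : ∀ p, v (-p) = -v p) (t : ℝ) (p : E) : φ t (-p) = -φ t p := by
  have h1 : IsIntegralCurve (fun r => -φ r p) (fun _ => v) := by
    intro s
    have := (h.hasDerivAt p s).fun_neg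
    simpa [hv] using this
  have := h.eq_of_isIntegralCurve _ h1 t
  simpa [h.zero] using this.symm

end IsFlow

end Flow

/-! ### Scalar differential inequalities -/

/-- The level `B` can only be crossed upwards where the derivative is nonnegative, so its sign
matters only at the points of that level. -/
theorem le_barrier_of_hasDerivAt {u u' : ℝ → ℝ} {t₀ B : ℝ} (hd : ∀ t, HasDerivAt u (u' t) t)
    (h₀ : u t₀ ≤ B) (hB : ∀ t, t₀ ≤ t → u t = B → u' t < 0) {t : ℝ} (ht : t₀ ≤ t) : u t ≤ B := by
  refine image_le_of_deriv_right_lt_deriv_boundary (f := u) (f' := u') (a := t₀) (b := t)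
    (B := fun _ => B) (B' := fun _ => 0) (fun s _ => (hd s).continuousAt.continuousWithinAt)
    (fun s _ => (hd s).hasDerivWithinAt) h₀ (fun s => hasDerivAt_const _ _)
    (fun s hs h => hB s hs.1 h) ⟨ht, le_rfl⟩

theorem le_sub_mul_of_hasDerivAt_le {u u' : ℝ → ℝ} {t₀ m : ℝ} (hd : ∀ t, HasDerivAt u (u' t) t)
    (hm : ∀ t, t₀ ≤ t → u' t ≤ -m) {t : ℝ} (ht : t₀ ≤ t) : u t ≤ u t₀ - m * (t - t₀) := by
  have h1 : ∀ s, HasDerivAt (fun s => u s + m * s) (u' s + m) s := fun s => by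
    simpa using (hd s).fun_add ((hasDerivAt_id' s).const_mul m)
  have : AntitoneOn (fun s => u s + m * s) (Ici t₀) := by
    apply antitoneOn_of_hasDerivWithinAt_nonpos (convex_Ici t₀)
      (fun s _ => (h1 s).continuousAt.continuousWithinAt)
      (fun s _ => (h1 s).hasDerivWithinAt)
    intro s hs
    rw [interior_Ici] at hs
    have := hm s (le_of_lt hs)
    linarith
  have := this self_mem_Ici ht ht
  simp only at this
  linarith

theorem eventually_pos_of_hasDerivAt_pos {u : ℝ → ℝ} {t₀ m : ℝ} (hd : HasDerivAt u m t₀)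
    (hm : 0 < m) (h₀ : u t₀ = 0) : ∀ᶠ t in 𝓝[>] t₀, 0 < u t := by
  have h1 := (hasDerivAt_iff_tendsto_slope.1 hd).mono_left (nhdsGT_le_nhdsNE t₀)
  filter_upwards [h1.eventually (lt_mem_nhds hm), self_mem_nhdsWithin] with t ht ht'
  rw [slope_def_field, h₀, sub_zero] at ht
  have : (0 : ℝ) < t - t₀ := sub_pos.2 ht'
  exact (div_pos_iff_of_pos_right this).1 ht

theorem eventually_neg_of_hasDerivAt_pos {u : ℝ → ℝ} {t₀ m : ℝ} (hd : HasDerivAt u m t₀)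
    (hm : 0 < m) (h₀ : u t₀ = 0) : ∀ᶠ t in 𝓝[<] t₀, u t < 0 := by
  have h1 := (hasDerivAt_iff_tendsto_slope.1 hd).mono_left (nhdsLT_le_nhdsNE t₀)
  filter_upwards [h1.eventually (lt_mem_nhds hm), self_mem_nhdsWithin] with t ht ht'
  rw [slope_def_field, h₀, sub_zero] at ht
  have : t - t₀ < 0 := sub_neg.2 ht'
  rcases div_pos_iff.1 ht with h | h
  · exact absurd h.2 this.not_gt
  · exact h.1

/-! ### The Liénard plane -/

/-- The vector field `(x, v) ↦ (v - F(x), -g(x))`. -/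
def planeField (F g : ℝ → ℝ) (p : ℝ × ℝ) : ℝ × ℝ := (p.2 - F p.1, -g p.1)

/-- The energy `v² / 2 + ∫₀ˣ g`. -/
noncomputable def planeEnergy (g : ℝ → ℝ) (p : ℝ × ℝ) : ℝ := p.2 ^ 2 / 2 + ∫ s in (0 : ℝ)..p.1, g s

/-- Data of a Liénard system with a damping primitive `F` which is negative on `(0, a)` and
increasing on `[a, ∞)`. -/
structure LienardSystem (F f g : ℝ → ℝ) (a c M : ℝ) : Prop where
  a_pos : 0 < a
  hasDerivAt_F : ∀ x, HasDerivAt F (f x) x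
  continuous_f : Continuous f
  continuous_g : Continuous g
  odd_F : ∀ x, F (-x) = -F x
  odd_g : ∀ x, g (-x) = -g x
  F_neg : ∀ x, 0 < x → x < a → F x < 0
  F_a : F a = 0
  mono : StrictMonoOn F (Ici a)
  c_pos : 0 < c
  le_g : ∀ x, 0 ≤ x → c * x ≤ g x
  le_F : ∀ x, 0 ≤ x → -M ≤ F x

namespace LienardSystem

variable {F f g : ℝ → ℝ} {a c M K : ℝ} {φ : ℝ → ℝ × ℝ → ℝ × ℝ}

section Basic

theorem continuous_F (S : LienardSystem F f g a c M) : Continuous F :=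
  continuous_iff_continuousAt.2 fun x => (S.hasDerivAt_F x).continuousAt

theorem F_zero (S : LienardSystem F f g a c M) : F 0 = 0 := by
  have := S.odd_F 0
  simp only [neg_zero] at this
  linarith

theorem g_zero (S : LienardSystem F f g a c M) : g 0 = 0 := by
  have := S.odd_g 0
  simp only [neg_zero] at this
  linarith

theorem g_pos (S : LienardSystem F f g a c M) {x : ℝ} (hx : 0 < x) : 0 < g x :=
  (mul_pos S.c_pos hx).trans_le (S.le_g x hx.le)

theorem planeField_neg (S : LienardSystem F f g a c M) (p : ℝ × ℝ) :
    planeField F g (-p) = -planeField F g p := by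
  ext <;> simp [planeField, S.odd_F, S.odd_g]
  ring

theorem hasDerivAt_potential (S : LienardSystem F f g a c M) (x : ℝ) :
    HasDerivAt (fun x => ∫ s in (0 : ℝ)..x, g s) (g x) x :=
  intervalIntegral.integral_hasDerivAt_right (S.continuous_g.intervalIntegrable _ _)
    S.continuous_g.aestronglyMeasurable.stronglyMeasurableAtFilter
    S.continuous_g.continuousAt

theorem strictMonoOn_potential (S : LienardSystem F f g a c M) :
    StrictMonoOn (fun x => ∫ s in (0 : ℝ)..x, g s) (Ici 0) := by
  apply strictMonoOn_of_hasDerivWithinAt_pos (convex_Ici 0)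
    (fun s _ => (S.hasDerivAt_potential s).continuousAt.continuousWithinAt)
    (fun s _ => (S.hasDerivAt_potential s).hasDerivWithinAt)
  intro x hx
  rw [interior_Ici] at hx
  exact S.g_pos hx

theorem hasDerivAt_fst (h : IsFlow (planeField F g) K φ) (p : ℝ × ℝ) (t : ℝ) :
    HasDerivAt (fun t => (φ t p).1) ((φ t p).2 - F (φ t p).1) t := by
  have h1 : HasFDerivAt Prod.fst (ContinuousLinearMap.fst ℝ ℝ ℝ) (φ t p) := hasFDerivAt_fst
  exact h1.comp_hasDerivAt t (h.hasDerivAt p t)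

theorem hasDerivAt_snd (h : IsFlow (planeField F g) K φ) (p : ℝ × ℝ) (t : ℝ) :
    HasDerivAt (fun t => (φ t p).2) (-g (φ t p).1) t := by
  have h1 : HasFDerivAt Prod.snd (ContinuousLinearMap.snd ℝ ℝ ℝ) (φ t p) := hasFDerivAt_snd
  exact h1.comp_hasDerivAt t (h.hasDerivAt p t)

/-- The two conservative contributions `± v g` cancel. What remains feeds energy in while `0 < x <
a`, where `F < 0`, and drains it while `x > a`. -/
theorem hasDerivAt_energy (S : LienardSystem F f g a c M) (h : IsFlow (planeField F g) K φ)
    (p : ℝ × ℝ) (t : ℝ) :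
    HasDerivAt (fun t => planeEnergy g (φ t p)) (-(g (φ t p).1 * F (φ t p).1)) t := by
  have h1 := (((hasDerivAt_snd h p t).fun_pow 2).div_const 2).fun_add
    ((S.hasDerivAt_potential _).comp t (hasDerivAt_fst h p t))
  convert! h1 using 1
  simp
  ring

theorem flow_zero (S : LienardSystem F f g a c M) (h : IsFlow (planeField F g) K φ) (t : ℝ) :
    φ t 0 = 0 := by
  have h1 : IsIntegralCurve (fun _ : ℝ => (0 : ℝ × ℝ)) (fun _ => planeField F g) := by
    apply isIntegralCurve_const
    simp [planeField, S.F_zero, S.g_zero]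
  exact (h.eq_of_isIntegralCurve _ h1 t).symm

theorem flow_ne_zero (S : LienardSystem F f g a c M) (h : IsFlow (planeField F g) K φ) {p : ℝ × ℝ}
    (hp : p ≠ 0) (t : ℝ) : φ t p ≠ 0 := by
  intro h0
  apply hp
  rw [← h.neg_cancel t p, h0, S.flow_zero h]

theorem continuous_flow_fst (h : IsFlow (planeField F g) K φ) (p : ℝ × ℝ) :
    Continuous fun t => (φ t p).1 := (h.continuous p).fst

theorem continuous_flow_snd (h : IsFlow (planeField F g) K φ) (p : ℝ × ℝ) :
    Continuous fun t => (φ t p).2 := (h.continuous p).snd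

end Basic

/-! ### Half-orbits -/

/-- The solution issued from `(0, v)`, `v > 0`, stays in `x > 0` until it reaches `(0, -p)`,
`p > 0`, at time `T`. -/
structure HalfOrbit (φ : ℝ → ℝ × ℝ → ℝ × ℝ) (T v p : ℝ) : Prop where
  T_pos : 0 < T
  v_pos : 0 < v
  p_pos : 0 < p
  flow_T : φ T (0, v) = (0, -p)
  pos : ∀ t, 0 < t → t < T → 0 < (φ t (0, v)).1

/-- Suppose `x` stays positive. Then the height `w` decreases. It cannot drop below `-M - 1`, where
`x' ≤ -1` for ever. The energy stays above a positive level, so close to the axis `|w|` is bounded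
below; a negative value would drive `x` through `0`, so `w` is positive there and `x` is pushed away
from the axis for good. From then on `w' ≤ -c δ`, and `w` falls without bound, a contradiction. -/
theorem exists_fst_nonpos (S : LienardSystem F f g a c M) (h : IsFlow (planeField F g) K φ)
    {v : ℝ} (hv : 0 < v) : ∃ t, 0 < t ∧ (φ t (0, v)).1 ≤ 0 := by
  by_contra! hpos
  set x := fun t => (φ t (0, v)).1 with hx
  set w := fun t => (φ t (0, v)).2 with hw
  have hx' : ∀ t, HasDerivAt x (w t - F (x t)) t := hasDerivAt_fst h (0, v)
  have hw' : ∀ t, HasDerivAt w (-g (x t)) t := hasDerivAt_snd h (0, v)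
  have hE' := S.hasDerivAt_energy h (0, v)
  have hx0 : x 0 = 0 := by simp [hx, h.zero]
  have hw0 : w 0 = v := by simp [hw, h.zero]
  have hxnn : ∀ t, 0 ≤ t → 0 ≤ x t := fun t ht => by
    rcases ht.eq_or_lt with rfl | ht
    · exact hx0.ge
    · exact (hpos t ht).le
  have hwanti : ∀ s t, 0 ≤ s → s ≤ t → w t ≤ w s := by
    intro s t hs hst
    have := le_sub_mul_of_hasDerivAt_le (m := 0) (t₀ := s) hw' (fun r hr => by
      have := S.le_g _ (hxnn r (hs.trans hr))
      have := mul_nonneg S.c_pos.le (hxnn r (hs.trans hr))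
      linarith) hst
    linarith
  -- a definite negative slope of `x` is impossible
  have hslope : ∀ t₀ m, 0 ≤ t₀ → 0 < m → ¬ ∀ t, t₀ ≤ t → w t - F (x t) ≤ -m := by
    intro t₀ m ht₀ hm hle
    have h1 : t₀ ≤ t₀ + (x t₀ + 1) / m := by
      have := div_pos (add_pos_of_nonneg_of_pos (hxnn t₀ ht₀) one_pos) hm
      linarith
    have h2 := le_sub_mul_of_hasDerivAt_le hx' hle h1
    rw [add_sub_cancel_left, mul_div_cancel₀ _ hm.ne'] at h2
    have := hxnn _ (ht₀.trans h1)
    linarith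
  have hwM : ∀ t, 0 ≤ t → -M - 1 ≤ w t := by
    intro t₀ ht₀
    by_contra! hlt
    refine hslope t₀ 1 ht₀ one_pos fun t ht => ?_
    have := hwanti t₀ t ht₀ ht
    have := S.le_F _ (hxnn t (ht₀.trans ht))
    linarith
  set G := fun x : ℝ => ∫ s in (0 : ℝ)..x, g s with hG
  have hG0 : G 0 = 0 := by simp [hG]
  have hGa : 0 < G a := by
    rw [← hG0]
    exact S.strictMonoOn_potential self_mem_Ici S.a_pos.le S.a_pos
  -- Below the initial energy `v² / 2`, and below `G a`: a point of energy `e₀` then has `x < a`,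
  -- where the energy is increasing, so this level is never crossed downwards.
  obtain ⟨e₀, he₀, he₀v, he₀a⟩ : ∃ e₀ > 0, e₀ < v ^ 2 / 2 ∧ e₀ < G a := by
    obtain ⟨e, h1, h2⟩ := exists_between (lt_min (by positivity : 0 < v ^ 2 / 2) hGa)
    exact ⟨e, h1, lt_min_iff.1 h2⟩
  have hE : ∀ t, 0 ≤ t → e₀ ≤ w t ^ 2 / 2 + G (x t) := by
    intro t ht
    have h1 := le_barrier_of_hasDerivAt (t₀ := 0) (B := -e₀) (fun t => (hE' t).fun_neg) (by
      simp only [planeEnergy, h.zero, intervalIntegral.integral_same]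
      linarith) (fun s hs heq => by
      have heq' : w s ^ 2 / 2 + G (x s) = e₀ := by
        have : w s ^ 2 / 2 + G (x s) = planeEnergy g (φ s (0, v)) := rfl
        linarith
      have hs' : 0 < s := by
        rcases hs.eq_or_lt with rfl | hs
        · rw [hw0, hx0, hG0] at heq'
          linarith
        · exact hs
      have hxa : x s < a := by
        by_contra! hle
        have := S.strictMonoOn_potential.monotoneOn S.a_pos.le (hpos s hs').le hle
        have := sq_nonneg (w s)
        simp only [hG] at *
        linarith
      have := mul_neg_of_pos_of_neg (S.g_pos (hpos s hs')) (S.F_neg _ (hpos s hs') hxa)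
      linarith) ht
    have : w t ^ 2 / 2 + G (x t) = planeEnergy g (φ t (0, v)) := rfl
    linarith
  set b := √e₀ with hb
  have hbpos : 0 < b := Real.sqrt_pos.2 he₀
  obtain ⟨δ, hδ, hδF⟩ : ∃ δ > 0, ∀ y, 0 ≤ y → y ≤ δ → |F y| < b / 2 ∧ G y < e₀ / 2 := by
    have h1 : ∀ᶠ y in 𝓝 (0 : ℝ), |F y| < b / 2 ∧ G y < e₀ / 2 := by
      apply Filter.Eventually.and
      · have : Tendsto (fun y => |F y|) (𝓝 0) (𝓝 |F 0|) := S.continuous_F.abs.tendsto 0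
        rw [S.F_zero, abs_zero] at this
        exact this.eventually (gt_mem_nhds (by positivity))
      · have : Tendsto G (𝓝 0) (𝓝 (G 0)) := (S.hasDerivAt_potential 0).continuousAt
        rw [hG0] at this
        exact this.eventually (gt_mem_nhds (by positivity))
    obtain ⟨δ, hδ, hball⟩ := Metric.eventually_nhds_iff.1 h1
    refine ⟨δ / 2, by positivity, fun y hy hy' => hball ?_⟩
    rw [Real.dist_eq, sub_zero, abs_of_nonneg hy]
    linarith
  -- In the strip `G < e₀ / 2`, so the energy bound forces `|w| ≥ b`. If `w ≤ -b`, it remains so,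
  -- and `|F| < b / 2` keeps `x' ≤ -b / 2`, which contradicts `x ≥ 0`.
  have hstrip : ∀ t, 0 ≤ t → x t ≤ δ → b ≤ w t := by
    intro t₀ ht₀ hxt
    have h1 := hE t₀ ht₀
    have h2 := (hδF _ (hxnn t₀ ht₀) hxt).2
    have h3 : b ^ 2 = e₀ := Real.sq_sqrt he₀.le
    by_contra! hlt
    have h4 : w t₀ ≤ -b := by
      by_contra! hlt'
      have := sq_lt_sq' hlt' hlt
      linarith
    have h5 : ∀ t, t₀ ≤ t → x t ≤ δ := fun t ht =>
      le_barrier_of_hasDerivAt hx' hxt (fun s hs heq => by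
        have := (abs_lt.1 (hδF _ (hxnn s (ht₀.trans hs)) heq.le).1).1
        have := hwanti t₀ s ht₀ hs
        linarith) ht
    refine hslope t₀ (b / 2) ht₀ (by positivity) fun t ht => ?_
    have := (abs_lt.1 (hδF _ (hxnn t (ht₀.trans ht)) (h5 t ht)).1).1
    have := hwanti t₀ t ht₀ ht
    linarith
  obtain ⟨t₁, ht₁, hxt₁⟩ : ∃ t₁, 0 ≤ t₁ ∧ δ ≤ x t₁ := by
    by_contra! hlt
    have h1 : (0 : ℝ) ≤ 2 * (δ + 1) / b := by positivity
    have h2 := le_sub_mul_of_hasDerivAt_le (t₀ := 0) (m := b / 2) (fun t => (hx' t).fun_neg)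
      (fun t ht => by
        have := (abs_lt.1 (hδF _ (hxnn t ht) (hlt t ht).le).1).2
        have := hstrip t ht (hlt t ht).le
        linarith) h1
    have h3 : b / 2 * (2 * (δ + 1) / b - 0) = δ + 1 := by
      field_simp
      ring
    rw [h3, hx0] at h2
    have := hlt _ h1
    linarith
  have hxδ : ∀ t, t₁ ≤ t → δ ≤ x t := by
    intro t ht
    have := le_barrier_of_hasDerivAt (B := -δ) (fun t => (hx' t).fun_neg) (neg_le_neg hxt₁)
      (fun s hs heq => by
        have heq' : x s = δ := neg_inj.1 heq
        have := (abs_lt.1 (hδF _ (hxnn s (ht₁.trans hs)) heq'.le).1).2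
        have := hstrip s (ht₁.trans hs) heq'.le
        linarith) ht
    linarith
  have hcδ := mul_pos S.c_pos hδ
  have h1 : t₁ ≤ t₁ + (w t₁ + M + 2) / (c * δ) := by
    have := div_nonneg (by linarith [hwM t₁ ht₁] : 0 ≤ w t₁ + M + 2) hcδ.le
    linarith
  have h2 := le_sub_mul_of_hasDerivAt_le (m := c * δ) hw' (fun t ht => by
    have := S.le_g _ (hxnn t (ht₁.trans ht))
    have := mul_le_mul_of_nonneg_left (hxδ t ht) S.c_pos.le
    linarith) h1
  rw [add_sub_cancel_left, mul_div_cancel₀ _ hcδ.ne'] at h2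
  have := hwM _ (ht₁.trans h1)
  linarith

theorem exists_halfOrbit (S : LienardSystem F f g a c M) (h : IsFlow (planeField F g) K φ)
    {v : ℝ} (hv : 0 < v) : ∃ T p, HalfOrbit φ T v p := by
  have hx' := hasDerivAt_fst h (0, v)
  have hcont := continuous_flow_fst h (0, v)
  have hx0 : (φ 0 (0, v)).1 = 0 := by simp [h.zero]
  have hnear := eventually_pos_of_hasDerivAt_pos (hx' 0) (by simpa [h.zero, S.F_zero]) hx0
  obtain ⟨η, hη, hηpos⟩ := (mem_nhdsGT_iff_exists_Ioo_subset (a := (0 : ℝ))).1 hnear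
  replace hη : (0 : ℝ) < η := hη
  obtain ⟨t₁, ht₁, ht₁'⟩ := S.exists_fst_nonpos h hv
  -- The bound `η ≤ t` discards the initial time, at which `x` vanishes already; its infimum is
  -- therefore the first return.
  set A := {t | η ≤ t ∧ (φ t (0, v)).1 ≤ 0} with hA
  have hAc : IsClosed A :=
    (isClosed_le continuous_const continuous_id).inter (isClosed_le hcont continuous_const)
  have hAne : A.Nonempty := by
    refine ⟨t₁, ?_, ht₁'⟩
    by_contra! hlt
    exact absurd (hηpos ⟨ht₁, hlt⟩) (not_lt.2 ht₁')
  have hAb : BddBelow A := ⟨η, fun t ht => ht.1⟩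
  obtain ⟨hTη, hT0⟩ := hAc.csInf_mem hAne hAb
  set T := sInf A
  have hTpos : 0 < T := hη.trans_le hTη
  have hpos : ∀ t, 0 < t → t < T → 0 < (φ t (0, v)).1 := by
    intro t ht htT
    by_contra! hle
    rcases lt_or_ge t η with htη | htη
    · exact absurd (hηpos ⟨ht, htη⟩) (not_lt.2 hle)
    · exact absurd (csInf_le hAb ⟨htη, hle⟩) (not_le.2 htT)
  have hxT : (φ T (0, v)).1 = 0 := by
    refine le_antisymm hT0 ?_
    refine ge_of_tendsto (hcont.continuousWithinAt (s := Iio T)).tendsto ?_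
    filter_upwards [Ioo_mem_nhdsLT hTpos] with t ht using (hpos t ht.1 ht.2).le
  -- On the axis `x' = v`. A positive height at `T` would mean that `x` was negative just before; a
  -- zero height is excluded since the origin is an equilibrium.
  have hwT : (φ T (0, v)).2 ≤ 0 := by
    by_contra! hlt
    have h1 := eventually_neg_of_hasDerivAt_pos (hx' T) (by rwa [hxT, S.F_zero, sub_zero]) hxT
    obtain ⟨t, ht, ht'⟩ := (h1.and (Ioo_mem_nhdsLT hTpos)).exists
    exact lt_asymm ht (hpos t ht'.1 ht'.2)
  have hne : (φ T (0, v)).2 ≠ 0 := fun h0 =>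
    S.flow_ne_zero h (p := (0, v)) (by simp [Prod.ext_iff, hv.ne']) T (Prod.ext hxT h0)
  exact ⟨T, -(φ T (0, v)).2, hTpos, hv, neg_pos.2 (lt_of_le_of_ne hwT hne),
    Prod.ext hxT (by simp), hpos⟩

end LienardSystem

/-! ### Inverse functions on compact intervals -/

/-- Used to parametrise arcs of orbits by abscissa or by height. Clamping to `[u s, u t]` makes the
inverse continuous on all of `ℝ`. Derivatives are claimed only in the interior, since `u'` vanishes
at the ends in the applications (`x' = 0` at the turning point, `v' = 0` on the axis). -/
theorem exists_inverse_of_deriv_pos {u u' : ℝ → ℝ} {s t : ℝ} (hst : s ≤ t) (hc : Continuous u)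
    (hd : ∀ r ∈ Ioo s t, HasDerivAt u (u' r) r) (hpos : ∀ r ∈ Ioo s t, 0 < u' r) :
    ∃ σ : ℝ → ℝ, Continuous σ ∧ σ (u s) = s ∧ σ (u t) = t ∧
      (∀ r ∈ Icc (u s) (u t), σ r ∈ Icc s t ∧ u (σ r) = r) ∧
      ∀ r ∈ Ioo (u s) (u t), σ r ∈ Ioo s t ∧ HasDerivAt σ (u' (σ r))⁻¹ r := by
  have hmono : StrictMonoOn u (Icc s t) := by
    refine strictMonoOn_of_hasDerivWithinAt_pos (f' := u') (convex_Icc s t) hc.continuousOn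
      (fun r hr => ?_) (fun r hr => ?_)
    · rw [interior_Icc] at hr
      exact (hd r hr).hasDerivWithinAt
    · rw [interior_Icc] at hr
      exact hpos r hr
  have hle : u s ≤ u t := hmono.monotoneOn ⟨le_rfl, hst⟩ ⟨hst, le_rfl⟩ hst
  have hproj : ∀ r, max (u s) (min r (u t)) ∈ Icc (u s) (u t) := fun r =>
    ⟨le_max_left _ _, max_le hle (min_le_right _ _)⟩
  have hex : ∀ r, ∃ y : Icc s t, u y = max (u s) (min r (u t)) := fun r => by
    obtain ⟨y, hy, h⟩ := intermediate_value_Icc hst hc.continuousOn (hproj r)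
    exact ⟨⟨y, hy⟩, h⟩
  choose σ hσ using hex
  have hid : ∀ r ∈ Icc (u s) (u t), max (u s) (min r (u t)) = r := fun r hr => by
    rw [min_eq_left hr.2, max_eq_right hr.1]
  have hinv : ∀ y : Icc s t, σ (u y) = y := fun y => by
    have h1 : u y ∈ Icc (u s) (u t) :=
      ⟨hmono.monotoneOn ⟨le_rfl, hst⟩ y.2 y.2.1, hmono.monotoneOn y.2 ⟨hst, le_rfl⟩ y.2.2⟩
    exact Subtype.ext (hmono.injOn (σ (u y)).2 y.2 ((hσ _).trans (hid _ h1)))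
  have hσmono : Monotone σ := fun r r' hr => by
    have h1 : u (σ r) ≤ u (σ r') := by
      rw [hσ, hσ]
      gcongr
    exact (hmono.le_iff_le (σ r).2 (σ r').2).1 h1
  have hcont : Continuous σ := hσmono.continuous_of_surjective fun y => ⟨u y, hinv y⟩
  have hcont' : Continuous fun r => (σ r : ℝ) := continuous_subtype_val.comp hcont
  refine ⟨fun r => σ r, hcont', congrArg Subtype.val (hinv ⟨s, le_rfl, hst⟩),
    congrArg Subtype.val (hinv ⟨t, hst, le_rfl⟩),
    fun r hr => ⟨(σ r).2, (hσ r).trans (hid r hr)⟩, fun r hr => ?_⟩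
  have hmem : (σ r : ℝ) ∈ Ioo s t := by
    have h1 : u (σ r) = r := (hσ r).trans (hid r (Ioo_subset_Icc_self hr))
    refine ⟨lt_of_le_of_ne (σ r).2.1 ?_, lt_of_le_of_ne (σ r).2.2 ?_⟩
    · intro h
      rw [← h] at h1
      exact hr.1.ne h1
    · intro h
      rw [h] at h1
      exact hr.2.ne' h1
  refine ⟨hmem, HasDerivAt.of_local_left_inverse hcont'.continuousAt (hd _ hmem)
    (hpos _ hmem).ne' ?_⟩
  filter_upwards [Ioo_mem_nhds hr.1 hr.2] with y hy
  exact (hσ y).trans (hid y (Ioo_subset_Icc_self hy))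

theorem exists_inverse_of_deriv_neg {u u' : ℝ → ℝ} {s t : ℝ} (hst : s ≤ t) (hc : Continuous u)
    (hd : ∀ r ∈ Ioo s t, HasDerivAt u (u' r) r) (hneg : ∀ r ∈ Ioo s t, u' r < 0) :
    ∃ σ : ℝ → ℝ, Continuous σ ∧ σ (u s) = s ∧ σ (u t) = t ∧
      (∀ r ∈ Icc (u t) (u s), σ r ∈ Icc s t ∧ u (σ r) = r) ∧
      ∀ r ∈ Ioo (u t) (u s), σ r ∈ Ioo s t ∧ HasDerivAt σ (u' (σ r))⁻¹ r := by
  obtain ⟨σ, h1, h2, h3, h4, h5⟩ := exists_inverse_of_deriv_pos (u := fun r => -u r)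
    (u' := fun r => -u' r) hst hc.neg (fun r hr => (hd r hr).fun_neg)
    (fun r hr => neg_pos.2 (hneg r hr))
  refine ⟨fun r => σ (-r), h1.comp continuous_neg, h2, h3, fun r hr => ?_, fun r hr => ?_⟩
  · obtain ⟨h, h'⟩ := h4 (-r) ⟨neg_le_neg hr.2, neg_le_neg hr.1⟩
    exact ⟨h, neg_inj.1 h'⟩
  · obtain ⟨h, h'⟩ := h5 (-r) ⟨neg_lt_neg hr.2, neg_lt_neg hr.1⟩
    refine ⟨h, ?_⟩
    have := h'.comp r (hasDerivAt_neg r)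
    simpa [Function.comp_def, inv_neg] using this

namespace LienardSystem

variable {F f g : ℝ → ℝ} {a c M K : ℝ} {φ : ℝ → ℝ × ℝ → ℝ × ℝ} {T v p T₁ v₁ p₁ T₂ v₂ p₂ : ℝ}

/-! ### The shape of a half-orbit -/

namespace HalfOrbit

theorem fst_zero (h : IsFlow (planeField F g) K φ) : (φ 0 (0, v)).1 = 0 := by rw [h.zero]

theorem snd_zero (h : IsFlow (planeField F g) K φ) : (φ 0 (0, v)).2 = v := by rw [h.zero]

theorem fst_T (H : HalfOrbit φ T v p) : (φ T (0, v)).1 = 0 := by rw [H.flow_T]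

theorem snd_T (H : HalfOrbit φ T v p) : (φ T (0, v)).2 = -p := by rw [H.flow_T]

theorem fst_nonneg (H : HalfOrbit φ T v p) (h : IsFlow (planeField F g) K φ) {t : ℝ} (h0 : 0 ≤ t)
    (hT : t ≤ T) : 0 ≤ (φ t (0, v)).1 := by
  rcases h0.eq_or_lt with rfl | h0
  · exact (fst_zero h).ge
  rcases hT.eq_or_lt with rfl | hT
  · exact H.fst_T.ge
  exact (H.pos t h0 hT).le

theorem strictAntiOn_snd (H : HalfOrbit φ T v p) (S : LienardSystem F f g a c M)
    (h : IsFlow (planeField F g) K φ) : StrictAntiOn (fun t => (φ t (0, v)).2) (Icc 0 T) := by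
  refine strictAntiOn_of_hasDerivWithinAt_neg (convex_Icc 0 T)
    (continuous_flow_snd h _).continuousOn
    (fun t _ => (hasDerivAt_snd h (0, v) t).hasDerivWithinAt) (fun t ht => ?_)
  rw [interior_Icc] at ht
  exact neg_neg_of_pos (S.g_pos (H.pos t ht.1 ht.2))

/-- The horizontal velocity changes sign exactly once, at time `s`. -/
structure Shape (F : ℝ → ℝ) (φ : ℝ → ℝ × ℝ → ℝ × ℝ) (T v s : ℝ) : Prop where
  s_pos : 0 < s
  s_lt : s < T
  up : ∀ t, 0 ≤ t → t < s → 0 < (φ t (0, v)).2 - F (φ t (0, v)).1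
  down : ∀ t, s < t → t ≤ T → (φ t (0, v)).2 - F (φ t (0, v)).1 < 0
  top : (φ s (0, v)).2 = F (φ s (0, v)).1

/-- The horizontal velocity `y = v - F(x)` satisfies `y' = -g(x) - f(x) y`. Multiplied by the
integrating factor `exp ∫ f(x)` it becomes strictly decreasing on the half-orbit, and it goes from
`v > 0` to a negative multiple of `p`, so it has a single zero. -/
theorem exists_shape (H : HalfOrbit φ T v p) (S : LienardSystem F f g a c M)
    (h : IsFlow (planeField F g) K φ) : ∃ s, Shape F φ T v s := by
  set x := fun t => (φ t (0, v)).1 with hx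
  set y := fun t => (φ t (0, v)).2 - F (x t) with hy
  have hxc : Continuous x := continuous_flow_fst h _
  set m := fun t => ∫ s in (0 : ℝ)..t, f (x s) with hm
  have hfx : Continuous fun t => f (x t) := S.continuous_f.comp hxc
  have hm' : ∀ t, HasDerivAt m (f (x t)) t := fun t =>
    intervalIntegral.integral_hasDerivAt_right (hfx.intervalIntegrable _ _)
      hfx.aestronglyMeasurable.stronglyMeasurableAtFilter hfx.continuousAt
  have hy' : ∀ t, HasDerivAt y (-g (x t) - f (x t) * y t) t := fun t =>
    (hasDerivAt_snd h (0, v) t).sub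
      ((S.hasDerivAt_F (x t)).comp t (hasDerivAt_fst h (0, v) t))
  have hz' : ∀ t, HasDerivAt (fun t => Real.exp (m t) * y t) (-(Real.exp (m t) * g (x t))) t := by
    intro t
    refine ((hm' t).exp.fun_mul (hy' t)).congr_deriv ?_
    ring
  have hanti : StrictAntiOn (fun t => Real.exp (m t) * y t) (Icc 0 T) := by
    refine strictAntiOn_of_hasDerivWithinAt_neg (convex_Icc 0 T)
      (fun t _ => (hz' t).continuousAt.continuousWithinAt)
      (fun t _ => (hz' t).hasDerivWithinAt) (fun t ht => ?_)
    rw [interior_Icc] at ht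
    exact neg_neg_of_pos (mul_pos (Real.exp_pos _) (S.g_pos (H.pos t ht.1 ht.2)))
  have hz0 : 0 < Real.exp (m 0) * y 0 := by
    apply mul_pos (Real.exp_pos _)
    simp only [hy, hx, snd_zero h, fst_zero h, S.F_zero, sub_zero]
    exact H.v_pos
  have hzT : Real.exp (m T) * y T < 0 := by
    apply mul_neg_of_pos_of_neg (Real.exp_pos _)
    simp only [hy, hx, H.snd_T, H.fst_T, S.F_zero, sub_zero]
    exact neg_neg_of_pos H.p_pos
  obtain ⟨s, hs, hs0⟩ := intermediate_value_Icc' H.T_pos.le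
    (f := fun t => Real.exp (m t) * y t)
    (fun t _ => (hz' t).continuousAt.continuousWithinAt) ⟨hzT.le, hz0.le⟩
  simp only at hs0
  refine ⟨s, lt_of_le_of_ne hs.1 ?_, lt_of_le_of_ne hs.2 ?_, fun t h0 hts => ?_,
    fun t hst htT => ?_, sub_eq_zero.1 ((mul_eq_zero.1 hs0).resolve_left (Real.exp_ne_zero _))⟩
  · rintro rfl
    exact hz0.ne' hs0
  · rintro rfl
    exact hzT.ne hs0
  · have := hanti ⟨h0, hts.le.trans hs.2⟩ hs hts
    simp only [hs0] at this
    exact pos_of_mul_pos_right this (Real.exp_pos _).le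
  · have := hanti hs ⟨hs.1.trans hst.le, htT⟩ hst
    simp only [hs0] at this
    exact neg_of_mul_neg_right this (Real.exp_pos _).le

variable {s s₁ s₂ : ℝ}

theorem Shape.strictMonoOn (Q : Shape F φ T v s) (h : IsFlow (planeField F g) K φ) :
    StrictMonoOn (fun t => (φ t (0, v)).1) (Icc 0 s) := by
  refine strictMonoOn_of_hasDerivWithinAt_pos (convex_Icc 0 s)
    (continuous_flow_fst h _).continuousOn
    (fun t _ => (hasDerivAt_fst h (0, v) t).hasDerivWithinAt) (fun t ht => ?_)
  rw [interior_Icc] at ht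
  exact Q.up t ht.1.le ht.2

theorem Shape.strictAntiOn (Q : Shape F φ T v s) (h : IsFlow (planeField F g) K φ) :
    StrictAntiOn (fun t => (φ t (0, v)).1) (Icc s T) := by
  refine strictAntiOn_of_hasDerivWithinAt_neg (convex_Icc s T)
    (continuous_flow_fst h _).continuousOn
    (fun t _ => (hasDerivAt_fst h (0, v) t).hasDerivWithinAt) (fun t ht => ?_)
  rw [interior_Icc] at ht
  exact Q.down t ht.1 ht.2.le

theorem Shape.fst_le (Q : Shape F φ T v s) (h : IsFlow (planeField F g) K φ) {t : ℝ} (h0 : 0 ≤ t)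
    (hT : t ≤ T) : (φ t (0, v)).1 ≤ (φ s (0, v)).1 := by
  rcases le_total t s with hts | hts
  · exact (Q.strictMonoOn h).monotoneOn ⟨h0, hts⟩ ⟨Q.s_pos.le, le_rfl⟩ hts
  · exact (Q.strictAntiOn h).antitoneOn ⟨le_rfl, Q.s_lt.le⟩ ⟨hts, hT⟩ hts

theorem energy_zero (h : IsFlow (planeField F g) K φ) : planeEnergy g (φ 0 (0, v)) = v ^ 2 / 2 := by
  simp [planeEnergy, h.zero]

theorem energy_T (H : HalfOrbit φ T v p) : planeEnergy g (φ T (0, v)) = p ^ 2 / 2 := by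
  simp [planeEnergy, H.flow_T]

/-- A half-orbit which stays in `x ≤ a` gains energy. -/
theorem lt_of_fst_le (H : HalfOrbit φ T v p) (S : LienardSystem F f g a c M)
    (h : IsFlow (planeField F g) K φ) (ha : ∀ t, 0 ≤ t → t ≤ T → (φ t (0, v)).1 ≤ a) : v < p := by
  obtain ⟨s, Q⟩ := H.exists_shape S h
  have hE := S.hasDerivAt_energy h (0, v)
  have h1 : StrictMonoOn (fun t => planeEnergy g (φ t (0, v))) (Icc 0 s) := by
    refine strictMonoOn_of_hasDerivWithinAt_pos (convex_Icc 0 s)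
      (fun t _ => (hE t).continuousAt.continuousWithinAt)
      (fun t _ => (hE t).hasDerivWithinAt) (fun t ht => ?_)
    rw [interior_Icc] at ht
    have hpos := H.pos t ht.1 (ht.2.trans Q.s_lt)
    have hlt : (φ t (0, v)).1 < a :=
      (Q.strictMonoOn h ⟨ht.1.le, ht.2.le⟩ ⟨Q.s_pos.le, le_rfl⟩ ht.2).trans_le
        (ha s Q.s_pos.le Q.s_lt.le)
    have := mul_neg_of_pos_of_neg (S.g_pos hpos) (S.F_neg _ hpos hlt)
    linarith
  have h2 : MonotoneOn (fun t => planeEnergy g (φ t (0, v))) (Icc s T) := by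
    refine monotoneOn_of_hasDerivWithinAt_nonneg (convex_Icc s T)
      (fun t _ => (hE t).continuousAt.continuousWithinAt)
      (fun t _ => (hE t).hasDerivWithinAt) (fun t ht => ?_)
    rw [interior_Icc] at ht
    have hpos := H.pos t (Q.s_pos.trans ht.1) ht.2
    have hF : F (φ t (0, v)).1 ≤ 0 := by
      rcases (ha t (Q.s_pos.trans ht.1).le ht.2.le).eq_or_lt with heq | hlt
      · rw [heq, S.F_a]
      · exact (S.F_neg _ hpos hlt).le
    have := mul_nonpos_of_nonneg_of_nonpos (S.g_pos hpos).le hF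
    linarith
  have h3 := h1 ⟨le_rfl, Q.s_pos.le⟩ ⟨Q.s_pos.le, le_rfl⟩ Q.s_pos
  have h4 := h2 ⟨le_rfl, Q.s_lt.le⟩ ⟨Q.s_lt.le, le_rfl⟩ Q.s_lt.le
  have h5 := h3.trans_le h4
  simp only [energy_zero h, H.energy_T] at h5
  exact lt_of_pow_lt_pow_left₀ 2 H.p_pos.le (by linarith)

/-! ### Nesting of half-orbits -/

/-- If they met, flowing back from the meeting point would put the start of one of them on the
other. But a half-orbit meets `x = 0` only at its start and at its end, and the end has negative
height. -/
theorem disjoint (H₁ : HalfOrbit φ T₁ v₁ p₁) (H₂ : HalfOrbit φ T₂ v₂ p₂)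
    (h : IsFlow (planeField F g) K φ) (hv : v₁ ≠ v₂) {t₁ t₂ : ℝ} (h₁ : 0 ≤ t₁) (h₁' : t₁ ≤ T₁)
    (h₂ : 0 ≤ t₂) (h₂' : t₂ ≤ T₂) : φ t₁ (0, v₁) ≠ φ t₂ (0, v₂) := by
  have key : ∀ {T v p w r : ℝ}, HalfOrbit φ T v p → 0 < w → v ≠ w → 0 ≤ r → r ≤ T →
      φ r (0, v) ≠ (0, w) := by
    intro T v p w r H hw hne h0 hT heq
    rcases h0.eq_or_lt with rfl | h0
    · rw [h.zero] at heq
      exact hne (congrArg Prod.snd heq)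
    rcases hT.eq_or_lt with rfl | hT
    · have := congrArg Prod.snd heq
      rw [H.snd_T] at this
      have := H.p_pos
      linarith
    · have := congrArg Prod.fst heq
      exact (H.pos r h0 hT).ne' this
  intro heq
  rcases le_total t₁ t₂ with hle | hle
  · refine key H₂ H₁.v_pos hv.symm (sub_nonneg.2 hle) (by linarith : t₂ - t₁ ≤ T₂) ?_
    rw [sub_eq_neg_add, h.add, ← heq, h.neg_cancel]
  · refine key H₁ H₂.v_pos hv (sub_nonneg.2 hle) (by linarith : t₁ - t₂ ≤ T₁) ?_
    rw [sub_eq_neg_add, h.add, heq, h.neg_cancel]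

/-- The time at which the half-orbit has a given height. -/
theorem exists_height_inverse (H : HalfOrbit φ T v p) (S : LienardSystem F f g a c M)
    (h : IsFlow (planeField F g) K φ) :
    ∃ ρ : ℝ → ℝ, Continuous ρ ∧ ρ v = 0 ∧ ρ (-p) = T ∧
      (∀ r ∈ Icc (-p) v, ρ r ∈ Icc 0 T ∧ (φ (ρ r) (0, v)).2 = r) ∧
      ∀ r ∈ Ioo (-p) v, ρ r ∈ Ioo 0 T ∧
        HasDerivAt ρ (-g (φ (ρ r) (0, v)).1)⁻¹ r := by
  have := exists_inverse_of_deriv_neg H.T_pos.le (continuous_flow_snd h (0, v))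
    (fun r _ => hasDerivAt_snd h (0, v) r)
    (fun r hr => neg_neg_of_pos (S.g_pos (H.pos r hr.1 hr.2)))
  rwa [snd_zero h, H.snd_T] at this

/-- Parametrise both by height. If `p₂ ≤ p₁`, the difference of abscissae is nonpositive at height
`-p₂` and nonnegative at height `v₁`; a zero in between is a common point. -/
theorem p_lt_p (H₁ : HalfOrbit φ T₁ v₁ p₁) (H₂ : HalfOrbit φ T₂ v₂ p₂)
    (S : LienardSystem F f g a c M) (h : IsFlow (planeField F g) K φ) (hv : v₁ < v₂) :
    p₁ < p₂ := by
  obtain ⟨ρ₁, hc₁, hv₁, hp₁, hi₁, -⟩ := H₁.exists_height_inverse S h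
  obtain ⟨ρ₂, hc₂, hv₂, hp₂, hi₂, hj₂⟩ := H₂.exists_height_inverse S h
  by_contra! hle
  have hv0 := H₁.v_pos
  have hp0 := H₂.p_pos
  have hcont : ContinuousOn (fun r => (φ (ρ₂ r) (0, v₂)).1 - (φ (ρ₁ r) (0, v₁)).1)
      (Icc (-p₂) v₁) :=
    (((continuous_flow_fst h _).comp hc₂).sub ((continuous_flow_fst h _).comp hc₁)).continuousOn
  have hmem : (-p₂) ∈ Icc (-p₁) v₁ := ⟨by linarith, by linarith⟩
  obtain ⟨r, hr, hr0⟩ := intermediate_value_Icc (by linarith : -p₂ ≤ v₁) hcont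
    (show (0 : ℝ) ∈ Icc _ _ by
      constructor
      · simp only [hp₂, H₂.fst_T, zero_sub, Left.neg_nonpos_iff]
        exact H₁.fst_nonneg h (hi₁ _ hmem).1.1 (hi₁ _ hmem).1.2
      · simp only [hv₁, fst_zero h, sub_zero]
        have := (hi₂ v₁ ⟨by linarith, hv.le⟩).1
        exact H₂.fst_nonneg h this.1 this.2)
  have hr₁ := hi₁ r ⟨by linarith [hr.1], hr.2⟩
  have hr₂ := hi₂ r ⟨hr.1, hr.2.trans hv.le⟩
  exact H₁.disjoint H₂ h hv.ne hr₁.1.1 hr₁.1.2 hr₂.1.1 hr₂.1.2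
    (Prod.ext (sub_eq_zero.1 hr0).symm (hr₁.2.trans hr₂.2.symm))

/-- Same intermediate value argument as for `p_lt_p`, between the given height and `v₁`: the
opposite inequality would make the half-orbits meet. -/
theorem fst_lt_of_snd_eq (H₁ : HalfOrbit φ T₁ v₁ p₁) (H₂ : HalfOrbit φ T₂ v₂ p₂)
    (S : LienardSystem F f g a c M) (h : IsFlow (planeField F g) K φ) (hv : v₁ < v₂) {t₁ t₂ : ℝ}
    (h₁ : 0 ≤ t₁) (h₁' : t₁ ≤ T₁) (h₂ : 0 ≤ t₂) (h₂' : t₂ ≤ T₂)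
    (heq : (φ t₁ (0, v₁)).2 = (φ t₂ (0, v₂)).2) : (φ t₁ (0, v₁)).1 < (φ t₂ (0, v₂)).1 := by
  obtain ⟨ρ₁, hc₁, hv₁, hp₁, hi₁, -⟩ := H₁.exists_height_inverse S h
  obtain ⟨ρ₂, hc₂, hv₂, hp₂, hi₂, hj₂⟩ := H₂.exists_height_inverse S h
  have hp := H₁.p_lt_p H₂ S h hv
  have hv0 := H₁.v_pos
  have hp0 := H₁.p_pos
  by_contra! hle
  have hanti₁ := H₁.strictAntiOn_snd S h
  have hanti₂ := H₂.strictAntiOn_snd S h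
  set r₀ := (φ t₁ (0, v₁)).2 with hr₀
  have hr₀mem : r₀ ∈ Icc (-p₁) v₁ := by
    constructor
    · have := hanti₁.antitoneOn ⟨h₁, h₁'⟩ ⟨H₁.T_pos.le, le_rfl⟩ h₁'
      simpa only [H₁.snd_T] using this
    · have := hanti₁.antitoneOn ⟨le_rfl, H₁.T_pos.le⟩ ⟨h₁, h₁'⟩ h₁
      simpa only [snd_zero h] using this
  have hr₀mem' : r₀ ∈ Icc (-p₂) v₂ := ⟨by linarith [hr₀mem.1], by linarith [hr₀mem.2]⟩
  have ht₁ : ρ₁ r₀ = t₁ :=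
    hanti₁.injOn (hi₁ _ hr₀mem).1 ⟨h₁, h₁'⟩ (hi₁ _ hr₀mem).2
  have ht₂ : ρ₂ r₀ = t₂ :=
    hanti₂.injOn (hi₂ _ hr₀mem').1 ⟨h₂, h₂'⟩ ((hi₂ _ hr₀mem').2.trans heq)
  have hcont : ContinuousOn (fun r => (φ (ρ₂ r) (0, v₂)).1 - (φ (ρ₁ r) (0, v₁)).1)
      (Icc r₀ v₁) :=
    (((continuous_flow_fst h _).comp hc₂).sub ((continuous_flow_fst h _).comp hc₁)).continuousOn
  obtain ⟨r, hr, hr0⟩ := intermediate_value_Icc hr₀mem.2 hcont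
    (show (0 : ℝ) ∈ Icc _ _ by
      constructor
      · simp only [ht₁, ht₂]
        linarith
      · simp only [hv₁, fst_zero h, sub_zero]
        have := (hi₂ v₁ ⟨by linarith, hv.le⟩).1
        exact H₂.fst_nonneg h this.1 this.2)
  have hr₁ := hi₁ r ⟨hr₀mem.1.trans hr.1, hr.2⟩
  have hr₂ := hi₂ r ⟨hr₀mem'.1.trans hr.1, hr.2.trans hv.le⟩
  exact H₁.disjoint H₂ h hv.ne hr₁.1.1 hr₁.1.2 hr₂.1.1 hr₂.1.2
    (Prod.ext (sub_eq_zero.1 hr0).symm (hr₁.2.trans hr₂.2.symm))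

/-- Otherwise the outer orbit passed, earlier on its rising branch, at the height of the inner
point. There it lay strictly to the right of that point, although `x` only grows along the rising
branch. The falling branch is treated in the same way in `snd_lt_of_fst_eq_down`. -/
theorem snd_lt_of_fst_eq_up (H₁ : HalfOrbit φ T₁ v₁ p₁) (H₂ : HalfOrbit φ T₂ v₂ p₂)
    (Q₂ : Shape F φ T₂ v₂ s₂)
    (S : LienardSystem F f g a c M) (h : IsFlow (planeField F g) K φ) (hv : v₁ < v₂) {t₁ t₂ : ℝ}
    (h₁ : 0 ≤ t₁) (h₁' : t₁ ≤ T₁) (h₂ : 0 ≤ t₂) (h₂' : t₂ ≤ s₂)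
    (heq : (φ t₁ (0, v₁)).1 = (φ t₂ (0, v₂)).1) : (φ t₁ (0, v₁)).2 < (φ t₂ (0, v₂)).2 := by
  by_contra! hle
  have hle' : (φ t₁ (0, v₁)).2 ≤ (φ 0 (0, v₂)).2 := by
    have := (H₁.strictAntiOn_snd S h).antitoneOn ⟨le_rfl, H₁.T_pos.le⟩ ⟨h₁, h₁'⟩ h₁
    simp only [snd_zero h] at this ⊢
    linarith
  obtain ⟨r, hr, hr'⟩ := intermediate_value_Icc' h₂ (f := fun t => (φ t (0, v₂)).2)
    (continuous_flow_snd h _).continuousOn ⟨hle, hle'⟩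
  have h3 := H₁.fst_lt_of_snd_eq H₂ S h hv h₁ h₁' hr.1 (hr.2.trans (h₂'.trans Q₂.s_lt.le)) hr'.symm
  have h4 := (Q₂.strictMonoOn h).monotoneOn ⟨hr.1, hr.2.trans h₂'⟩ ⟨h₂, h₂'⟩ hr.2
  linarith

theorem snd_lt_of_fst_eq_down (H₁ : HalfOrbit φ T₁ v₁ p₁) (H₂ : HalfOrbit φ T₂ v₂ p₂)
    (Q₂ : Shape F φ T₂ v₂ s₂)
    (S : LienardSystem F f g a c M) (h : IsFlow (planeField F g) K φ) (hv : v₁ < v₂) {t₁ t₂ : ℝ}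
    (h₁ : 0 ≤ t₁) (h₁' : t₁ ≤ T₁) (h₂ : s₂ ≤ t₂) (h₂' : t₂ ≤ T₂)
    (heq : (φ t₁ (0, v₁)).1 = (φ t₂ (0, v₂)).1) : (φ t₂ (0, v₂)).2 < (φ t₁ (0, v₁)).2 := by
  by_contra! hle
  have hle' : (φ T₂ (0, v₂)).2 ≤ (φ t₁ (0, v₁)).2 := by
    have := (H₁.strictAntiOn_snd S h).antitoneOn ⟨h₁, h₁'⟩ ⟨H₁.T_pos.le, le_rfl⟩ h₁'
    simp only [H₁.snd_T] at this
    have := H₁.p_lt_p H₂ S h hv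
    rw [H₂.snd_T]
    linarith
  obtain ⟨r, hr, hr'⟩ := intermediate_value_Icc' h₂' (f := fun t => (φ t (0, v₂)).2)
    (continuous_flow_snd h _).continuousOn ⟨hle', hle⟩
  have h3 := H₁.fst_lt_of_snd_eq H₂ S h hv h₁ h₁' (Q₂.s_pos.le.trans (h₂.trans hr.1)) hr.2 hr'.symm
  have h4 := (Q₂.strictAntiOn h).antitoneOn ⟨h₂, h₂'⟩ ⟨h₂.trans hr.1, hr.2⟩ hr.1
  linarith

end HalfOrbit

end LienardSystem

namespace LienardSystem

variable {F f g : ℝ → ℝ} {a c M K : ℝ} {φ : ℝ → ℝ × ℝ → ℝ × ℝ} {T v p T₁ v₁ p₁ T₂ v₂ p₂ : ℝ}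

namespace HalfOrbit

variable {s s₁ s₂ : ℝ}

/-! ### Comparison of the energy balance of two half-orbits -/

theorem F_nonneg (S : LienardSystem F f g a c M) {x : ℝ} (hx : a ≤ x) : 0 ≤ F x := by
  rw [← S.F_a]
  exact S.mono.monotoneOn self_mem_Ici hx hx

/-- Rising branches over `[0, a]`: the outer one gains less energy. -/
theorem energy_up_lt (H₁ : HalfOrbit φ T₁ v₁ p₁) (H₂ : HalfOrbit φ T₂ v₂ p₂)
    (Q₁ : Shape F φ T₁ v₁ s₁) (Q₂ : Shape F φ T₂ v₂ s₂) (S : LienardSystem F f g a c M)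
    (h : IsFlow (planeField F g) K φ) (hv : v₁ < v₂) {t₁ t₂ : ℝ}
    (h₁ : 0 ≤ t₁) (h₁' : t₁ ≤ s₁) (h₂ : 0 ≤ t₂) (h₂' : t₂ ≤ s₂)
    (ht₁ : (φ t₁ (0, v₁)).1 = a) (ht₂ : (φ t₂ (0, v₂)).1 = a) :
    planeEnergy g (φ t₂ (0, v₂)) - planeEnergy g (φ t₁ (0, v₁)) < v₂ ^ 2 / 2 - v₁ ^ 2 / 2 := by
  obtain ⟨σ₁, hc₁, hz₁, ha₁, hi₁, hj₁⟩ := exists_inverse_of_deriv_pos h₁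
    (continuous_flow_fst h (0, v₁)) (fun r _ => hasDerivAt_fst h (0, v₁) r)
    (fun r hr => Q₁.up r hr.1.le (hr.2.trans_le h₁'))
  obtain ⟨σ₂, hc₂, hz₂, ha₂, hi₂, hj₂⟩ := exists_inverse_of_deriv_pos h₂
    (continuous_flow_fst h (0, v₂)) (fun r _ => hasDerivAt_fst h (0, v₂) r)
    (fun r hr => Q₂.up r hr.1.le (hr.2.trans_le h₂'))
  rw [fst_zero h] at hz₁ hz₂
  rw [ht₁] at ha₁
  rw [ht₂] at ha₂
  rw [fst_zero h, ht₁] at hi₁ hj₁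
  rw [fst_zero h, ht₂] at hi₂ hj₂
  have hE₁ := S.hasDerivAt_energy h (0, v₁)
  have hE₂ := S.hasDerivAt_energy h (0, v₂)
  have hEc₁ : Continuous fun t => planeEnergy g (φ t (0, v₁)) :=
    continuous_iff_continuousAt.2 fun t => (hE₁ t).continuousAt
  have hEc₂ : Continuous fun t => planeEnergy g (φ t (0, v₂)) :=
    continuous_iff_continuousAt.2 fun t => (hE₂ t).continuousAt
  -- As a function of abscissa, `dE / dx = -g F / (v - F)`, with `-g F > 0`. The outer branch has
  -- the larger `v - F > 0`, hence the smaller rate.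
  have hanti : StrictAntiOn (fun r => planeEnergy g (φ (σ₂ r) (0, v₂)) -
      planeEnergy g (φ (σ₁ r) (0, v₁))) (Icc 0 a) := by
    apply strictAntiOn_of_deriv_neg (convex_Icc 0 a)
      ((hEc₂.comp hc₂).sub (hEc₁.comp hc₁)).continuousOn
    intro r hr
    rw [interior_Icc] at hr
    have hr' := Ioo_subset_Icc_self hr
    have hd₁ := (hE₁ (σ₁ r)).comp r (hj₁ r hr).2
    have hd₂ := (hE₂ (σ₂ r)).comp r (hj₂ r hr).2
    have hd := hd₂.sub hd₁
    simp only [(hi₁ r hr').2, (hi₂ r hr').2] at hd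
    have := hd.deriv
    simp only [Function.comp_def] at this
    refine (this.trans_lt ?_)
    have hlt := H₁.snd_lt_of_fst_eq_up H₂ Q₂ S h hv (hi₁ r hr').1.1
      ((hi₁ r hr').1.2.trans (h₁'.trans Q₁.s_lt.le)) (hi₂ r hr').1.1
      ((hi₂ r hr').1.2.trans h₂') ((hi₁ r hr').2.trans (hi₂ r hr').2.symm)
    have hup := Q₁.up (σ₁ r) (hi₁ r hr').1.1 ((hj₁ r hr).1.2.trans_le h₁')
    rw [(hi₁ r hr').2] at hup
    have hinv := (inv_lt_inv₀ (hup.trans (sub_lt_sub_right hlt (F r))) hup).2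
      (sub_lt_sub_right hlt (F r))
    have := mul_neg_of_pos_of_neg (S.g_pos hr.1) (S.F_neg r hr.1 hr.2)
    have := mul_lt_mul_of_pos_left hinv (neg_pos.2 this)
    linarith
  have := hanti ⟨le_rfl, S.a_pos.le⟩ ⟨S.a_pos.le, le_rfl⟩ S.a_pos
  simp only [hz₁, hz₂, ha₁, ha₂, energy_zero h] at this
  exact this

/-- Falling branches over `[0, a]`: the outer one gains less energy. -/
theorem energy_down_lt (H₁ : HalfOrbit φ T₁ v₁ p₁) (H₂ : HalfOrbit φ T₂ v₂ p₂)
    (Q₁ : Shape F φ T₁ v₁ s₁) (Q₂ : Shape F φ T₂ v₂ s₂) (S : LienardSystem F f g a c M)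
    (h : IsFlow (planeField F g) K φ) (hv : v₁ < v₂) {t₁ t₂ : ℝ}
    (h₁ : s₁ ≤ t₁) (h₁' : t₁ ≤ T₁) (h₂ : s₂ ≤ t₂) (h₂' : t₂ ≤ T₂)
    (ht₁ : (φ t₁ (0, v₁)).1 = a) (ht₂ : (φ t₂ (0, v₂)).1 = a) :
    p₂ ^ 2 / 2 - p₁ ^ 2 / 2 < planeEnergy g (φ t₂ (0, v₂)) - planeEnergy g (φ t₁ (0, v₁)) := by
  obtain ⟨σ₁, hc₁, ha₁, hz₁, hi₁, hj₁⟩ := exists_inverse_of_deriv_neg h₁'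
    (continuous_flow_fst h (0, v₁)) (fun r _ => hasDerivAt_fst h (0, v₁) r)
    (fun r hr => Q₁.down r (h₁.trans_lt hr.1) hr.2.le)
  obtain ⟨σ₂, hc₂, ha₂, hz₂, hi₂, hj₂⟩ := exists_inverse_of_deriv_neg h₂'
    (continuous_flow_fst h (0, v₂)) (fun r _ => hasDerivAt_fst h (0, v₂) r)
    (fun r hr => Q₂.down r (h₂.trans_lt hr.1) hr.2.le)
  rw [H₁.fst_T] at hz₁
  rw [H₂.fst_T] at hz₂
  rw [ht₁] at ha₁
  rw [ht₂] at ha₂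
  rw [H₁.fst_T, ht₁] at hi₁ hj₁
  rw [H₂.fst_T, ht₂] at hi₂ hj₂
  have hE₁ := S.hasDerivAt_energy h (0, v₁)
  have hE₂ := S.hasDerivAt_energy h (0, v₂)
  have hEc₁ : Continuous fun t => planeEnergy g (φ t (0, v₁)) :=
    continuous_iff_continuousAt.2 fun t => (hE₁ t).continuousAt
  have hEc₂ : Continuous fun t => planeEnergy g (φ t (0, v₂)) :=
    continuous_iff_continuousAt.2 fun t => (hE₂ t).continuousAt
  -- Again `dE / dx = -g F / (v - F)`, now with `v - F < 0` and more negative on the outer branch,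
  -- so the difference increases with `x`. Time runs from `x = a` to `x = 0`, so the outer branch
  -- gains less.
  have hmono : StrictMonoOn (fun r => planeEnergy g (φ (σ₂ r) (0, v₂)) -
      planeEnergy g (φ (σ₁ r) (0, v₁))) (Icc 0 a) := by
    apply strictMonoOn_of_deriv_pos (convex_Icc 0 a)
      ((hEc₂.comp hc₂).sub (hEc₁.comp hc₁)).continuousOn
    intro r hr
    rw [interior_Icc] at hr
    have hr' := Ioo_subset_Icc_self hr
    have hd₁ := (hE₁ (σ₁ r)).comp r (hj₁ r hr).2
    have hd₂ := (hE₂ (σ₂ r)).comp r (hj₂ r hr).2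
    have hd := hd₂.sub hd₁
    simp only [(hi₁ r hr').2, (hi₂ r hr').2] at hd
    have := hd.deriv
    simp only [Function.comp_def] at this
    refine lt_of_lt_of_eq ?_ this.symm
    have hlt := H₁.snd_lt_of_fst_eq_down H₂ Q₂ S h hv (Q₁.s_pos.le.trans (h₁.trans (hi₁ r hr').1.1))
      (hi₁ r hr').1.2 (h₂.trans (hi₂ r hr').1.1)
      (hi₂ r hr').1.2 ((hi₁ r hr').2.trans (hi₂ r hr').2.symm)
    have hdown := Q₁.down (σ₁ r) (h₁.trans_lt (hj₁ r hr).1.1) (hi₁ r hr').1.2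
    rw [(hi₁ r hr').2] at hdown
    have hinv := (inv_lt_inv_of_neg hdown ((sub_lt_sub_right hlt (F r)).trans hdown)).2
      (sub_lt_sub_right hlt (F r))
    have := mul_neg_of_pos_of_neg (S.g_pos hr.1) (S.F_neg r hr.1 hr.2)
    have := mul_lt_mul_of_pos_left hinv (neg_pos.2 this)
    linarith
  have := hmono ⟨le_rfl, S.a_pos.le⟩ ⟨S.a_pos.le, le_rfl⟩ S.a_pos
  simp only [hz₁, hz₂, ha₁, ha₂, H₁.energy_T, H₂.energy_T] at this
  exact this

/-- Middle parts, in `x ≥ a`: the outer one loses more energy. -/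
theorem energy_middle_le (H₁ : HalfOrbit φ T₁ v₁ p₁) (H₂ : HalfOrbit φ T₂ v₂ p₂)
    (Q₂ : Shape F φ T₂ v₂ s₂) (S : LienardSystem F f g a c M)
    (h : IsFlow (planeField F g) K φ) (hv : v₁ < v₂) {t₁ t₂ r₁ r₂ : ℝ}
    (h₁ : 0 ≤ t₁) (htr₁ : t₁ ≤ r₁) (h₁' : r₁ ≤ T₁) (h₂ : 0 ≤ t₂) (hts : t₂ ≤ s₂) (hsr : s₂ ≤ r₂)
    (h₂' : r₂ ≤ T₂) (ht : (φ t₁ (0, v₁)).1 = (φ t₂ (0, v₂)).1)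
    (hr : (φ r₁ (0, v₁)).1 = (φ r₂ (0, v₂)).1)
    (ha₁ : ∀ t, t₁ ≤ t → t ≤ r₁ → a ≤ (φ t (0, v₁)).1)
    (ha₂ : ∀ t, t₂ ≤ t → t ≤ r₂ → a ≤ (φ t (0, v₂)).1) :
    planeEnergy g (φ r₂ (0, v₂)) - planeEnergy g (φ r₁ (0, v₁)) ≤
      planeEnergy g (φ t₂ (0, v₂)) - planeEnergy g (φ t₁ (0, v₁)) := by
  obtain ⟨ρ₁, hc₁, hv₁, hp₁, hi₁, hj₁⟩ := H₁.exists_height_inverse S h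
  obtain ⟨ρ₂, hc₂, hv₂, hp₂, hi₂, hj₂⟩ := H₂.exists_height_inverse S h
  have hp := H₁.p_lt_p H₂ S h hv
  have hanti₁ := H₁.strictAntiOn_snd S h
  have hanti₂ := H₂.strictAntiOn_snd S h
  have hE₁ := S.hasDerivAt_energy h (0, v₁)
  have hE₂ := S.hasDerivAt_energy h (0, v₂)
  have hEc₁ : Continuous fun t => planeEnergy g (φ t (0, v₁)) :=
    continuous_iff_continuousAt.2 fun t => (hE₁ t).continuousAt
  have hEc₂ : Continuous fun t => planeEnergy g (φ t (0, v₂)) :=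
    continuous_iff_continuousAt.2 fun t => (hE₂ t).continuousAt
  have hrange : ∀ t, 0 ≤ t → t ≤ T₁ → (φ t (0, v₁)).2 ∈ Icc (-p₁) v₁ := by
    intro t h0 hT
    constructor
    · have := hanti₁.antitoneOn ⟨h0, hT⟩ ⟨H₁.T_pos.le, le_rfl⟩ hT
      simpa only [H₁.snd_T] using this
    · have := hanti₁.antitoneOn ⟨le_rfl, H₁.T_pos.le⟩ ⟨h0, hT⟩ h0
      simpa only [snd_zero h] using this
  have hsub : ∀ r, r ∈ Icc (-p₁) v₁ → r ∈ Ioo (-p₂) v₂ := fun r hr =>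
    ⟨(neg_lt_neg hp).trans_le hr.1, hr.2.trans_lt hv⟩
  have hinv₁ : ∀ t, 0 ≤ t → t ≤ T₁ → ρ₁ (φ t (0, v₁)).2 = t := fun t h0 hT =>
    hanti₁.injOn (hi₁ _ (hrange t h0 hT)).1 ⟨h0, hT⟩ (hi₁ _ (hrange t h0 hT)).2
  have hAmem := hrange t₁ h₁ (htr₁.trans h₁')
  have hBmem := hrange r₁ (h₁.trans htr₁) h₁'
  have hρt := hinv₁ t₁ h₁ (htr₁.trans h₁')
  have hρr := hinv₁ r₁ (h₁.trans htr₁) h₁'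
  set A := (φ t₁ (0, v₁)).2 with hA
  set B := (φ r₁ (0, v₁)).2 with hB
  have hBA : B ≤ A := hanti₁.antitoneOn ⟨h₁, htr₁.trans h₁'⟩ ⟨h₁.trans htr₁, h₁'⟩ htr₁
  have hA₂ := hi₂ A (Ioo_subset_Icc_self (hsub A hAmem))
  have hB₂ := hi₂ B (Ioo_subset_Icc_self (hsub B hBmem))
  have hup := H₁.snd_lt_of_fst_eq_up H₂ Q₂ S h hv h₁ (htr₁.trans h₁') h₂ hts ht
  have hdown := H₁.snd_lt_of_fst_eq_down H₂ Q₂ S h hv (h₁.trans htr₁) h₁' hsr h₂' hr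
  -- The outer arc enters `x ≥ a` above height `A` and leaves it below height `B`. It contains a
  -- subarc with the same heights as the inner arc; on the two extra pieces it loses energy, since
  -- `F ≥ 0` there.
  have htA : t₂ ≤ ρ₂ A := by
    refine ((hanti₂.lt_iff_gt hA₂.1 ⟨h₂, hts.trans Q₂.s_lt.le⟩).1 ?_).le
    simpa only [hA₂.2] using hup
  have hBr : ρ₂ B ≤ r₂ := by
    refine ((hanti₂.lt_iff_gt ⟨Q₂.s_pos.le.trans hsr, h₂'⟩ hB₂.1).1 ?_).le
    simpa only [hB₂.2] using hdown
  have hAB : ρ₂ A ≤ ρ₂ B := by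
    refine (hanti₂.le_iff_ge hB₂.1 hA₂.1).1 ?_
    simpa only [hA₂.2, hB₂.2] using hBA
  have hEanti : AntitoneOn (fun t => planeEnergy g (φ t (0, v₂))) (Icc t₂ r₂) := by
    refine antitoneOn_of_hasDerivWithinAt_nonpos (convex_Icc _ _) hEc₂.continuousOn
      (fun t _ => (hE₂ t).hasDerivWithinAt) (fun t ht => ?_)
    have ht' := interior_subset ht
    have hx := ha₂ t ht'.1 ht'.2
    have := mul_nonneg (S.g_pos (S.a_pos.trans_le hx)).le (F_nonneg S hx)
    linarith
  have e₁ := hEanti ⟨le_rfl, hts.trans hsr⟩ ⟨htA, hAB.trans hBr⟩ htA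
  have e₂ := hEanti ⟨htA.trans hAB, hBr⟩ ⟨hts.trans hsr, le_rfl⟩ hBr
  -- Parametrised by height, `dE / dv = F(x)`, because `dv / dt = -g`. At equal height the outer
  -- orbit has larger `x`, and `F` increases beyond `a`; the height runs downwards in time, so the
  -- outer orbit loses at least as much.
  have hmono : MonotoneOn (fun r => planeEnergy g (φ (ρ₂ r) (0, v₂)) -
      planeEnergy g (φ (ρ₁ r) (0, v₁))) (Icc B A) := by
    have hder : ∀ r ∈ Ioo B A, HasDerivAt (fun r => planeEnergy g (φ (ρ₂ r) (0, v₂)) -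
        planeEnergy g (φ (ρ₁ r) (0, v₁)))
        (F (φ (ρ₂ r) (0, v₂)).1 - F (φ (ρ₁ r) (0, v₁)).1) r := by
      intro r hr
      have hr₁ : r ∈ Ioo (-p₁) v₁ := ⟨hBmem.1.trans_lt hr.1, hr.2.trans_le hAmem.2⟩
      have hr₂ := hsub r (Ioo_subset_Icc_self hr₁)
      have hd₁ := (hE₁ (ρ₁ r)).comp r (hj₁ r hr₁).2
      have hd₂ := (hE₂ (ρ₂ r)).comp r (hj₂ r hr₂).2
      have hg₁ := (S.g_pos (H₁.pos _ (hj₁ r hr₁).1.1 (hj₁ r hr₁).1.2)).ne'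
      have hg₂ := (S.g_pos (H₂.pos _ (hj₂ r hr₂).1.1 (hj₂ r hr₂).1.2)).ne'
      refine (hd₂.sub hd₁).congr_deriv ?_
      field_simp
    refine monotoneOn_of_hasDerivWithinAt_nonneg (convex_Icc _ _)
      ((hEc₂.comp hc₂).sub (hEc₁.comp hc₁)).continuousOn
      (fun r hr => (hder r (by rwa [interior_Icc] at hr)).hasDerivWithinAt) (fun r hr => ?_)
    rw [interior_Icc] at hr
    have hr₁ : r ∈ Icc (-p₁) v₁ := ⟨hBmem.1.trans hr.1.le, hr.2.le.trans hAmem.2⟩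
    have hr₂ := Ioo_subset_Icc_self (hsub r hr₁)
    have hlt := H₁.fst_lt_of_snd_eq H₂ S h hv (hi₁ r hr₁).1.1 (hi₁ r hr₁).1.2 (hi₂ r hr₂).1.1
      (hi₂ r hr₂).1.2 ((hi₁ r hr₁).2.trans (hi₂ r hr₂).2.symm)
    have hx := ha₁ (ρ₁ r) (by
      refine ((hanti₁.lt_iff_gt (hi₁ r hr₁).1 ⟨h₁, htr₁.trans h₁'⟩).1 ?_).le
      simpa only [(hi₁ r hr₁).2] using hr.2) (by
      refine ((hanti₁.lt_iff_gt ⟨h₁.trans htr₁, h₁'⟩ (hi₁ r hr₁).1).1 ?_).le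
      simpa only [(hi₁ r hr₁).2] using hr.1)
    exact sub_nonneg.2 (S.mono.monotoneOn hx (hx.trans hlt.le) hlt.le)
  have e₃ := hmono ⟨le_rfl, hBA⟩ ⟨hBA, le_rfl⟩ hBA
  simp only [hρt, hρr] at e₁ e₂ e₃
  linarith

/-- The part of a half-orbit in `x ≥ a`. -/
theorem Shape.exists_times (Q : Shape F φ T v s) (H : HalfOrbit φ T v p)
    (S : LienardSystem F f g a c M)
    (h : IsFlow (planeField F g) K φ) (ha : a ≤ (φ s (0, v)).1) :
    ∃ t r, 0 ≤ t ∧ t ≤ s ∧ s ≤ r ∧ r ≤ T ∧ (φ t (0, v)).1 = a ∧ (φ r (0, v)).1 = a ∧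
      ∀ q, t ≤ q → q ≤ r → a ≤ (φ q (0, v)).1 := by
  obtain ⟨t, ht, hta⟩ := intermediate_value_Icc Q.s_pos.le (f := fun t => (φ t (0, v)).1)
    (continuous_flow_fst h _).continuousOn ⟨by rw [fst_zero h]; exact S.a_pos.le, ha⟩
  obtain ⟨r, hr, hra⟩ := intermediate_value_Icc' Q.s_lt.le (f := fun t => (φ t (0, v)).1)
    (continuous_flow_fst h _).continuousOn ⟨by rw [H.fst_T]; exact S.a_pos.le, ha⟩
  refine ⟨t, r, ht.1, ht.2, hr.1, hr.2, hta, hra, fun q htq hqr => ?_⟩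
  rcases le_total q s with hqs | hqs
  · have := (Q.strictMonoOn h).monotoneOn ht ⟨ht.1.trans htq, hqs⟩ htq
    exact hta.ge.trans this
  · have := (Q.strictAntiOn h).antitoneOn ⟨hqs, hqr.trans hr.2⟩ hr hqr
    exact hra.ge.trans this

/-- A half-orbit outside one that reaches `x = a` also reaches `x = a`. -/
theorem reaches_of_lt (H₁ : HalfOrbit φ T₁ v₁ p₁) (H₂ : HalfOrbit φ T₂ v₂ p₂)
    (S : LienardSystem F f g a c M) (h : IsFlow (planeField F g) K φ) (hv : v₁ < v₂)
    (ha : ∃ t, 0 ≤ t ∧ t ≤ T₁ ∧ a ≤ (φ t (0, v₁)).1) :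
    ∃ t, 0 ≤ t ∧ t ≤ T₂ ∧ a ≤ (φ t (0, v₂)).1 := by
  obtain ⟨t, h0, hT, hat⟩ := ha
  have hp := H₁.p_lt_p H₂ S h hv
  have hanti₁ := H₁.strictAntiOn_snd S h
  obtain ⟨r, hr, hr'⟩ := intermediate_value_Icc' H₂.T_pos.le (f := fun t => (φ t (0, v₂)).2)
    (continuous_flow_snd h _).continuousOn (show (φ t (0, v₁)).2 ∈ Icc _ _ by
      have h1 := hanti₁.antitoneOn ⟨h0, hT⟩ ⟨H₁.T_pos.le, le_rfl⟩ hT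
      have h2 := hanti₁.antitoneOn ⟨le_rfl, H₁.T_pos.le⟩ ⟨h0, hT⟩ h0
      simp only [H₁.snd_T, snd_zero h] at h1 h2
      simp only [H₂.snd_T, snd_zero h]
      constructor <;> linarith)
  exact ⟨r, hr.1, hr.2, hat.trans (H₁.fst_lt_of_snd_eq H₂ S h hv h0 hT hr.1 hr.2 hr'.symm).le⟩

/-- Among the half-orbits which reach `x = a`, the energy gain strictly decreases. -/
theorem energy_gain_lt (H₁ : HalfOrbit φ T₁ v₁ p₁) (H₂ : HalfOrbit φ T₂ v₂ p₂)
    (S : LienardSystem F f g a c M) (h : IsFlow (planeField F g) K φ) (hv : v₁ < v₂)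
    (ha : ∃ t, 0 ≤ t ∧ t ≤ T₁ ∧ a ≤ (φ t (0, v₁)).1) :
    p₂ ^ 2 - v₂ ^ 2 < p₁ ^ 2 - v₁ ^ 2 := by
  obtain ⟨s₁, Q₁⟩ := H₁.exists_shape S h
  obtain ⟨s₂, Q₂⟩ := H₂.exists_shape S h
  obtain ⟨q₂, h0, hT, hq₂⟩ := H₁.reaches_of_lt H₂ S h hv ha
  obtain ⟨q₁, h0', hT', hq₁⟩ := ha
  obtain ⟨t₁, r₁, b1, b2, b3, b4, b5, b6, b7⟩ :=
    Q₁.exists_times H₁ S h (hq₁.trans (Q₁.fst_le h h0' hT'))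
  obtain ⟨t₂, r₂, d1, d2, d3, d4, d5, d6, d7⟩ :=
    Q₂.exists_times H₂ S h (hq₂.trans (Q₂.fst_le h h0 hT))
  have e1 := H₁.energy_up_lt H₂ Q₁ Q₂ S h hv b1 b2 d1 d2 b5 d5
  have e2 := H₁.energy_middle_le H₂ Q₂ S h hv b1 (b2.trans b3) b4 d1 d2 d3 d4
    (b5.trans d5.symm) (b6.trans d6.symm) b7 d7
  have e3 := H₁.energy_down_lt H₂ Q₁ Q₂ S h hv b3 b4 d3 d4 b6 d6
  linarith

end HalfOrbit

end LienardSystem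

namespace LienardSystem

variable {F f g : ℝ → ℝ} {a c M K B : ℝ} {φ : ℝ → ℝ × ℝ → ℝ × ℝ} {T v p : ℝ}

/-! ### The half-return map and its fixed point -/

/-- As `F ≥ -M`, the quantity `E + M v` does not increase along a half-orbit. At the turning point
`v = F(x)`, which is nonnegative if `x > a`; the energy there would be more than `G a` and at most
`v² / 2 + M v`. For small `v` this is impossible, so the half-orbit stays in `x ≤ a` and gains
energy. -/
theorem HalfOrbit.exists_small (S : LienardSystem F f g a c M) (h : IsFlow (planeField F g) K φ) :
    ∃ r > 0, ∀ T v p, HalfOrbit φ T v p → v < r → v < p := by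
  have hM : 0 ≤ M := by
    have := S.le_F 0 le_rfl
    rw [S.F_zero] at this
    linarith
  have hGa : 0 < ∫ s in (0 : ℝ)..a, g s := by
    have := S.strictMonoOn_potential self_mem_Ici S.a_pos.le S.a_pos
    simpa using this
  set e := ∫ s in (0 : ℝ)..a, g s with he
  -- For `v < 1` one has `v² / 2 + M v ≤ v (1 + M)`, and the second bound makes this smaller than
  -- `e`.
  refine ⟨min 1 (e / (1 + M)), by positivity, fun T v p H hv => ?_⟩
  obtain ⟨s, Q⟩ := H.exists_shape S h
  refine H.lt_of_fst_le S h fun t h0 hT => (Q.fst_le h h0 hT).trans ?_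
  by_contra! hlt
  have hd : ∀ t, HasDerivAt (fun t => planeEnergy g (φ t (0, v)) + M * (φ t (0, v)).2)
      (-(g (φ t (0, v)).1 * F (φ t (0, v)).1) + M * -g (φ t (0, v)).1) t := fun t =>
    (S.hasDerivAt_energy h (0, v) t).fun_add ((hasDerivAt_snd h (0, v) t).const_mul M)
  have hanti : AntitoneOn (fun t => planeEnergy g (φ t (0, v)) + M * (φ t (0, v)).2)
      (Icc 0 T) := by
    refine antitoneOn_of_hasDerivWithinAt_nonpos (convex_Icc _ _)
      (fun t _ => (hd t).continuousAt.continuousWithinAt)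
      (fun t _ => (hd t).hasDerivWithinAt) (fun t ht => ?_)
    rw [interior_Icc] at ht
    have hx := H.pos t ht.1 ht.2
    have h1 := S.le_F _ hx.le
    have := mul_nonneg (S.g_pos hx).le (by linarith : 0 ≤ F (φ t (0, v)).1 + M)
    linarith
  have h1 := hanti ⟨le_rfl, H.T_pos.le⟩ ⟨Q.s_pos.le, Q.s_lt.le⟩ Q.s_pos.le
  simp only [HalfOrbit.energy_zero h, HalfOrbit.snd_zero h, Q.top] at h1
  have h2 := HalfOrbit.F_nonneg S hlt.le
  have h3 : e < planeEnergy g (φ s (0, v)) := by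
    have h4 := S.strictMonoOn_potential S.a_pos.le (S.a_pos.trans hlt).le hlt
    have h5 := sq_nonneg (φ s (0, v)).2
    simp only [planeEnergy]
    simp only at h4
    linarith
  have h6 : v < 1 := hv.trans_le (min_le_left _ _)
  have h7 : v * (1 + M) < e := (lt_div_iff₀ (by positivity)).1 (hv.trans_le (min_le_right _ _))
  have h8 : v ^ 2 / 2 ≤ v := by nlinarith [H.v_pos]
  have := mul_nonneg hM h2
  linarith

theorem HalfOrbit.unique {T₁ T₂ p₁ p₂ : ℝ} (H₁ : HalfOrbit φ T₁ v p₁) (H₂ : HalfOrbit φ T₂ v p₂) :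
    T₁ = T₂ ∧ p₁ = p₂ := by
  have hT : T₁ = T₂ := by
    rcases lt_trichotomy T₁ T₂ with hlt | heq | hlt
    · exact absurd H₁.fst_T (H₂.pos _ H₁.T_pos hlt).ne'
    · exact heq
    · exact absurd H₂.fst_T (H₁.pos _ H₂.T_pos hlt).ne'
  subst hT
  exact ⟨rfl, neg_inj.1 (H₁.snd_T.symm.trans H₂.snd_T)⟩

/-- `w` is the globally attracting fixed point of the half-return map. -/
structure AttractingFixedPoint (φ : ℝ → ℝ × ℝ → ℝ × ℝ) (T w : ℝ) : Prop where
  halfOrbit : HalfOrbit φ T w w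
  of_lt : ∀ T' v p, HalfOrbit φ T' v p → w < v → w < p ∧ p < v
  of_gt : ∀ T' v p, HalfOrbit φ T' v p → v < w → v < p ∧ p < w

/-- The half-return map `P` is increasing, so the supremum `w` of `{v | v ≤ P v}` is a fixed point;
no continuity of `P` is needed. The set is nonempty by `exists_small` and bounded by `hB`. Above `w`
the definition of the supremum gives `P v < v`. Below `w`, a half-orbit reaching `a` gains more than
that of `w`, which gains nothing, and one that does not reach `a` gains anyway. -/
theorem exists_attractingFixedPoint (S : LienardSystem F f g a c M)
    (h : IsFlow (planeField F g) K φ) (hB : ∀ T v p, HalfOrbit φ T v p → B < v → p < v) :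
    ∃ T w, AttractingFixedPoint φ T w := by
  have hex : ∀ v, 0 < v → ∃ T p, HalfOrbit φ T v p := fun v hv => S.exists_halfOrbit h hv
  choose! T P hP using hex
  set A := {v | 0 < v ∧ v ≤ P v} with hA
  obtain ⟨r, hr, hsmall⟩ := HalfOrbit.exists_small S h
  have hAne : A.Nonempty :=
    ⟨r / 2, half_pos hr, (hsmall _ _ _ (hP _ (half_pos hr)) (half_lt_self hr)).le⟩
  have hAb : BddAbove A := ⟨B, fun v hv => by
    by_contra! hlt
    exact absurd hv.2 (not_le.2 (hB _ _ _ (hP v hv.1) hlt))⟩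
  set w := sSup A with hw
  have hmono : ∀ v₁ v₂, 0 < v₁ → v₁ ≤ v₂ → P v₁ ≤ P v₂ := by
    intro v₁ v₂ h1 h12
    rcases h12.eq_or_lt with rfl | h12
    · exact le_rfl
    · exact ((hP v₁ h1).p_lt_p (hP v₂ (h1.trans h12)) S h h12).le
  obtain ⟨v₀, hv₀⟩ := hAne
  have hwpos : 0 < w := hv₀.1.trans_le (le_csSup hAb hv₀)
  have hw1 : w ≤ P w := csSup_le ⟨v₀, hv₀⟩ fun v hv =>
    hv.2.trans (hmono v w hv.1 (le_csSup hAb hv))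
  have hw2 : P w ≤ w := le_csSup hAb ⟨(hP w hwpos).p_pos, hmono w (P w) hwpos hw1⟩
  have hweq : P w = w := le_antisymm hw2 hw1
  have hHw : HalfOrbit φ (T w) w w := by
    have := hP w hwpos
    rwa [hweq] at this
  refine ⟨T w, w, hHw, fun T' v p H hlt => ⟨hHw.p_lt_p H S h hlt, ?_⟩,
    fun T' v p H hlt => ⟨?_, H.p_lt_p hHw S h hlt⟩⟩
  · rw [(H.unique (hP v H.v_pos)).2]
    by_contra! hle
    exact absurd (le_csSup hAb ⟨H.v_pos, hle⟩) (not_le.2 hlt)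
  · by_cases hreach : ∃ t, 0 ≤ t ∧ t ≤ T' ∧ a ≤ (φ t (0, v)).1
    · have := H.energy_gain_lt hHw S h hlt hreach
      exact lt_of_pow_lt_pow_left₀ 2 H.p_pos.le (by linarith)
    · push Not at hreach
      exact H.lt_of_fst_le S h fun t h0 hT => (hreach t h0 hT).le

namespace AttractingFixedPoint

variable {w : ℝ}

theorem reaches (W : AttractingFixedPoint φ T w) (S : LienardSystem F f g a c M)
    (h : IsFlow (planeField F g) K φ) : ∃ t, 0 ≤ t ∧ t ≤ T ∧ a < (φ t (0, w)).1 := by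
  by_contra! hle
  exact lt_irrefl _ (W.halfOrbit.lt_of_fst_le S h hle)

theorem abs_sub_le (W : AttractingFixedPoint φ T w) {T' : ℝ} (H : HalfOrbit φ T' v p) :
    |p - w| ≤ |v - w| := by
  rcases lt_trichotomy v w with hlt | rfl | hlt
  · obtain ⟨h1, h2⟩ := W.of_gt _ _ _ H hlt
    rw [abs_of_neg (by linarith), abs_of_neg (by linarith)]
    linarith
  · rw [(H.unique W.halfOrbit).2]
  · obtain ⟨h1, h2⟩ := W.of_lt _ _ _ H hlt
    rw [abs_of_pos (by linarith), abs_of_pos (by linarith)]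
    linarith

/-- The iterates decrease to some `L ≥ w`. If `L > w`, every gain `P(u)² - u²` along the sequence is
at most the gain at `L`, which is negative; but these gains are differences of a convergent sequence
and tend to `0`. The comparison replaces continuity of `P` at `L`. -/
theorem tendsto_iterate_of_lt (W : AttractingFixedPoint φ T w) (S : LienardSystem F f g a c M)
    (h : IsFlow (planeField F g) K φ) {P : ℝ → ℝ} (hP : ∀ v, 0 < v → ∃ T, HalfOrbit φ T v (P v))
    (hv : w < v) : Tendsto (fun n => P^[n] v) atTop (𝓝 w) := by
  have hw := W.halfOrbit.v_pos
  have hgt : ∀ n, w < P^[n] v := by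
    intro n
    induction n with
    | zero => exact hv
    | succ n ih =>
      rw [Function.iterate_succ_apply']
      obtain ⟨T', H⟩ := hP _ (hw.trans ih)
      exact (W.of_lt _ _ _ H ih).1
  have hanti : Antitone fun n => P^[n] v := by
    refine antitone_nat_of_succ_le fun n => ?_
    rw [Function.iterate_succ_apply']
    obtain ⟨T', H⟩ := hP _ (hw.trans (hgt n))
    exact (W.of_lt _ _ _ H (hgt n)).2.le
  have hbdd : BddBelow (range fun n => P^[n] v) := ⟨w, by rintro _ ⟨n, rfl⟩; exact (hgt n).le⟩
  have hlim := tendsto_atTop_ciInf hanti hbdd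
  set L := ⨅ n, P^[n] v with hL
  have hLle : ∀ n, L ≤ P^[n] v := fun n => ciInf_le hbdd n
  have hwL : w ≤ L := le_ciInf fun n => (hgt n).le
  rcases hwL.eq_or_lt with heq | hlt
  · rwa [heq]
  exfalso
  obtain ⟨T', H⟩ := hP L (hw.trans hlt)
  obtain ⟨t, h0, hT, ht⟩ := W.reaches S h
  have hreach := W.halfOrbit.reaches_of_lt H S h hlt ⟨t, h0, hT, ht.le⟩
  have hgain : ∀ n, (P^[n + 1] v) ^ 2 - (P^[n] v) ^ 2 ≤ P L ^ 2 - L ^ 2 := by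
    intro n
    rcases (hLle n).eq_or_lt with heq | hlt'
    · rw [Function.iterate_succ_apply', ← heq]
    · obtain ⟨T₂, H₂⟩ := hP _ (hw.trans (hgt n))
      rw [Function.iterate_succ_apply']
      exact (H.energy_gain_lt H₂ S h hlt' hreach).le
  have h1 := le_of_tendsto' (((hlim.comp (tendsto_add_atTop_nat 1)).pow 2).sub (hlim.pow 2)) hgain
  have h2 := (W.of_lt _ _ _ H hlt).2
  have h3 := pow_lt_pow_left₀ h2 H.p_pos.le two_ne_zero
  linarith

/-- The argument of `tendsto_iterate_of_lt` from below. Here `hr` has to be supplied, since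
`energy_gain_lt` compares only half-orbits whose inner one reaches `x = a`. -/
theorem tendsto_iterate_of_gt (W : AttractingFixedPoint φ T w) (S : LienardSystem F f g a c M)
    (h : IsFlow (planeField F g) K φ) {P : ℝ → ℝ} (hP : ∀ v, 0 < v → ∃ T, HalfOrbit φ T v (P v))
    (hv0 : 0 < v) (hv : v < w)
    (hr : ∀ T p, HalfOrbit φ T v p → ∃ t, 0 ≤ t ∧ t ≤ T ∧ a ≤ (φ t (0, v)).1) :
    Tendsto (fun n => P^[n] v) atTop (𝓝 w) := by
  have hgt : ∀ n, v ≤ P^[n] v ∧ P^[n] v < w := by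
    intro n
    induction n with
    | zero => exact ⟨le_rfl, hv⟩
    | succ n ih =>
      rw [Function.iterate_succ_apply']
      obtain ⟨T', H⟩ := hP _ (hv0.trans_le ih.1)
      have := W.of_gt _ _ _ H ih.2
      exact ⟨ih.1.trans this.1.le, this.2⟩
  have hmono : Monotone fun n => P^[n] v := by
    refine monotone_nat_of_le_succ fun n => ?_
    rw [Function.iterate_succ_apply']
    obtain ⟨T', H⟩ := hP _ (hv0.trans_le (hgt n).1)
    exact (W.of_gt _ _ _ H (hgt n).2).1.le
  have hbdd : BddAbove (range fun n => P^[n] v) :=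
    ⟨w, by rintro _ ⟨n, rfl⟩; exact (hgt n).2.le⟩
  have hlim := tendsto_atTop_ciSup hmono hbdd
  set L := ⨆ n, P^[n] v with hL
  have hLle : ∀ n, P^[n] v ≤ L := fun n => le_ciSup hbdd n
  have hwL : L ≤ w := ciSup_le fun n => (hgt n).2.le
  rcases hwL.eq_or_lt with heq | hlt
  · rwa [heq] at hlim
  exfalso
  obtain ⟨T₀, H₀⟩ := hP v hv0
  have hreach : ∀ n T p, HalfOrbit φ T (P^[n] v) p →
      ∃ t, 0 ≤ t ∧ t ≤ T ∧ a ≤ (φ t (0, P^[n] v)).1 := by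
    intro n T p H
    rcases (hgt n).1.eq_or_lt with heq | hlt'
    · rw [← heq] at H ⊢
      exact hr T p H
    · exact H₀.reaches_of_lt H S h hlt' (hr _ _ H₀)
  obtain ⟨T', H⟩ := hP L (hv0.trans_le (hLle 0))
  have hgain : ∀ n, P L ^ 2 - L ^ 2 ≤ (P^[n + 1] v) ^ 2 - (P^[n] v) ^ 2 := by
    intro n
    rcases (hLle n).eq_or_lt with heq | hlt'
    · rw [Function.iterate_succ_apply', heq]
    · obtain ⟨T₂, H₂⟩ := hP _ (hv0.trans_le (hgt n).1)
      rw [Function.iterate_succ_apply']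
      exact (H₂.energy_gain_lt H S h hlt' (hreach n _ _ H₂)).le
  have h1 := ge_of_tendsto' (((hlim.comp (tendsto_add_atTop_nat 1)).pow 2).sub (hlim.pow 2)) hgain
  have h2 := (W.of_gt _ _ _ H hlt).1
  have h3 := pow_lt_pow_left₀ h2 H.v_pos.le two_ne_zero
  linarith

end AttractingFixedPoint

end LienardSystem

namespace LienardSystem

variable {F f g : ℝ → ℝ} {a c M K B : ℝ} {φ : ℝ → ℝ × ℝ → ℝ × ℝ} {T v p w : ℝ}

/-! ### The periodic orbit and its stability -/

theorem dist_flow_le {E : Type*} [NormedAddCommGroup E] [NormedSpace ℝ E] {V : E → E}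
    {φ : ℝ → E → E} (h : IsFlow V K φ) {t τ : ℝ} (ht : |t| ≤ τ) (p q : E) :
    dist (φ t p) (φ t q) ≤ dist p q * Real.exp (|K| * τ) := by
  refine (h.dist_le t p q).trans ?_
  gcongr
  exact le_abs_self K

theorem dist_zero_mk (v w : ℝ) : dist ((0 : ℝ), v) (0, w) = |v - w| := by
  simp [Prod.dist_eq, Real.dist_eq]

/-- Trajectories passing near a point of the axis `x = 0` hit this axis nearby. -/
theorem exists_hit_of_pos (S : LienardSystem F f g a c M) (h : IsFlow (planeField F g) K φ)
    (hw : 0 < w) {η : ℝ} (hη : 0 < η) :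
    ∃ δ > 0, ∀ q, dist q (0, w) < δ →
      ∃ t, |t| ≤ η ∧ (φ t q).1 = 0 ∧ dist (φ t q) (0, w) < η := by
  have hcont : Tendsto (fun t => φ t (0, w)) (𝓝 0) (𝓝 (0, w)) := by
    have := (h.continuous (0, w)).tendsto 0
    rwa [h.zero] at this
  obtain ⟨ρ, hρ, hclose⟩ := Metric.tendsto_nhds_nhds.1 hcont (η / 2) (by positivity)
  set η' := min η (ρ / 2) with hη'
  have hη'pos : 0 < η' := by positivity
  have hx' := hasDerivAt_fst h (0, w) 0
  have hx0 : (φ 0 (0, w)).1 = 0 := by rw [h.zero]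
  have hpos : 0 < (φ 0 (0, w)).2 - F (φ 0 (0, w)).1 := by simpa [h.zero, S.F_zero]
  obtain ⟨t₁, ht₁, ht₁'⟩ := ((eventually_pos_of_hasDerivAt_pos hx' hpos hx0).and
    (Ioo_mem_nhdsGT hη'pos)).exists
  obtain ⟨t₂, ht₂, ht₂'⟩ := ((eventually_neg_of_hasDerivAt_pos hx' hpos hx0).and
    (Ioo_mem_nhdsLT (neg_lt_zero.2 hη'pos))).exists
  -- The orbit of `(0, w)` crosses the axis transversally, with `x > 0` at `t₁` and `x < 0` at `t₂`.
  -- A trajectory staying within `m` of it keeps both signs, hence vanishes in between.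
  set m := min (η / 2) (min (φ t₁ (0, w)).1 (-(φ t₂ (0, w)).1)) with hm
  have hmpos : 0 < m := lt_min (by positivity) (lt_min ht₁ (neg_pos.2 ht₂))
  refine ⟨m / Real.exp (|K| * η'), by positivity, fun q hq => ?_⟩
  have hq' : ∀ t, |t| ≤ η' → dist (φ t q) (φ t (0, w)) < m := fun t ht =>
    (dist_flow_le h ht _ _).trans_lt ((lt_div_iff₀ (Real.exp_pos _)).1 hq)
  have hfst : ∀ t, |t| ≤ η' → |(φ t q).1 - (φ t (0, w)).1| < m := fun t ht => by
    have := (hq' t ht)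
    rw [Prod.dist_eq] at this
    exact (le_max_left _ _).trans_lt this
  have hm₁ : m ≤ (φ t₁ (0, w)).1 := (min_le_right _ _).trans (min_le_left _ _)
  have hm₂ : m ≤ -(φ t₂ (0, w)).1 := (min_le_right _ _).trans (min_le_right _ _)
  have h1 := (abs_lt.1 (hfst t₁ (by rw [abs_of_pos ht₁'.1]; exact ht₁'.2.le))).1
  have h2 := (abs_lt.1 (hfst t₂ (by rw [abs_of_neg ht₂'.2]; linarith [ht₂'.1]))).2
  obtain ⟨t, ht, ht0⟩ := intermediate_value_Icc (ht₂'.2.trans ht₁'.1).le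
    (continuous_flow_fst h q).continuousOn (show (0 : ℝ) ∈ Icc _ _ from
      ⟨by linarith, by linarith⟩)
  have htη : |t| ≤ η' := abs_le.2 ⟨ht₂'.1.le.trans ht.1, ht.2.trans ht₁'.2.le⟩
  refine ⟨t, htη.trans (min_le_left _ _), ht0, ?_⟩
  have h3 : dist (φ t (0, w)) (0, w) < η / 2 := by
    refine hclose ?_
    rw [Real.dist_eq, sub_zero]
    exact (htη.trans (min_le_right _ _)).trans_lt (half_lt_self hρ)
  have h4 := (hq' t htη).trans_le (min_le_left _ _)
  have := dist_triangle (φ t q) (φ t (0, w)) (0, w)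
  linarith

theorem flow_neg (S : LienardSystem F f g a c M) (h : IsFlow (planeField F g) K φ) (t : ℝ)
    (q : ℝ × ℝ) : φ t (-q) = -φ t q := h.map_neg S.planeField_neg t q

theorem exists_hit_of_neg (S : LienardSystem F f g a c M) (h : IsFlow (planeField F g) K φ)
    (hw : 0 < w) {η : ℝ} (hη : 0 < η) :
    ∃ δ > 0, ∀ q, dist q (0, -w) < δ → ∃ t, |t| ≤ η ∧ (φ t q).1 = 0 := by
  obtain ⟨δ, hδ, hhit⟩ := S.exists_hit_of_pos h hw hη
  refine ⟨δ, hδ, fun q hq => ?_⟩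
  obtain ⟨t, ht, ht', -⟩ := hhit (-q) (by
    rw [← dist_neg_neg]
    simpa using hq)
  refine ⟨t, ht, ?_⟩
  rw [S.flow_neg h] at ht'
  simpa using ht'

/-- The half-orbits of nearby points stay in `x > 0` for a definite time. -/
theorem HalfOrbit.exists_pos_near (H : HalfOrbit φ T w p) (S : LienardSystem F f g a c M)
    (h : IsFlow (planeField F g) K φ) {s : ℝ} (hs : 0 < s) (hsT : s < T) :
    ∃ δ > 0, ∀ v, |v - w| < δ → ∀ t, 0 < t → t ≤ s → 0 < (φ t (0, v)).1 := by
  have hw := H.v_pos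
  have hopen : ∀ᶠ q : ℝ × ℝ in 𝓝 (0, w), 0 < q.2 - F q.1 := by
    have h1 : Continuous fun q : ℝ × ℝ => q.2 - F q.1 :=
      continuous_snd.sub (S.continuous_F.comp continuous_fst)
    have h2 : Tendsto (fun q : ℝ × ℝ => q.2 - F q.1) (𝓝 (0, w)) (𝓝 (w - F 0)) :=
      h1.tendsto (0, w)
    rw [S.F_zero, sub_zero] at h2
    exact h2.eventually (lt_mem_nhds hw)
  obtain ⟨r, hr, hball⟩ := Metric.eventually_nhds_iff.1 hopen
  have hcont : Tendsto (fun t => φ t (0, w)) (𝓝 0) (𝓝 (0, w)) := by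
    have := (h.continuous (0, w)).tendsto 0
    rwa [h.zero] at this
  obtain ⟨ρ, hρ, hclose⟩ := Metric.tendsto_nhds_nhds.1 hcont (r / 2) (by positivity)
  -- Positivity has two sources: up to `η` the trajectory stays where `x' > 0`, so `x` increases
  -- from `0`; on `[η, s]` the limiting orbit has a positive minimum `m`, and the trajectory stays
  -- closer to it than that.
  set η := min s (ρ / 2) with hη
  have hηpos : 0 < η := by positivity
  have hηs : η ≤ s := min_le_left _ _
  obtain ⟨t₀, ht₀, hmin⟩ := isCompact_Icc.exists_isMinOn (nonempty_Icc.2 hηs)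
    (continuous_flow_fst h (0, w)).continuousOn
  set m := (φ t₀ (0, w)).1 with hm
  have hmpos : 0 < m := H.pos t₀ (hηpos.trans_le ht₀.1) (ht₀.2.trans_lt hsT)
  refine ⟨min (r / 2) m / Real.exp (|K| * s), by positivity, fun v hv => ?_⟩
  have hv' : ∀ t, 0 ≤ t → t ≤ s → dist (φ t (0, v)) (φ t (0, w)) < min (r / 2) m := by
    intro t h0 hts
    refine (dist_flow_le h (by rwa [abs_of_nonneg h0] : |t| ≤ s) _ _).trans_lt ?_
    rw [dist_zero_mk]
    exact (lt_div_iff₀ (Real.exp_pos _)).1 hv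
  have hmono : StrictMonoOn (fun t => (φ t (0, v)).1) (Icc 0 η) := by
    refine strictMonoOn_of_hasDerivWithinAt_pos (convex_Icc _ _)
      (continuous_flow_fst h _).continuousOn
      (fun t _ => (hasDerivAt_fst h (0, v) t).hasDerivWithinAt) (fun t ht => ?_)
    rw [interior_Icc] at ht
    refine hball ?_
    have h1 := (hv' t ht.1.le (ht.2.le.trans hηs)).trans_le (min_le_left _ _)
    have h2 : dist (φ t (0, w)) (0, w) < r / 2 := by
      refine hclose ?_
      rw [Real.dist_eq, sub_zero, abs_of_pos ht.1]
      exact (ht.2.trans_le (min_le_right _ _)).trans (half_lt_self hρ)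
    have := dist_triangle (φ t (0, v)) (φ t (0, w)) (0, w)
    linarith
  intro t h0 hts
  rcases le_total t η with htη | htη
  · have := hmono ⟨le_rfl, hηpos.le⟩ ⟨h0.le, htη⟩ h0
    simpa only [HalfOrbit.fst_zero h] using this
  · have h1 := (hv' t h0.le hts).trans_le (min_le_right _ _)
    rw [Prod.dist_eq] at h1
    have h2 := (abs_lt.1 ((le_max_left _ _).trans_lt h1)).1
    have h3 : m ≤ (φ t (0, w)).1 := hmin ⟨htη, hts⟩
    linarith

namespace AttractingFixedPoint

theorem flow_T (W : AttractingFixedPoint φ T w) : φ T (0, w) = -(0, w) := by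
  rw [W.halfOrbit.flow_T]
  simp

theorem flow_two_mul_T (W : AttractingFixedPoint φ T w) (S : LienardSystem F f g a c M)
    (h : IsFlow (planeField F g) K φ) : φ (2 * T) (0, w) = (0, w) := by
  rw [two_mul, h.add, W.flow_T, S.flow_neg h, W.flow_T, neg_neg]

/-- Uniform information on the half-orbits near the fixed one. -/
theorem exists_uniform (W : AttractingFixedPoint φ T w) (S : LienardSystem F f g a c M)
    (h : IsFlow (planeField F g) K φ) :
    ∃ δ > 0, δ ≤ w ∧ ∃ τ > 0, ∀ v, |v - w| < δ → ∀ T' p, HalfOrbit φ T' v p →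
      τ ≤ T' ∧ T' ≤ T + 1 ∧ ∃ t, 0 ≤ t ∧ t ≤ T' ∧ a ≤ (φ t (0, v)).1 := by
  have H := W.halfOrbit
  obtain ⟨s, hs0, hsT, hsa⟩ := W.reaches S h
  have hs0' : 0 < s := by
    refine lt_of_le_of_ne hs0 ?_
    rintro rfl
    rw [HalfOrbit.fst_zero h] at hsa
    exact S.a_pos.not_gt hsa
  have hsT' : s < T := by
    refine lt_of_le_of_ne hsT ?_
    rintro rfl
    rw [H.fst_T] at hsa
    exact S.a_pos.not_gt hsa
  obtain ⟨δ₁, hδ₁, hpos⟩ := H.exists_pos_near S h hs0' hsT'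
  have hη : 0 < min 1 (T / 2) := lt_min one_pos (half_pos H.T_pos)
  obtain ⟨δ₂, hδ₂, hhit⟩ := S.exists_hit_of_neg h H.v_pos hη
  -- The four bounds keep, in order, `v` positive, the half-orbit alive up to time `s`, its return
  -- within `T + 1`, and its abscissa at time `s` above `a`.
  refine ⟨min w (min δ₁ (min (δ₂ / Real.exp (|K| * T))
    (((φ s (0, w)).1 - a) / Real.exp (|K| * T)))), ?_, min_le_left _ _, s, hs0', ?_⟩
  · have := sub_pos.2 hsa
    exact lt_min H.v_pos (lt_min hδ₁ (lt_min (by positivity) (by positivity)))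
  intro v hv T' p H'
  simp only [lt_min_iff] at hv
  obtain ⟨-, hv1, hv2, hv3⟩ := hv
  have hsT'' : s < T' := by
    by_contra! hle
    exact (hpos v hv1 T' H'.T_pos hle).ne' H'.fst_T
  refine ⟨hsT''.le, ?_, s, hs0, hsT''.le, ?_⟩
  · obtain ⟨t, ht, ht0⟩ := hhit (φ T (0, v)) (by
      rw [← H.flow_T]
      refine (dist_flow_le h (abs_of_pos H.T_pos).le _ _).trans_lt ?_
      rw [dist_zero_mk]
      exact (lt_div_iff₀ (Real.exp_pos _)).1 hv2)
    rw [← h.add] at ht0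
    have h1 := abs_le.1 (ht.trans (min_le_left _ _))
    have h2 := abs_le.1 (ht.trans (min_le_right _ _))
    have hT := H.T_pos
    by_contra! hlt
    exact (H'.pos (t + T) (by linarith) (by linarith)).ne' ht0
  · have h1 : dist (φ s (0, v)) (φ s (0, w)) < (φ s (0, w)).1 - a := by
      refine (dist_flow_le h (by rwa [abs_of_pos hs0'] : |s| ≤ T) _ _).trans_lt ?_
      rw [dist_zero_mk]
      exact (lt_div_iff₀ (Real.exp_pos _)).1 hv3
    rw [Prod.dist_eq] at h1
    have h2 := (abs_lt.1 ((le_max_left _ _).trans_lt h1)).1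
    linarith

/-- The periodic orbit. -/
def orbit (φ : ℝ → ℝ × ℝ → ℝ × ℝ) (w : ℝ) : Set (ℝ × ℝ) := range fun t => φ t (0, w)

theorem neg_mem_orbit (W : AttractingFixedPoint φ T w) (S : LienardSystem F f g a c M)
    (h : IsFlow (planeField F g) K φ) {q : ℝ × ℝ} (hq : q ∈ orbit φ w) : -q ∈ orbit φ w := by
  obtain ⟨t, rfl⟩ := hq
  refine ⟨t + T, ?_⟩
  simp only
  rw [h.add, W.flow_T, S.flow_neg h]

/-- The trajectory is cut into half-turns. Each lasts at most `T + 1`, so the flow estimate costs a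
fixed factor, and at its end the distance to `±w` on the axis has not grown (`abs_sub_le`); hence
the factor does not accumulate. Each half-turn lasts at least `τ`, which makes induction on the
multiples of `τ` exhaust all times. -/
theorem exists_dist_le (W : AttractingFixedPoint φ T w) (S : LienardSystem F f g a c M)
    (h : IsFlow (planeField F g) K φ) :
    ∃ δ > 0, δ ≤ w ∧ ∀ v, |v - w| < δ → ∀ t, 0 ≤ t →
      ∃ q ∈ orbit φ w, dist (φ t (0, v)) q ≤ |v - w| * Real.exp (|K| * (T + 1)) := by
  obtain ⟨δ, hδ, hδw, τ, hτ, hunif⟩ := W.exists_uniform S h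
  refine ⟨δ, hδ, hδw, ?_⟩
  have key : ∀ n : ℕ, ∀ v, |v - w| < δ → ∀ t, 0 ≤ t → t ≤ n * τ →
      ∃ q ∈ orbit φ w, dist (φ t (0, v)) q ≤ |v - w| * Real.exp (|K| * (T + 1)) := by
    intro n
    induction n with
    | zero =>
      intro v hv t h0 ht
      refine ⟨φ t (0, w), ⟨t, rfl⟩, ?_⟩
      rw [← dist_zero_mk v w]
      refine dist_flow_le h ?_ _ _
      rw [abs_of_nonneg h0]
      simp only [Nat.cast_zero, zero_mul] at ht
      linarith [W.halfOrbit.T_pos]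
    | succ n ih =>
      intro v hv t h0 ht
      have hvpos : 0 < v := by linarith [(abs_lt.1 hv).1]
      obtain ⟨T', p, H'⟩ := S.exists_halfOrbit h hvpos
      obtain ⟨h1, h2, -⟩ := hunif v hv T' p H'
      rcases le_total t T' with htT | htT
      · refine ⟨φ t (0, w), ⟨t, rfl⟩, ?_⟩
        rw [← dist_zero_mk v w]
        refine dist_flow_le h ?_ _ _
        rw [abs_of_nonneg h0]
        linarith
      · have hp := W.abs_sub_le H'
        push_cast at ht
        obtain ⟨q, hq, hdist⟩ := ih p (hp.trans_lt hv) (t - T') (by linarith) (by linarith)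
        refine ⟨-q, W.neg_mem_orbit S h hq, ?_⟩
        have heq : φ t (0, v) = -φ (t - T') (0, p) := by
          rw [← S.flow_neg h, show -((0 : ℝ), p) = φ T' (0, v) by rw [H'.flow_T]; simp, ← h.add,
            sub_add_cancel]
        rw [heq, dist_neg_neg]
        exact hdist.trans (by gcongr)
  intro v hv t h0
  obtain ⟨n, hn⟩ := exists_nat_ge (t / τ)
  exact key n v hv t h0 ((div_le_iff₀ hτ).1 hn)

theorem exists_iterate_time (S : LienardSystem F f g a c M) (h : IsFlow (planeField F g) K φ)
    {P : ℝ → ℝ} (hP : ∀ v, 0 < v → ∃ T, HalfOrbit φ T v (P v)) (hv : 0 < v) (n : ℕ) :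
    0 < P^[n] v ∧ ∃ t, 0 ≤ t ∧ (φ t (0, v) = (0, P^[n] v) ∨ φ t (0, v) = -(0, P^[n] v)) := by
  induction n with
  | zero => exact ⟨hv, 0, le_rfl, Or.inl (h.zero _)⟩
  | succ n ih =>
    obtain ⟨hpos, t, h0, ht⟩ := ih
    rw [Function.iterate_succ_apply']
    obtain ⟨T', H'⟩ := hP _ hpos
    refine ⟨H'.p_pos, T' + t, by linarith [H'.T_pos], ?_⟩
    rw [h.add]
    have hT : φ T' (0, P^[n] v) = -(0, P (P^[n] v)) := by rw [H'.flow_T]; simp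
    rcases ht with ht | ht
    · right
      rw [ht, hT]
    · left
      rw [ht, S.flow_neg h, hT, neg_neg]

/-- The successive crossing heights converge to `w`. Once one of them is close enough,
`exists_dist_le` controls all later times. -/
theorem exists_tendsto (W : AttractingFixedPoint φ T w) (S : LienardSystem F f g a c M)
    (h : IsFlow (planeField F g) K φ) :
    ∃ δ > 0, δ ≤ w ∧ ∀ v, |v - w| < δ → ∀ ε > 0, ∃ t₀, ∀ t, t₀ ≤ t →
      ∃ q ∈ orbit φ w, dist (φ t (0, v)) q < ε := by
  obtain ⟨δ₁, hδ₁, hδw, hdist⟩ := W.exists_dist_le S h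
  obtain ⟨δ₂, hδ₂, -, τ, -, hunif⟩ := W.exists_uniform S h
  refine ⟨min δ₁ δ₂, lt_min hδ₁ hδ₂, (min_le_left _ _).trans hδw, fun v hv ε hε => ?_⟩
  obtain ⟨hv1, hv2⟩ := lt_min_iff.1 hv
  have hvpos : 0 < v := by linarith [(abs_lt.1 hv1).1]
  have hex : ∀ v, 0 < v → ∃ p T, HalfOrbit φ T v p := fun v hv => by
    obtain ⟨T, p, H⟩ := S.exists_halfOrbit h hv
    exact ⟨p, T, H⟩
  choose! P hP using hex
  have hlim : Tendsto (fun n => P^[n] v) atTop (𝓝 w) := by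
    rcases lt_trichotomy v w with hlt | heq | hlt
    · exact W.tendsto_iterate_of_gt S h hP hvpos hlt fun T' p H => (hunif v hv2 T' p H).2.2
    · have hfix : ∀ n, P^[n] v = w := by
        intro n
        induction n with
        | zero => exact heq
        | succ n ih =>
          rw [Function.iterate_succ_apply', ih]
          obtain ⟨T', H'⟩ := hP w W.halfOrbit.v_pos
          exact (H'.unique W.halfOrbit).2
      simp only [hfix]
      exact tendsto_const_nhds
    · exact W.tendsto_iterate_of_lt S h hP hlt
  have hC := Real.exp_pos (|K| * (T + 1))
  obtain ⟨n, hn⟩ := (Metric.tendsto_nhds.1 hlim (min δ₁ (ε / Real.exp (|K| * (T + 1))))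
    (by positivity)).exists
  rw [Real.dist_eq, lt_min_iff, lt_div_iff₀ hC] at hn
  obtain ⟨hupos, t₀, h0, ht₀⟩ := exists_iterate_time S h hP hvpos n
  refine ⟨t₀, fun t ht => ?_⟩
  obtain ⟨q, hq, hqd⟩ := hdist _ hn.1 (t - t₀) (sub_nonneg.2 ht)
  have heq : φ t (0, v) = φ (t - t₀) (φ t₀ (0, v)) := by rw [← h.add, sub_add_cancel]
  rcases ht₀ with ht₀ | ht₀
  · exact ⟨q, hq, by rw [heq, ht₀]; exact hqd.trans_lt hn.2⟩
  · refine ⟨-q, W.neg_mem_orbit S h hq, ?_⟩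
    rw [heq, ht₀, S.flow_neg h, dist_neg_neg]
    exact hqd.trans_lt hn.2

/-- Trajectories which start near the periodic orbit hit the section `x = 0` near `(0, w)`. -/
theorem exists_entry (W : AttractingFixedPoint φ T w) (S : LienardSystem F f g a c M)
    (h : IsFlow (planeField F g) K φ) {ε : ℝ} (hε : 0 < ε) :
    ∃ δ > 0, ∀ p, ∀ q ∈ orbit φ w, dist p q < δ →
      ∃ t v, |t| ≤ 2 * T + 1 ∧ |v - w| < ε ∧ φ t p = (0, v) := by
  obtain ⟨δ, hδ, hhit⟩ := S.exists_hit_of_pos h W.halfOrbit.v_pos (lt_min one_pos hε)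
  refine ⟨δ / Real.exp (|K| * (2 * T)), by positivity, ?_⟩
  rintro p q ⟨r, rfl⟩ hpq
  have hper : Function.Periodic (fun t => φ t (0, w)) (2 * T) := fun t => by
    simp only
    rw [h.add, W.flow_two_mul_T S h]
  have hT : 0 < 2 * T := by linarith [W.halfOrbit.T_pos]
  -- The nearby point of the orbit is `φ s (0, w)` with `0 ≤ s < 2 T`; flowing back by `s` brings
  -- `p` near `(0, w)` at a bounded cost.
  obtain ⟨s, hs, hsr⟩ := hper.exists_mem_Ico₀ hT r
  simp only at hsr hpq
  rw [hsr] at hpq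
  have hs' : |-s| ≤ 2 * T := by
    rw [abs_neg, abs_of_nonneg hs.1]
    exact hs.2.le
  obtain ⟨t, ht, ht0, htd⟩ := hhit (φ (-s) p) (by
    rw [← h.neg_cancel s (0, w)]
    exact (dist_flow_le h hs' _ _).trans_lt ((lt_div_iff₀ (Real.exp_pos _)).1 hpq))
  rw [← h.add] at ht0 htd
  refine ⟨t + -s, (φ (t + -s) p).2, ?_, ?_, Prod.ext ht0 rfl⟩
  · have h1 := ht.trans (min_le_left _ _)
    have := abs_add_le t (-s)
    linarith
  · rw [Prod.dist_eq] at htd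
    exact ((le_max_right _ _).trans_lt htd).trans_le (min_le_right _ _)

theorem orbit_stable (W : AttractingFixedPoint φ T w) (S : LienardSystem F f g a c M)
    (h : IsFlow (planeField F g) K φ) {ε : ℝ} (hε : 0 < ε) :
    ∃ δ > 0, ∀ p, ∀ q ∈ orbit φ w, dist p q < δ → ∀ t, 0 ≤ t →
      ∃ q' ∈ orbit φ w, dist (φ t p) q' < ε := by
  obtain ⟨δ₁, hδ₁, hδw, hdist⟩ := W.exists_dist_le S h
  -- One constant for both regimes: the bounded stretch before the section is reached, and the
  -- half-turns after it.
  set C := Real.exp (|K| * (2 * T + 1)) with hC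
  have hCpos : 0 < C := Real.exp_pos _
  have hT := W.halfOrbit.T_pos
  have hCle : Real.exp (|K| * (T + 1)) ≤ C := by
    rw [hC]
    gcongr
    linarith
  obtain ⟨δ, hδ, hentry⟩ := W.exists_entry S h (lt_min hδ₁ (div_pos hε hCpos))
  refine ⟨δ, hδ, fun p q hq hpq t h0 => ?_⟩
  obtain ⟨s, v, hs, hv, hsv⟩ := hentry p q hq hpq
  rw [lt_min_iff, lt_div_iff₀ hCpos] at hv
  have heq : φ t p = φ (t - s) (0, v) := by rw [← hsv, ← h.add, sub_add_cancel]
  rw [heq]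
  rcases le_total s t with hst | hst
  · obtain ⟨q', hq', hd⟩ := hdist v hv.1 (t - s) (sub_nonneg.2 hst)
    refine ⟨q', hq', hd.trans_lt (lt_of_le_of_lt ?_ hv.2)⟩
    gcongr
  · refine ⟨φ (t - s) (0, w), ⟨_, rfl⟩, ?_⟩
    have hs' := abs_le.1 hs
    refine (dist_flow_le h (τ := 2 * T + 1) ?_ _ _).trans_lt (by rw [dist_zero_mk]; exact hv.2)
    rw [abs_of_nonpos (sub_nonpos.2 hst)]
    linarith

theorem orbit_attracting (W : AttractingFixedPoint φ T w) (S : LienardSystem F f g a c M)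
    (h : IsFlow (planeField F g) K φ) :
    ∃ δ > 0, ∀ p, ∀ q ∈ orbit φ w, dist p q < δ → ∀ ε > 0, ∃ t₀, ∀ t, t₀ ≤ t →
      ∃ q' ∈ orbit φ w, dist (φ t p) q' < ε := by
  obtain ⟨δ₁, hδ₁, hδw, htend⟩ := W.exists_tendsto S h
  obtain ⟨δ, hδ, hentry⟩ := W.exists_entry S h hδ₁
  refine ⟨δ, hδ, fun p q hq hpq ε hε => ?_⟩
  obtain ⟨s, v, hs, hv, hsv⟩ := hentry p q hq hpq
  obtain ⟨t₀, ht₀⟩ := htend v hv ε hε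
  refine ⟨t₀ + s, fun t ht => ?_⟩
  have heq : φ t p = φ (t - s) (0, v) := by rw [← hsv, ← h.add, sub_add_cancel]
  rw [heq]
  exact ht₀ _ (by linarith)

end AttractingFixedPoint

end LienardSystem

/-! ### Uniqueness of the periodic orbit, and `ω`-limit sets -/

namespace LienardSystem

variable {F f g : ℝ → ℝ} {a c M K B : ℝ} {φ : ℝ → ℝ × ℝ → ℝ × ℝ} {T v p w : ℝ}

/-- A nontrivial periodic orbit crosses the axis `x = 0`. -/
theorem exists_fst_eq_zero (S : LienardSystem F f g a c M) (h : IsFlow (planeField F g) K φ)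
    {q : ℝ × ℝ} {τ : ℝ} (hτ : 0 < τ) (hper : φ τ q = q) : ∃ t, (φ t q).1 = 0 := by
  by_contra! hne
  have hcont := continuous_flow_fst h q
  -- A periodic orbit confined to `x > 0` would have a strictly decreasing height. The case `x < 0`
  -- reduces to it by oddness.
  have key : ∀ q : ℝ × ℝ, φ τ q = q → ¬ ∀ t, 0 < (φ t q).1 := by
    intro q hper hpos
    have hanti : StrictAnti fun t => (φ t q).2 :=
      strictAnti_of_hasDerivAt_neg (fun t => hasDerivAt_snd h q t)
        (fun t => neg_neg_of_pos (S.g_pos (hpos t)))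
    have := hanti hτ
    simp only [h.zero, hper, lt_irrefl] at this
  rcases lt_or_gt_of_ne (hne 0) with hlt | hgt
  · refine key (-q) (by rw [S.flow_neg h, hper]) fun t => ?_
    rw [S.flow_neg h]
    by_contra! hle
    have hle' : 0 ≤ (φ t q).1 := by simpa using hle
    obtain ⟨s, hs⟩ := mem_range_of_exists_le_of_exists_ge hcont ⟨0, hlt.le⟩ ⟨t, hle'⟩
    exact hne s hs
  · refine key q hper fun t => ?_
    by_contra! hle
    obtain ⟨s, hs⟩ := mem_range_of_exists_le_of_exists_ge hcont ⟨t, hle⟩ ⟨0, hgt.le⟩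
    exact hne s hs

namespace AttractingFixedPoint

/-- Every nontrivial periodic point lies on the periodic orbit through `(0, w)`. -/
theorem mem_orbit_of_periodic (W : AttractingFixedPoint φ T w) (S : LienardSystem F f g a c M)
    (h : IsFlow (planeField F g) K φ) {q : ℝ × ℝ} (hq : q ≠ 0) {τ : ℝ} (hτ : 0 < τ)
    (hper : φ τ q = q) : q ∈ orbit φ w := by
  have hw := W.halfOrbit.v_pos
  set O := range fun t => φ t q with hO
  have hOinv : ∀ r t, r ∈ O → φ t r ∈ O := by
    rintro _ t ⟨s, rfl⟩
    exact ⟨t + s, h.add t s q⟩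
  have hOc : IsCompact O := by
    have hp : Function.Periodic (fun t => φ t q) τ := fun t => by
      simp only
      rw [h.add, hper]
    rw [hO, ← hp.image_Icc hτ 0]
    exact isCompact_Icc.image (h.continuous q)
  -- The heights, up to sign, at which the orbit crosses the axis. This compact set of positive
  -- numbers is stable under the half-return map.
  set A := {v : ℝ | 0 ≤ v ∧ ((0, v) ∈ O ∨ -(0, v) ∈ O)} with hA
  have hApos : ∀ v ∈ A, 0 < v := by
    rintro v ⟨hv0, hv⟩
    refine lt_of_le_of_ne hv0 ?_
    rintro rfl
    have hz : (0 : ℝ × ℝ) ∈ O := by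
      rcases hv with hv | hv
      · exact hv
      · rw [show -((0 : ℝ), (0 : ℝ)) = 0 by simp] at hv
        exact hv
    obtain ⟨t, ht⟩ := hz
    exact S.flow_ne_zero h hq t ht
  have hAclosed : IsClosed A := by
    have h1 : Continuous fun v : ℝ => ((0 : ℝ), v) := by fun_prop
    exact isClosed_Ici.inter ((hOc.isClosed.preimage h1).union (hOc.isClosed.preimage h1.neg))
  have hAbdd : Bornology.IsBounded A := by
    obtain ⟨R, hR⟩ := hOc.isBounded.exists_norm_le
    refine (Metric.isBounded_iff_subset_closedBall 0).2 ⟨R, fun v hv => ?_⟩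
    rw [mem_closedBall_zero_iff]
    rcases hv.2 with hv | hv
    · exact (norm_snd_le (0, v)).trans (hR _ hv)
    · have := hR _ hv
      rw [norm_neg] at this
      exact (norm_snd_le ((0 : ℝ), v)).trans this
  have hAne : A.Nonempty := by
    obtain ⟨t, ht⟩ := S.exists_fst_eq_zero h hτ hper
    refine ⟨|(φ t q).2|, abs_nonneg _, ?_⟩
    have hmem : φ t q ∈ O := ⟨t, rfl⟩
    rcases le_total 0 (φ t q).2 with h0 | h0
    · left
      rw [abs_of_nonneg h0, ← ht]
      exact hmem
    · right
      rw [abs_of_nonpos h0]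
      have heq : -((0 : ℝ), -(φ t q).2) = φ t q := by
        ext <;> simp [ht]
      rwa [heq]
  have hAstep : ∀ v ∈ A, ∀ T p, HalfOrbit φ T v p → p ∈ A := by
    intro v hv T p H
    have hflow : φ T (0, v) = -(0, p) := by rw [H.flow_T]; simp
    refine ⟨H.p_pos.le, ?_⟩
    rcases hv.2 with hv | hv
    · right
      rw [← hflow]
      exact hOinv _ _ hv
    · left
      have := hOinv _ T hv
      rwa [S.flow_neg h, hflow, neg_neg] at this
  obtain ⟨m, hmA, hmax⟩ := (Metric.isCompact_of_isClosed_isBounded hAclosed hAbdd).exists_isGreatest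
    hAne
  -- Take the largest crossing height `m`. If `m < w`, the next crossing would be higher still. If
  -- `m > w`, the iterates of `m` stay in the closed set `A` and converge to `w`.
  have hwA : w ∈ A := by
    rcases lt_trichotomy m w with hlt | heq | hlt
    · obtain ⟨T', p, H⟩ := S.exists_halfOrbit h (hApos m hmA)
      exact absurd (hmax (hAstep m hmA _ _ H)) (not_le.2 (W.of_gt _ _ _ H hlt).1)
    · rwa [← heq]
    · have hex : ∀ v, 0 < v → ∃ p T, HalfOrbit φ T v p := fun v hv => by
        obtain ⟨T, p, H⟩ := S.exists_halfOrbit h hv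
        exact ⟨p, T, H⟩
      choose! P hP using hex
      refine hAclosed.mem_of_tendsto (W.tendsto_iterate_of_lt S h hP hlt)
        (Eventually.of_forall fun n => ?_)
      induction n with
      | zero => exact hmA
      | succ n ih =>
        rw [Function.iterate_succ_apply']
        obtain ⟨T', H⟩ := hP _ (hApos _ ih)
        exact hAstep _ ih _ _ H
  have hback : ∀ r ∈ O, r ∈ orbit φ w → q ∈ orbit φ w := by
    rintro _ ⟨t, rfl⟩ ⟨s, hs⟩
    refine ⟨-t + s, ?_⟩
    simp only at hs ⊢
    rw [h.add, hs, h.neg_cancel]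
  have hw0 : ((0 : ℝ), w) ∈ orbit φ w := ⟨0, h.zero _⟩
  rcases hwA.2 with hmem | hmem
  · exact hback _ hmem hw0
  · exact hback _ hmem (W.neg_mem_orbit S h hw0)

theorem isCompact_orbit (W : AttractingFixedPoint φ T w) (S : LienardSystem F f g a c M)
    (h : IsFlow (planeField F g) K φ) : IsCompact (orbit φ w) := by
  have hp : Function.Periodic (fun t => φ t (0, w)) (2 * T) := fun t => by
    simp only
    rw [h.add, W.flow_two_mul_T S h]
  rw [orbit, ← hp.image_Icc (by linarith [W.halfOrbit.T_pos]) 0]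
  exact isCompact_Icc.image (h.continuous _)

/-- Over one period `2 T` the orbit meets `x = 0` only at times `0` and `T`, at heights `w` and
`-w`. This supplies starting points off the cycle, as the notion of limit cycle requires. -/
theorem eq_of_mem_orbit (W : AttractingFixedPoint φ T w) (S : LienardSystem F f g a c M)
    (h : IsFlow (planeField F g) K φ) (hv : 0 < v) (hmem : ((0 : ℝ), v) ∈ orbit φ w) : v = w := by
  obtain ⟨t, ht⟩ := hmem
  have H := W.halfOrbit
  have hp : Function.Periodic (fun t => φ t (0, w)) (2 * T) := fun t => by
    simp only
    rw [h.add, W.flow_two_mul_T S h]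
  obtain ⟨s, hs, hst⟩ := hp.exists_mem_Ico₀ (by linarith [H.T_pos]) t
  simp only at hst ht
  rw [hst] at ht
  rcases lt_trichotomy s T with hlt | rfl | hlt
  · rcases hs.1.eq_or_lt with rfl | h0
    · rw [h.zero] at ht
      exact (congrArg Prod.snd ht).symm
    · exact absurd (congrArg Prod.fst ht) (H.pos s h0 hlt).ne'
  · rw [H.flow_T] at ht
    have := congrArg Prod.snd ht
    simp only at this
    linarith [H.v_pos]
  · have h1 : φ s (0, w) = -φ (s - T) (0, w) := by
      rw [← S.flow_neg h, ← W.flow_T, ← h.add, sub_add_cancel]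
    rw [h1] at ht
    have := congrArg Prod.fst ht
    simp only [Prod.fst_neg, neg_eq_zero] at this
    exact absurd this (H.pos _ (sub_pos.2 hlt) (by linarith [hs.2])).ne'

/-- Any trajectory tending to the periodic orbit has the whole periodic orbit as `ω`-limit set. -/
theorem setOf_mapClusterPt_eq (W : AttractingFixedPoint φ T w) (S : LienardSystem F f g a c M)
    (h : IsFlow (planeField F g) K φ) {q : ℝ × ℝ}
    (hq : ∀ ε > 0, ∃ t₀, ∀ t, t₀ ≤ t → ∃ q' ∈ orbit φ w, dist (φ t q) q' < ε) :
    {r | MapClusterPt r atTop fun t => φ t q} = orbit φ w := by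
  have hc := W.isCompact_orbit S h
  have hsub : ∀ r, MapClusterPt r atTop (fun t => φ t q) → r ∈ orbit φ w := by
    intro r hr
    rw [← hc.isClosed.closure_eq, Metric.mem_closure_iff]
    intro ε hε
    obtain ⟨t₀, ht₀⟩ := hq (ε / 2) (half_pos hε)
    have h1 := (mapClusterPt_iff_frequently.1 hr) _ (Metric.ball_mem_nhds r (half_pos hε))
    obtain ⟨t, ht, ht'⟩ := (h1.and_eventually (eventually_ge_atTop t₀)).exists
    obtain ⟨q', hq', hd⟩ := ht₀ t ht'
    refine ⟨q', hq', ?_⟩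
    rw [Metric.mem_ball, dist_comm] at ht
    have := dist_triangle r (φ t q) q'
    linarith
  refine Subset.antisymm hsub ?_
  -- The trajectory ends up in a compact neighbourhood of the orbit, so at least one cluster point
  -- exists.
  obtain ⟨r₀, -, hr₀⟩ := (hc.cthickening (r := 1)).exists_mapClusterPt_of_frequently
    (l := atTop) (f := fun t => φ t q) (by
      obtain ⟨t₀, ht₀⟩ := hq 1 one_pos
      refine Eventually.frequently ?_
      filter_upwards [eventually_ge_atTop t₀] with t ht
      obtain ⟨q', hq', hd⟩ := ht₀ t ht
      exact Metric.thickening_subset_cthickening _ _ (Metric.mem_thickening_iff.2 ⟨q', hq', hd⟩))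
  obtain ⟨s₀, hs₀⟩ := hsub r₀ hr₀
  -- Cluster points are carried to cluster points by the flow, and the flow carries `r₀` to every
  -- point of the orbit.
  rintro _ ⟨s, rfl⟩
  have hcont : Continuous (φ (s - s₀)) := by
    refine (LipschitzWith.of_dist_le_mul (K := ⟨Real.exp (K * |s - s₀|), (Real.exp_pos _).le⟩)
      fun x y => ?_).continuous
    rw [mul_comm]
    exact h.dist_le _ x y
  have h1 := hr₀.continuousAt_comp hcont.continuousAt
  have h2 : MapClusterPt (φ (s - s₀) r₀) atTop (fun t => φ t q) := by
    rw [mapClusterPt_iff_frequently] at h1 ⊢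
    intro U hU
    have h3 := h1 U hU
    rw [frequently_atTop] at h3 ⊢
    intro t₀
    obtain ⟨t, ht, htU⟩ := h3 (t₀ - (s - s₀))
    refine ⟨s - s₀ + t, by linarith, ?_⟩
    rw [h.add]
    exact htU
  rw [← hs₀] at h2
  simpa only [← h.add, sub_add_cancel, mem_ofPred_eq] using h2

end AttractingFixedPoint

end LienardSystem

/-! ### From the phase plane to the Liénard plane -/

/-- The change of coordinates `(x, y) ↦ (x, y + F(x))`. -/
def shear (F : ℝ → ℝ) (hF : Continuous F) : ℝ × ℝ ≃ₜ ℝ × ℝ where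
  toFun p := (p.1, p.2 + F p.1)
  invFun p := (p.1, p.2 - F p.1)
  left_inv p := by simp
  right_inv p := by simp
  continuous_toFun := by fun_prop
  continuous_invFun := by fun_prop

theorem shear_apply (F : ℝ → ℝ) (hF : Continuous F) (p : ℝ × ℝ) :
    shear F hF p = (p.1, p.2 + F p.1) := rfl

theorem shear_symm_apply (F : ℝ → ℝ) (hF : Continuous F) (p : ℝ × ℝ) :
    (shear F hF).symm p = (p.1, p.2 - F p.1) := rfl

theorem HasDerivWithinAt.fst' {γ : ℝ → ℝ × ℝ} {γ' : ℝ × ℝ} {s : Set ℝ} {t : ℝ}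
    (h : HasDerivWithinAt γ γ' s t) : HasDerivWithinAt (fun t => (γ t).1) γ'.1 s t := by
  have h1 : HasFDerivAt Prod.fst (ContinuousLinearMap.fst ℝ ℝ ℝ) (γ t) := hasFDerivAt_fst
  exact h1.comp_hasDerivWithinAt t h

theorem HasDerivWithinAt.snd' {γ : ℝ → ℝ × ℝ} {γ' : ℝ × ℝ} {s : Set ℝ} {t : ℝ}
    (h : HasDerivWithinAt γ γ' s t) : HasDerivWithinAt (fun t => (γ t).2) γ'.2 s t := by
  have h1 : HasFDerivAt Prod.snd (ContinuousLinearMap.snd ℝ ℝ ℝ) (γ t) := hasFDerivAt_snd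
  exact h1.comp_hasDerivWithinAt t h

section Shear

variable {F f g : ℝ → ℝ} (hF : ∀ x, HasDerivAt F (f x) x) (hFc : Continuous F) {γ : ℝ → ℝ × ℝ}
  {s : Set ℝ} {t : ℝ}

/-- Since `F' = f`, the derivative of `F(x)` is `f(x) y`, which cancels the damping term in `y'`. -/
theorem hasDerivWithinAt_shear (hF : ∀ x, HasDerivAt F (f x) x)
    (h : HasDerivWithinAt γ (lienardField f g (γ t)) s t) :
    HasDerivWithinAt (fun t => shear F hFc (γ t)) (planeField F g (shear F hFc (γ t))) s t := by
  refine (h.fst'.prodMk (h.snd'.fun_add ((hF _).comp_hasDerivWithinAt t h.fst'))).congr_deriv ?_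
  simp only [lienardField, planeField, shear_apply, Prod.mk.injEq]
  constructor <;> ring

theorem hasDerivWithinAt_shear_symm (hF : ∀ x, HasDerivAt F (f x) x)
    (h : HasDerivWithinAt γ (planeField F g (γ t)) s t) :
    HasDerivWithinAt (fun t => (shear F hFc).symm (γ t))
      (lienardField f g ((shear F hFc).symm (γ t))) s t := by
  refine (h.fst'.prodMk (h.snd'.fun_sub ((hF _).comp_hasDerivWithinAt t h.fst'))).congr_deriv ?_
  simp only [lienardField, planeField, shear_symm_apply, Prod.mk.injEq]
  constructor
  · trivial
  · ring

end Shear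

/-- The flow in the phase plane. -/
structure IsPhaseFlow (f g : ℝ → ℝ) (ψ : ℝ → ℝ × ℝ → ℝ × ℝ) : Prop where
  zero : ∀ p, ψ 0 p = p
  isIntegralCurve : ∀ p, IsIntegralCurve (fun t => ψ t p) (fun _ => lienardField f g)
  eq_of_isIntegralCurve : ∀ γ, IsIntegralCurve γ (fun _ => lienardField f g) →
    ∀ t, γ t = ψ t (γ 0)
  eq_of_forward : ∀ γ, IsIntegralCurveOn γ (fun _ => lienardField f g) (Ici 0) →
    ∀ t, 0 ≤ t → γ t = ψ t (γ 0)

namespace IsPhaseFlow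

variable {f g : ℝ → ℝ} {ψ : ℝ → ℝ × ℝ → ℝ × ℝ}

theorem isForwardTrajectory (h : IsPhaseFlow f g ψ) (p : ℝ × ℝ) :
    IsForwardTrajectory (lienardField f g) p fun t => ψ t p :=
  ⟨h.zero p, (h.isIntegralCurve p).isIntegralCurveOn _⟩

end IsPhaseFlow

/-- The phase-plane field contains the product `f(x) y` and need not be globally Lipschitz, so its
flow is obtained by conjugation with the shear. -/
theorem IsFlow.isPhaseFlow {F f g : ℝ → ℝ} {K : ℝ} {φ : ℝ → ℝ × ℝ → ℝ × ℝ}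
    (h : IsFlow (planeField F g) K φ) (hF : ∀ x, HasDerivAt F (f x) x) (hFc : Continuous F) :
    IsPhaseFlow f g fun t p => (shear F hFc).symm (φ t (shear F hFc p)) where
  zero p := by rw [h.zero, Homeomorph.symm_apply_apply]
  isIntegralCurve p t := by
    have := hasDerivWithinAt_shear_symm hFc hF
      ((h.isIntegralCurve (shear F hFc p) t).hasDerivWithinAt (s := univ))
    exact this.hasDerivAt univ_mem
  eq_of_isIntegralCurve γ hγ t := by
    rw [Homeomorph.eq_symm_apply]
    refine h.eq_of_isIntegralCurve (fun t => shear F hFc (γ t)) (fun t => ?_) t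
    exact (hasDerivWithinAt_shear hFc hF ((hγ t).hasDerivWithinAt (s := univ))).hasDerivAt univ_mem
  eq_of_forward γ hγ t ht := by
    rw [Homeomorph.eq_symm_apply]
    exact h.eq_of_forward (fun t => shear F hFc (γ t))
      (fun t ht => hasDerivWithinAt_shear hFc hF (hγ t ht)) t ht

/-! ### Liénard's theorem in the phase plane -/

namespace LienardSystem

variable {F f g : ℝ → ℝ} {a c M K B : ℝ} {φ : ℝ → ℝ × ℝ → ℝ × ℝ} {T v p w : ℝ}

/-- **Liénard's theorem** in the phase plane, for a system with a Lipschitz flow in the Liénard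
plane which decreases large amplitudes. -/
theorem exists_limitCycle (S : LienardSystem F f g a c M) (h : IsFlow (planeField F g) K φ)
    (hB : ∀ T v p, HalfOrbit φ T v p → B < v → p < v) :
    ∃ Γ : Set (ℝ × ℝ), IsLimitCycle (lienardField f g) Γ ∧
      IsAsymptoticallyStable (lienardField f g) Γ ∧
      ∀ Γ' : Set (ℝ × ℝ), IsCycle (lienardField f g) Γ' → Γ' = Γ := by
  obtain ⟨T, w, W⟩ := S.exists_attractingFixedPoint h hB
  have hw := W.halfOrbit.v_pos
  have hTpos := W.halfOrbit.T_pos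
  have hψ := h.isPhaseFlow S.hasDerivAt_F S.continuous_F
  -- From here on the shear is used only as a homeomorphism conjugating the flows. It need not be an
  -- isometry, so neighbourhoods of the cycle are compared through compactness.
  generalize shear F S.continuous_F = H at hψ
  set O := AttractingFixedPoint.orbit φ w with hO
  have hOc : IsCompact O := W.isCompact_orbit S h
  set Γ := H ⁻¹' O with hΓ
  have hΓc : IsCompact Γ := H.isCompact_preimage.2 hOc
  have hw0 : ((0 : ℝ), w) ∈ O := ⟨0, h.zero _⟩
  have hΓrange : Γ = range fun t => H.symm (φ t (0, w)) := by
    ext q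
    constructor
    · rintro ⟨t, ht⟩
      exact ⟨t, by simp only at ht ⊢; rw [ht, Homeomorph.symm_apply_apply]⟩
    · rintro ⟨t, rfl⟩
      exact ⟨t, by simp⟩
  have hcurve : ∀ q, IsIntegralCurve (fun t => H.symm (φ t q)) (fun _ => lienardField f g) := by
    intro q
    have := hψ.isIntegralCurve (H.symm q)
    simpa using this
  have hcycle : IsCycle (lienardField f g) Γ := by
    refine ⟨fun t => H.symm (φ t (0, w)), 2 * T, by linarith, hcurve _, fun t => ?_, ⟨T, ?_⟩,
      hΓrange⟩
    · simp only
      rw [h.add, W.flow_two_mul_T S h]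
    · simp only
      rw [h.zero, W.flow_T]
      intro heq
      have := congrArg Prod.snd (H.symm.injective heq)
      simp only [Prod.snd_neg] at this
      linarith
  -- uniform neighbourhoods in the two planes
  have hnhd₁ : ∀ ε > 0, ∃ δ > 0, ∀ q, (∃ q' ∈ O, dist (H q) q' < δ) →
      q ∈ Metric.thickening ε Γ := by
    intro ε hε
    have hopen : IsOpen (H.symm ⁻¹' Metric.thickening ε Γ) :=
      Metric.isOpen_thickening.preimage H.symm.continuous
    have hO' : O ⊆ H.symm ⁻¹' Metric.thickening ε Γ := by
      intro q hq
      have hq' : H.symm q ∈ Γ := by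
        rw [hΓ, mem_preimage, Homeomorph.apply_symm_apply]
        exact hq
      exact mem_preimage.2 (Metric.self_subset_thickening hε Γ hq')
    obtain ⟨δ, hδ, hsub⟩ := hOc.exists_thickening_subset_open hopen hO'
    refine ⟨δ, hδ, fun q hq => ?_⟩
    have := mem_preimage.1 (hsub (Metric.mem_thickening_iff.2 hq))
    rwa [Homeomorph.symm_apply_apply] at this
  have hnhd₂ : ∀ ε > 0, ∃ δ > 0, ∀ q ∈ Metric.thickening δ Γ, ∃ q' ∈ O, dist (H q) q' < ε := by
    intro ε hε
    have hopen : IsOpen (H ⁻¹' Metric.thickening ε O) :=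
      Metric.isOpen_thickening.preimage H.continuous
    have hΓ' : Γ ⊆ H ⁻¹' Metric.thickening ε O := by
      intro q hq
      exact mem_preimage.2 (Metric.self_subset_thickening hε O (mem_preimage.1 hq))
    obtain ⟨δ, hδ, hsub⟩ := hΓc.exists_thickening_subset_open hopen hΓ'
    exact ⟨δ, hδ, fun q hq => Metric.mem_thickening_iff.1 (mem_preimage.1 (hsub hq))⟩
  have hfwd : ∀ q γ, IsForwardTrajectory (lienardField f g) q γ → ∀ t, 0 ≤ t →
      γ t = H.symm (φ t (H q)) := by
    rintro q γ ⟨h0, hγ⟩ t ht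
    rw [hψ.eq_of_forward γ hγ t ht, h0]
  refine ⟨Γ, ⟨hcycle, ?_⟩, ⟨fun ε hε => ?_, ?_⟩, ?_⟩
  · obtain ⟨δ, hδ, hatt⟩ := W.orbit_attracting S h
    have hne : ((0 : ℝ), w + δ / 2) ∉ O := fun hmem => by
      have := W.eq_of_mem_orbit S h (by positivity) hmem
      linarith
    have hlim := W.setOf_mapClusterPt_eq S h (q := (0, w + δ / 2))
      (hatt _ (0, w) hw0 (by
        rw [dist_zero_mk, add_sub_cancel_left, abs_of_pos (by positivity)]
        exact half_lt_self hδ))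
    refine ⟨H.symm (0, w + δ / 2), fun t => H.symm (φ t (0, w + δ / 2)), ?_, Or.inl ⟨⟨?_, ?_⟩, ?_⟩⟩
    · rw [hΓ, mem_preimage, Homeomorph.apply_symm_apply]
      exact hne
    · simp only
      rw [h.zero]
    · exact (hcurve _).isIntegralCurveOn _
    · ext q
      rw [hΓ, mem_preimage, hO, ← hlim, mem_ofPred_eq, mem_ofPred_eq]
      constructor
      · intro hq
        have := hq.continuousAt_comp H.symm.continuous.continuousAt
        simpa [Function.comp_def] using this
      · intro hq
        have := hq.continuousAt_comp H.continuous.continuousAt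
        simpa [Function.comp_def] using this
  · obtain ⟨ε', hε', hin⟩ := hnhd₁ ε hε
    obtain ⟨δ', hδ', hst⟩ := W.orbit_stable S h hε'
    obtain ⟨δ, hδ, hout⟩ := hnhd₂ δ' hδ'
    refine ⟨δ, hδ, fun q hq => ⟨⟨_, hψ.isForwardTrajectory q⟩, fun γ hγ t ht => ?_⟩⟩
    rw [hfwd q γ hγ t ht]
    refine hin _ ?_
    rw [Homeomorph.apply_symm_apply]
    obtain ⟨q', hq', hd⟩ := hout q hq
    exact hst _ q' hq' hd t ht
  · obtain ⟨δ', hδ', hatt⟩ := W.orbit_attracting S h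
    obtain ⟨δ, hδ, hout⟩ := hnhd₂ δ' hδ'
    refine ⟨δ, hδ, fun q hq γ hγ => ?_⟩
    rw [Metric.tendsto_atTop]
    intro ε hε
    obtain ⟨ε', hε', hin⟩ := hnhd₁ ε hε
    obtain ⟨q', hq', hd⟩ := hout q hq
    obtain ⟨t₀, ht₀⟩ := hatt _ q' hq' hd ε' hε'
    refine ⟨max t₀ 0, fun t ht => ?_⟩
    have hmem : γ t ∈ Metric.thickening ε Γ := by
      rw [hfwd q γ hγ t ((le_max_right _ _).trans ht)]
      refine hin _ ?_
      rw [Homeomorph.apply_symm_apply]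
      exact ht₀ t ((le_max_left _ _).trans ht)
    rw [Real.dist_eq, sub_zero, abs_of_nonneg Metric.infDist_nonneg]
    obtain ⟨z, hz, hdz⟩ := Metric.mem_thickening_iff.1 hmem
    exact (Metric.infDist_le_dist_of_mem hz).trans_lt hdz
  -- The transported cycle avoids the equilibrium, so it has a point on the orbit of `(0, w)`; the
  -- two curves then differ by a time shift and have the same range.
  · rintro Γ' ⟨γ, τ, hτ, hγ, hper, ⟨t₁, ht₁⟩, rfl⟩
    have hγeq : ∀ t, H (γ t) = φ t (H (γ 0)) := fun t => by
      rw [hψ.eq_of_isIntegralCurve γ hγ t, Homeomorph.apply_symm_apply]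
    have hne : H (γ 0) ≠ 0 := by
      intro h0
      apply ht₁
      apply H.injective
      rw [hγeq t₁, h0, S.flow_zero h]
    obtain ⟨s, hs⟩ := W.mem_orbit_of_periodic S h hne hτ (by
      rw [← hγeq τ]
      have := hper 0
      rw [zero_add] at this
      rw [this])
    simp only at hs
    have hγeq' : ∀ t, γ t = H.symm (φ (t + s) (0, w)) := fun t => by
      rw [Homeomorph.eq_symm_apply, hγeq t, ← hs, h.add]
    rw [hΓrange]
    ext q
    constructor
    · rintro ⟨t, rfl⟩
      exact ⟨t + s, (hγeq' t).symm⟩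
    · rintro ⟨t, rfl⟩
      exact ⟨t - s, by rw [hγeq', sub_add_cancel]⟩

end LienardSystem

/-! ### The coefficients of the truncated oscillator -/

section Coefficients

variable {μ k α τ₀ : ℝ}

theorem one_le_mass (hα : 0 < α) (τ₀ x : ℝ) : 1 ≤ 1 + α * delay τ₀ x ^ 2 / 2 := by
  have : 0 ≤ α * delay τ₀ x ^ 2 / 2 := by positivity
  linarith

theorem mass_pos (hα : 0 < α) (τ₀ x : ℝ) : 0 < 1 + α * delay τ₀ x ^ 2 / 2 :=
  one_pos.trans_le (one_le_mass hα τ₀ x)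

theorem continuous_delay : Continuous fun p : ℝ × ℝ => delay p.1 p.2 := by
  unfold delay
  fun_prop

theorem continuous_dampingCoeff_uncurry (hα : 0 < α) :
    Continuous fun p : ℝ × ℝ => dampingCoeff μ α p.1 p.2 := by
  have := continuous_delay
  unfold dampingCoeff
  exact Continuous.div (by fun_prop) (by fun_prop) fun p => (mass_pos hα p.1 p.2).ne'

theorem continuous_restoringForce_uncurry (hα : 0 < α) :
    Continuous fun p : ℝ × ℝ => restoringForce k α p.1 p.2 := by
  have := continuous_delay
  unfold restoringForce
  exact Continuous.div (by fun_prop) (by fun_prop) fun p => (mass_pos hα p.1 p.2).ne'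

theorem continuous_dampingCoeff (hα : 0 < α) : Continuous (dampingCoeff μ α τ₀) :=
  (continuous_dampingCoeff_uncurry hα).comp (f := fun x => (τ₀, x)) (by fun_prop)

theorem continuous_restoringForce (hα : 0 < α) : Continuous (restoringForce k α τ₀) :=
  (continuous_restoringForce_uncurry hα).comp (f := fun x => (τ₀, x)) (by fun_prop)

theorem hasDerivAt_dampingPrimitive (hα : 0 < α) (x : ℝ) :
    HasDerivAt (dampingPrimitive μ α τ₀) (dampingCoeff μ α τ₀ x) x :=
  intervalIntegral.integral_hasDerivAt_right ((continuous_dampingCoeff hα).intervalIntegrable _ _)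
    (continuous_dampingCoeff hα).aestronglyMeasurable.stronglyMeasurableAtFilter
    (continuous_dampingCoeff hα).continuousAt

theorem continuous_dampingPrimitive (hα : 0 < α) : Continuous (dampingPrimitive μ α τ₀) :=
  continuous_iff_continuousAt.2 fun x => (hasDerivAt_dampingPrimitive hα x).continuousAt

theorem contDiff_dampingPrimitive (hα : 0 < α) : ContDiff ℝ 1 (dampingPrimitive μ α τ₀) := by
  rw [contDiff_one_iff_deriv]
  refine ⟨fun x => (hasDerivAt_dampingPrimitive hα x).differentiableAt, ?_⟩
  have : deriv (dampingPrimitive μ α τ₀) = dampingCoeff μ α τ₀ :=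
    funext fun x => (hasDerivAt_dampingPrimitive hα x).deriv
  rw [this]
  exact continuous_dampingCoeff hα

theorem contDiff_restoringForce (hα : 0 < α) : ContDiff ℝ 1 (restoringForce k α τ₀) := by
  unfold restoringForce delay
  refine ContDiff.div (by fun_prop) (by fun_prop) fun x => ?_
  exact (mass_pos hα τ₀ x).ne'

theorem delay_neg (τ₀ x : ℝ) : delay τ₀ (-x) = delay τ₀ x := by simp [delay]

theorem delay_zero (τ₀ : ℝ) : delay τ₀ 0 = τ₀ := by simp [delay]

theorem dampingCoeff_neg (x : ℝ) : dampingCoeff μ α τ₀ (-x) = dampingCoeff μ α τ₀ x := by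
  simp [dampingCoeff, delay_neg]

theorem restoringForce_neg (x : ℝ) : restoringForce k α τ₀ (-x) = -restoringForce k α τ₀ x := by
  simp only [restoringForce, delay_neg]
  ring

theorem dampingPrimitive_neg (x : ℝ) :
    dampingPrimitive μ α τ₀ (-x) = -dampingPrimitive μ α τ₀ x := by
  have := intervalIntegral.integral_comp_neg (dampingCoeff μ α τ₀) (a := 0) (b := x)
  simp only [dampingCoeff_neg, neg_zero] at this
  rw [dampingPrimitive, dampingPrimitive, this, intervalIntegral.integral_symm]

theorem dampingPrimitive_zero : dampingPrimitive μ α τ₀ 0 = 0 := by simp [dampingPrimitive]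

theorem restoringForce_zero : restoringForce k α τ₀ 0 = 0 := by simp [restoringForce]

theorem exp_neg_sq_le_one (x : ℝ) : Real.exp (-x ^ 2) ≤ 1 :=
  Real.exp_le_one_iff.2 (neg_nonpos.2 (sq_nonneg x))

/-- The weaker bound is the derivative of `arctan`, which is bounded; it serves to bound `F(x) - μ
x` uniformly in `x`. -/
theorem exp_neg_sq_le_inv (x : ℝ) : Real.exp (-x ^ 2) ≤ 1 / (1 + x ^ 2) := by
  rw [Real.exp_neg, ← one_div]
  have := Real.add_one_le_exp (x ^ 2)
  exact one_div_le_one_div_of_le (by positivity) (by linarith)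

theorem sq_mul_exp_neg_sq_le_one (x : ℝ) : x ^ 2 * Real.exp (-x ^ 2) ≤ 1 := by
  have h1 := exp_neg_sq_le_inv x
  calc x ^ 2 * Real.exp (-x ^ 2) ≤ x ^ 2 * (1 / (1 + x ^ 2)) := by gcongr
    _ ≤ 1 := by
      rw [mul_one_div, div_le_one (by positivity)]
      linarith

theorem abs_mul_exp_neg_sq_le_one (x : ℝ) : |x| * Real.exp (-x ^ 2) ≤ 1 := by
  have h1 := exp_neg_sq_le_inv x
  calc |x| * Real.exp (-x ^ 2) ≤ |x| * (1 / (1 + x ^ 2)) := by gcongr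
    _ ≤ 1 := by
      rw [mul_one_div, div_le_one (by positivity)]
      nlinarith [sq_nonneg (|x| - 1), sq_abs x]

theorem abs_delay (τ₀ x : ℝ) : |delay τ₀ x| = |τ₀| * Real.exp (-x ^ 2) := by
  rw [delay, abs_mul, Real.abs_exp]

theorem delay_sq_le (τ₀ x : ℝ) : delay τ₀ x ^ 2 ≤ τ₀ ^ 2 * Real.exp (-x ^ 2) := by
  have h1 := exp_neg_sq_le_one x
  have h2 := Real.exp_pos (-x ^ 2)
  rw [delay, mul_pow]
  gcongr
  nlinarith

/-- A bound for `|F(x) - μ x|` and `|(k + α) x - g(x)|`. -/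
noncomputable def remainderBound (μ k α τ₀ : ℝ) : ℝ :=
  2 * (α * |τ₀| + μ * α * τ₀ ^ 2 / 2) + (k + α) * (α * τ₀ ^ 2 / 2)

/-- Makes the bounds uniform over bounded delays, as needed for the cycles near the critical delay.
-/
theorem remainderBound_le {R : ℝ} (hμ : 0 < μ) (hα : 0 < α) (hk : 0 < k + α) (h : |τ₀| ≤ R) :
    remainderBound μ k α τ₀ ≤ remainderBound μ k α R := by
  have hR : |R| = R := abs_of_nonneg ((abs_nonneg _).trans h)
  have h2 : τ₀ ^ 2 ≤ R ^ 2 := sq_le_sq.2 (h.trans (le_abs_self R))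
  unfold remainderBound
  rw [hR]
  gcongr

theorem abs_dampingCoeff_sub_le (hμ : 0 < μ) (hα : 0 < α) (x : ℝ) :
    |dampingCoeff μ α τ₀ x - μ| ≤ (α * |τ₀| + μ * α * τ₀ ^ 2 / 2) * (1 / (1 + x ^ 2)) := by
  have hD := mass_pos hα τ₀ x
  have hD1 := one_le_mass hα τ₀ x
  have h1 : dampingCoeff μ α τ₀ x - μ =
      -(α * delay τ₀ x + μ * α * delay τ₀ x ^ 2 / 2) / (1 + α * delay τ₀ x ^ 2 / 2) := by
    rw [dampingCoeff]
    field_simp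
    ring
  rw [h1, abs_div, abs_of_pos hD, abs_neg]
  calc |α * delay τ₀ x + μ * α * delay τ₀ x ^ 2 / 2| / (1 + α * delay τ₀ x ^ 2 / 2)
      ≤ |α * delay τ₀ x + μ * α * delay τ₀ x ^ 2 / 2| := div_le_self (abs_nonneg _) hD1
    _ ≤ α * |delay τ₀ x| + μ * α * delay τ₀ x ^ 2 / 2 := by
      refine (abs_add_le _ _).trans (le_of_eq ?_)
      rw [abs_mul, abs_of_pos hα, abs_of_nonneg (by positivity : 0 ≤ μ * α * delay τ₀ x ^ 2 / 2)]
    _ ≤ α * (|τ₀| * Real.exp (-x ^ 2)) + μ * α * (τ₀ ^ 2 * Real.exp (-x ^ 2)) / 2 := by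
      rw [abs_delay]
      have := delay_sq_le τ₀ x
      gcongr
    _ = (α * |τ₀| + μ * α * τ₀ ^ 2 / 2) * Real.exp (-x ^ 2) := by ring
    _ ≤ _ := by
      have := exp_neg_sq_le_inv x
      gcongr

theorem abs_dampingCoeff_le (hμ : 0 < μ) (hα : 0 < α) (x : ℝ) :
    |dampingCoeff μ α τ₀ x| ≤ μ + (α * |τ₀| + μ * α * τ₀ ^ 2 / 2) := by
  have h1 := abs_dampingCoeff_sub_le (τ₀ := τ₀) hμ hα x
  have h2 : (1 : ℝ) / (1 + x ^ 2) ≤ 1 := by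
    rw [div_le_one (by positivity)]
    nlinarith [sq_nonneg x]
  have h3 : (α * |τ₀| + μ * α * τ₀ ^ 2 / 2) * (1 / (1 + x ^ 2)) ≤
      (α * |τ₀| + μ * α * τ₀ ^ 2 / 2) := mul_le_of_le_one_right (by positivity) h2
  have h4 := abs_add_le (dampingCoeff μ α τ₀ x - μ) μ
  rw [sub_add_cancel, abs_of_pos hμ] at h4
  linarith

/-- Both `C arctan x ± (F(x) - μ x)` are nondecreasing and vanish at `0`. The factor `2` in
`remainderBound` is a round upper bound for `π / 2`. -/
theorem abs_dampingPrimitive_sub_le (hμ : 0 < μ) (hα : 0 < α) (hk : 0 < k + α) (x : ℝ) :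
    |dampingPrimitive μ α τ₀ x - μ * x| ≤ remainderBound μ k α τ₀ := by
  set C := α * |τ₀| + μ * α * τ₀ ^ 2 / 2 with hC
  have hC0 : 0 ≤ C := by positivity
  have hd : ∀ x, HasDerivAt (fun x => dampingPrimitive μ α τ₀ x - μ * x)
      (dampingCoeff μ α τ₀ x - μ) x := fun x => by
    simpa using (hasDerivAt_dampingPrimitive hα x).fun_sub ((hasDerivAt_id' x).const_mul μ)
  have ha : ∀ x, HasDerivAt (fun x => C * Real.arctan x) (C * (1 / (1 + x ^ 2))) x := fun x =>
    (Real.hasDerivAt_arctan x).const_mul C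
  have hbound := fun x => abs_le.1 (abs_dampingCoeff_sub_le (τ₀ := τ₀) hμ hα x)
  have hm₁ : Monotone fun x => C * Real.arctan x - (dampingPrimitive μ α τ₀ x - μ * x) :=
    monotone_of_hasDerivAt_nonneg (fun x => (ha x).fun_sub (hd x)) fun x => by
      have := (hbound x).2
      rw [← hC] at this
      simp only [Pi.zero_apply]
      linarith
  have hm₂ : Monotone fun x => C * Real.arctan x + (dampingPrimitive μ α τ₀ x - μ * x) :=
    monotone_of_hasDerivAt_nonneg (fun x => (ha x).fun_add (hd x)) fun x => by
      have := (hbound x).1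
      rw [← hC] at this
      simp only [Pi.zero_apply]
      linarith
  have h2C : 2 * C ≤ remainderBound μ k α τ₀ := by
    have : 0 ≤ (k + α) * (α * τ₀ ^ 2 / 2) := by positivity
    unfold remainderBound
    linarith
  have hpi : Real.pi / 2 ≤ 2 := by linarith [Real.pi_le_four]
  have hup : C * Real.arctan x ≤ 2 * C := by
    have := (Real.arctan_lt_pi_div_two x).le
    nlinarith
  have hlo : -(2 * C) ≤ C * Real.arctan x := by
    have := (Real.neg_pi_div_two_lt_arctan x).le
    nlinarith
  rw [abs_le]
  rcases le_total 0 x with hx | hx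
  · have h1 := hm₁ hx
    have h2 := hm₂ hx
    simp only [Real.arctan_zero, dampingPrimitive_zero, mul_zero, sub_zero, add_zero] at h1 h2
    constructor <;> linarith
  · have h1 := hm₁ hx
    have h2 := hm₂ hx
    simp only [Real.arctan_zero, dampingPrimitive_zero, mul_zero, sub_zero, add_zero] at h1 h2
    constructor <;> linarith

theorem abs_sub_restoringForce_le (hμ : 0 < μ) (hα : 0 < α) (hk : 0 < k + α) (x : ℝ) :
    |(k + α) * x - restoringForce k α τ₀ x| ≤ remainderBound μ k α τ₀ := by
  have hD := mass_pos hα τ₀ x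
  have hD1 := one_le_mass hα τ₀ x
  have h1 : (k + α) * x - restoringForce k α τ₀ x =
      (k + α) * (α / 2) * (x * delay τ₀ x ^ 2) / (1 + α * delay τ₀ x ^ 2 / 2) := by
    rw [restoringForce]
    field_simp
    ring
  rw [h1, abs_div, abs_of_pos hD]
  calc |(k + α) * (α / 2) * (x * delay τ₀ x ^ 2)| / (1 + α * delay τ₀ x ^ 2 / 2)
      ≤ |(k + α) * (α / 2) * (x * delay τ₀ x ^ 2)| := div_le_self (abs_nonneg _) hD1
    _ = (k + α) * (α / 2) * (|x| * delay τ₀ x ^ 2) := by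
      rw [abs_mul, abs_mul x, abs_of_pos (by positivity : 0 < (k + α) * (α / 2)),
        abs_of_nonneg (sq_nonneg (delay τ₀ x))]
    _ ≤ (k + α) * (α / 2) * (|x| * (τ₀ ^ 2 * Real.exp (-x ^ 2))) := by
      have := delay_sq_le τ₀ x
      gcongr
    _ = (k + α) * (α / 2) * τ₀ ^ 2 * (|x| * Real.exp (-x ^ 2)) := by ring
    _ ≤ (k + α) * (α / 2) * τ₀ ^ 2 * 1 := by
      have := abs_mul_exp_neg_sq_le_one x
      gcongr
    _ ≤ remainderBound μ k α τ₀ := by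
      have : 0 ≤ 2 * (α * |τ₀| + μ * α * τ₀ ^ 2 / 2) := by positivity
      unfold remainderBound
      linarith

theorem hasDerivAt_restoringForce (hα : 0 < α) (x : ℝ) :
    HasDerivAt (restoringForce k α τ₀)
      ((k + α) * (1 + α * delay τ₀ x ^ 2 / 2 + 2 * α * x ^ 2 * delay τ₀ x ^ 2) /
        (1 + α * delay τ₀ x ^ 2 / 2) ^ 2) x := by
  have h1 : HasDerivAt (delay τ₀) (-(2 * x * delay τ₀ x)) x := by
    have := (((hasDerivAt_id' x).fun_pow 2).fun_neg.exp).const_mul τ₀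
    refine this.congr_deriv ?_
    simp [delay]
    ring
  have h2 : HasDerivAt (fun x => 1 + α * delay τ₀ x ^ 2 / 2)
      (-(2 * α * x * delay τ₀ x ^ 2)) x := by
    have := (((h1.fun_pow 2).const_mul α).div_const 2).const_add 1
    refine this.congr_deriv ?_
    simp
    ring
  refine (((hasDerivAt_id' x).const_mul (k + α)).fun_div h2 (mass_pos hα τ₀ x).ne').congr_deriv ?_
  congr 1
  ring

theorem abs_deriv_restoringForce_le (hα : 0 < α) (hk : 0 < k + α) (x : ℝ) :
    |(k + α) * (1 + α * delay τ₀ x ^ 2 / 2 + 2 * α * x ^ 2 * delay τ₀ x ^ 2) /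
      (1 + α * delay τ₀ x ^ 2 / 2) ^ 2| ≤ (k + α) * (1 + α * τ₀ ^ 2 / 2 + 2 * α * τ₀ ^ 2) := by
  have hD1 := one_le_mass hα τ₀ x
  rw [abs_of_nonneg (by positivity)]
  refine (div_le_self (by positivity) (one_le_pow₀ hD1)).trans ?_
  have h1 := delay_sq_le τ₀ x
  have h2 : τ₀ ^ 2 * Real.exp (-x ^ 2) ≤ τ₀ ^ 2 :=
    mul_le_of_le_one_right (sq_nonneg _) (exp_neg_sq_le_one x)
  have h3 : x ^ 2 * delay τ₀ x ^ 2 ≤ τ₀ ^ 2 := by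
    calc x ^ 2 * delay τ₀ x ^ 2 ≤ x ^ 2 * (τ₀ ^ 2 * Real.exp (-x ^ 2)) := by gcongr
      _ = τ₀ ^ 2 * (x ^ 2 * Real.exp (-x ^ 2)) := by ring
      _ ≤ τ₀ ^ 2 * 1 := by
        have := sq_mul_exp_neg_sq_le_one x
        gcongr
      _ = τ₀ ^ 2 := mul_one _
  have h4 := h1.trans h2
  rw [mul_assoc (2 * α)]
  gcongr ?_ * (1 + ?_ * ?_ / 2 + _ * ?_)

/-- The vector field of the oscillator in the Liénard plane has a global Lipschitz flow. -/
theorem exists_isFlow_oscillator (hμ : 0 < μ) (hα : 0 < α) (hk : 0 < k + α) (τ₀ : ℝ) :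
    ∃ K φ, IsFlow (planeField (dampingPrimitive μ α τ₀) (restoringForce k α τ₀)) K φ := by
  have hF : LipschitzWith (Real.toNNReal (μ + (α * |τ₀| + μ * α * τ₀ ^ 2 / 2)))
      (dampingPrimitive μ α τ₀) := by
    refine lipschitzWith_of_nnnorm_deriv_le
      (fun x => (hasDerivAt_dampingPrimitive hα x).differentiableAt) fun x => ?_
    rw [(hasDerivAt_dampingPrimitive hα x).deriv, ← NNReal.coe_le_coe, coe_nnnorm,
      Real.coe_toNNReal _ (by positivity)]
    exact abs_dampingCoeff_le hμ hα x
  have hg : LipschitzWith (Real.toNNReal ((k + α) * (1 + α * τ₀ ^ 2 / 2 + 2 * α * τ₀ ^ 2)))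
      (restoringForce k α τ₀) := by
    refine lipschitzWith_of_nnnorm_deriv_le
      (fun x => (hasDerivAt_restoringForce hα x).differentiableAt) fun x => ?_
    rw [(hasDerivAt_restoringForce hα x).deriv, ← NNReal.coe_le_coe, coe_nnnorm,
      Real.coe_toNNReal _ (by positivity)]
    exact abs_deriv_restoringForce_le hα hk x
  have hlip := (LipschitzWith.prod_snd.sub (hF.comp (LipschitzWith.prod_fst (α := ℝ) (β := ℝ))))
    |>.prodMk (hg.comp (LipschitzWith.prod_fst (α := ℝ) (β := ℝ))).neg
  have hcd : ContDiff ℝ 1 (planeField (dampingPrimitive μ α τ₀) (restoringForce k α τ₀)) := by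
    have h1 := (contDiff_dampingPrimitive (μ := μ) (τ₀ := τ₀) hα).comp
      (contDiff_fst (𝕜 := ℝ) (E := ℝ) (F := ℝ) (n := 1))
    have h2 := (contDiff_restoringForce (k := k) (τ₀ := τ₀) hα).comp
      (contDiff_fst (𝕜 := ℝ) (E := ℝ) (F := ℝ) (n := 1))
    exact (contDiff_snd.sub h1).prodMk h2.neg
  obtain ⟨φ, hφ⟩ := exists_isFlow hlip hcd
  exact ⟨_, φ, hφ⟩

/-! ### Above the critical delay -/

theorem mul_restoringForce_pos (hα : 0 < α) (hk : 0 < k + α) {x : ℝ} (hx : x ≠ 0) :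
    0 < x * restoringForce k α τ₀ x := by
  rw [restoringForce, ← mul_div_assoc]
  refine div_pos ?_ (mass_pos hα τ₀ x)
  have : x * ((k + α) * x) = (k + α) * x ^ 2 := by ring
  rw [this]
  positivity

theorem mul_le_restoringForce (hα : 0 < α) (hk : 0 < k + α) {x : ℝ} (hx : 0 ≤ x) :
    (k + α) / (1 + α * τ₀ ^ 2 / 2) * x ≤ restoringForce k α τ₀ x := by
  have h1 := delay_sq_le τ₀ x
  have h2 : τ₀ ^ 2 * Real.exp (-x ^ 2) ≤ τ₀ ^ 2 :=
    mul_le_of_le_one_right (sq_nonneg _) (exp_neg_sq_le_one x)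
  rw [restoringForce, div_mul_eq_mul_div]
  have h3 := mass_pos hα τ₀ x
  have h4 := mul_le_mul_of_nonneg_left (h1.trans h2) hα.le
  refine div_le_div_of_nonneg_left (mul_nonneg hk.le hx) h3 (by linarith)

theorem tendsto_dampingPrimitive (hμ : 0 < μ) (hα : 0 < α) :
    Tendsto (dampingPrimitive μ α τ₀) atTop atTop := by
  -- `F` does not involve `k`; the value `k = 0` is admissible in the bound because `0 + α > 0`.
  refine tendsto_atTop_mono (f := fun x => μ * x + -remainderBound μ 0 α τ₀) (fun x => ?_)
    (tendsto_atTop_add_const_right _ _ (tendsto_id.const_mul_atTop hμ))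
  have := (abs_le.1 (abs_dampingPrimitive_sub_le (k := 0) (τ₀ := τ₀) hμ hα (by linarith) x)).1
  linarith

/-- The damping changes sign once on `x > 0`, at the point `b` where `α τ(b) = μ`. Thus `F`
decreases from `0` up to `b` and then increases to `∞`, with its root beyond `b`. -/
theorem exists_root (hμ : 0 < μ) (hα : 0 < α) (hτ : criticalDelay μ α < τ₀) :
    ∃ a, 0 < a ∧ dampingPrimitive μ α τ₀ a = 0 ∧
      (∀ x, 0 < x → x < a → dampingPrimitive μ α τ₀ x < 0) ∧
      StrictMonoOn (dampingPrimitive μ α τ₀) (Ici a) := by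
  have hμτ : μ < α * τ₀ := by
    rw [criticalDelay, div_lt_iff₀ hα] at hτ
    linarith
  have hτ0 : 0 < α * τ₀ := hμ.trans hμτ
  have hlog : 0 < Real.log (α * τ₀ / μ) := Real.log_pos ((one_lt_div hμ).2 hμτ)
  set b := √(Real.log (α * τ₀ / μ)) with hb
  have hbpos : 0 < b := Real.sqrt_pos.2 hlog
  have hexpb : α * τ₀ * Real.exp (-b ^ 2) = μ := by
    rw [hb, Real.sq_sqrt hlog.le, Real.exp_neg, Real.exp_log (div_pos hτ0 hμ), inv_div,
      mul_div_cancel₀ _ hτ0.ne']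
  have hneg : ∀ x, 0 < x → x < b → dampingCoeff μ α τ₀ x < 0 := by
    intro x hx hxb
    refine div_neg_of_neg_of_pos ?_ (mass_pos hα τ₀ x)
    have : Real.exp (-b ^ 2) < Real.exp (-x ^ 2) :=
      Real.exp_lt_exp.2 (neg_lt_neg (pow_lt_pow_left₀ hxb hx.le two_ne_zero))
    have := mul_lt_mul_of_pos_left this hτ0
    rw [delay]
    linarith
  have hpos : ∀ x, b < x → 0 < dampingCoeff μ α τ₀ x := by
    intro x hxb
    refine div_pos ?_ (mass_pos hα τ₀ x)
    have : Real.exp (-x ^ 2) < Real.exp (-b ^ 2) :=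
      Real.exp_lt_exp.2 (neg_lt_neg (pow_lt_pow_left₀ hxb hbpos.le two_ne_zero))
    have := mul_lt_mul_of_pos_left this hτ0
    rw [delay]
    linarith
  have hc := continuous_dampingPrimitive (μ := μ) (τ₀ := τ₀) hα
  have hanti : StrictAntiOn (dampingPrimitive μ α τ₀) (Icc 0 b) := by
    refine strictAntiOn_of_hasDerivWithinAt_neg (convex_Icc _ _) hc.continuousOn
      (fun x _ => (hasDerivAt_dampingPrimitive hα x).hasDerivWithinAt) fun x hx => ?_
    rw [interior_Icc] at hx
    exact hneg x hx.1 hx.2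
  have hmono : StrictMonoOn (dampingPrimitive μ α τ₀) (Ici b) := by
    refine strictMonoOn_of_hasDerivWithinAt_pos (convex_Ici _) hc.continuousOn
      (fun x _ => (hasDerivAt_dampingPrimitive hα x).hasDerivWithinAt) fun x hx => ?_
    rw [interior_Ici] at hx
    exact hpos x hx
  have hF0 : ∀ x, 0 < x → x ≤ b → dampingPrimitive μ α τ₀ x < 0 := fun x hx hxb => by
    have := hanti ⟨le_rfl, hbpos.le⟩ ⟨hx.le, hxb⟩ hx
    rwa [dampingPrimitive_zero] at this
  obtain ⟨r, hr0, hrb⟩ := ((tendsto_dampingPrimitive (τ₀ := τ₀) hμ hα).eventually_ge_atTop 0 |>.and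
    (eventually_ge_atTop b)).exists
  obtain ⟨a, ha, ha0⟩ := intermediate_value_Icc hrb hc.continuousOn ⟨(hF0 b hbpos le_rfl).le, hr0⟩
  refine ⟨a, hbpos.trans_le ha.1, ha0, fun x hx hxa => ?_, hmono.mono (Ici_subset_Ici.2 ha.1)⟩
  rcases le_total x b with hxb | hxb
  · exact hF0 x hx hxb
  · rw [← ha0]
    exact hmono hxb ha.1 hxa

theorem exists_lienardSystem (hμ : 0 < μ) (hα : 0 < α) (hk : 0 < k + α)
    (hτ : criticalDelay μ α < τ₀) :
    ∃ a c M, LienardSystem (dampingPrimitive μ α τ₀) (dampingCoeff μ α τ₀)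
      (restoringForce k α τ₀) a c M := by
  obtain ⟨a, ha, ha0, hneg, hmono⟩ := exists_root hμ hα hτ
  refine ⟨a, (k + α) / (1 + α * τ₀ ^ 2 / 2), remainderBound μ k α τ₀, ha,
    hasDerivAt_dampingPrimitive hα, continuous_dampingCoeff hα, continuous_restoringForce hα,
    dampingPrimitive_neg, restoringForce_neg, hneg, ha0, hmono, by positivity,
    fun x hx => mul_le_restoringForce hα hk hx, fun x hx => ?_⟩
  have := (abs_le.1 (abs_dampingPrimitive_sub_le (τ₀ := τ₀) hμ hα hk x)).1
  have := mul_nonneg hμ.le hx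
  linarith

theorem deriv_dampingPrimitive_zero (hα : 0 < α) :
    deriv (dampingPrimitive μ α τ₀) 0 = (μ - α * τ₀) / (1 + α * τ₀ ^ 2 / 2) := by
  rw [(hasDerivAt_dampingPrimitive hα 0).deriv, dampingCoeff, delay_zero]

/-- Necessity comes from the slope `F'(0) < 0` alone. -/
theorem lienardHypotheses_iff (hμ : 0 < μ) (hα : 0 < α) (hk : 0 < k + α) :
    LienardHypotheses (dampingPrimitive μ α τ₀) (restoringForce k α τ₀) ↔
      criticalDelay μ α < τ₀ := by
  have hD : 0 < 1 + α * τ₀ ^ 2 / 2 := by positivity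
  have hiff : (μ - α * τ₀) / (1 + α * τ₀ ^ 2 / 2) < 0 ↔ criticalDelay μ α < τ₀ := by
    rw [div_lt_iff₀ hD, zero_mul, criticalDelay, div_lt_iff₀ hα, sub_neg, mul_comm]
  constructor
  · intro h
    have := h.deriv_neg
    rwa [deriv_dampingPrimitive_zero hα, hiff] at this
  · intro h
    obtain ⟨a, ha, ha0, hneg, hmono⟩ := exists_root hμ hα h
    refine ⟨contDiff_dampingPrimitive hα, contDiff_restoringForce hα, dampingPrimitive_neg,
      restoringForce_neg, fun x hx => ?_, dampingPrimitive_zero, ?_, a, ha, ha0,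
      fun x hx hx0 => ?_, hmono, tendsto_dampingPrimitive hμ hα⟩
    · exact mul_restoringForce_pos hα hk hx
    · rwa [deriv_dampingPrimitive_zero hα, hiff]
    · rcases lt_trichotomy x a with hlt | heq | hlt
      · exact absurd hx0 (hneg x hx hlt).ne
      · exact heq
      · have := hmono self_mem_Ici hlt.le hlt
        rw [ha0, hx0] at this
        exact absurd this (lt_irrefl 0)

end Coefficients

/-! ### Dissipation at large amplitudes -/

section Dissipation

/-- The derivative of `v² / 2 + κ x² / 2 - ε x v` along a bounded perturbation of the linear
system `x' = v - μ x`, `v' = -κ x` is negative at large amplitudes. -/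
theorem exists_dissipation {μ κ C : ℝ} (hμ : 0 < μ) (hκ : 0 < κ) :
    ∃ ε > 0, ε ^ 2 < κ ∧ ∃ R ≥ 0, ∀ x v F g : ℝ, |F - μ * x| ≤ C → |κ * x - g| ≤ C →
      R < v ^ 2 / 2 + κ * x ^ 2 / 2 - ε * (x * v) →
      v * -g + κ * x * (v - F) - ε * ((v - F) * v + x * -g) < 0 := by
  have hden : 0 < 2 * κ + μ ^ 2 := by positivity
  -- Without the cross term the linear system dissipates only `κ μ x²`; the cross term adds `-ε v²`.
  -- This `ε` makes `κ (μ - ε) - ε μ² / 2 = κ μ / 2`.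
  set ε := κ * μ / (2 * κ + μ ^ 2) with hε
  have hεpos : 0 < ε := by positivity
  have hεeq : ε * (2 * κ + μ ^ 2) = κ * μ := div_mul_cancel₀ _ hden.ne'
  have hεsq : ε ^ 2 < κ := by
    have h1 : ε * μ < κ := by
      nlinarith [mul_pos hεpos hκ, mul_pos hεpos hμ]
    have h2 : ε * 2 ≤ μ := by
      have : 0 ≤ ε * μ ^ 2 := by positivity
      nlinarith
    nlinarith
  -- `N` collects the constants left by completing squares in the perturbation terms: the derivative
  -- is at most `-A + N`, with `A` as below. The form itself is at most `m A`, so values above `m N`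
  -- force `A > N`.
  set N := C ^ 2 * (1 + ε) ^ 2 / ε + C ^ 2 * (κ + ε) ^ 2 / (κ * μ) with hN
  set m := 2 * (1 + ε) / ε + 2 * (κ + ε) / (κ * μ) with hm
  refine ⟨ε, hεpos, hεsq, m * N, by positivity, fun x v F g hF hg hW => ?_⟩
  set b := F - μ * x with hb
  set r := κ * x - g with hr
  have hFeq : F = μ * x + b := by rw [hb]; ring
  have hgeq : g = κ * x - r := by rw [hr]; ring
  have h1 : v * -g + κ * x * (v - F) - ε * ((v - F) * v + x * -g) =
      -(κ * (μ - ε)) * x ^ 2 - ε * v ^ 2 + ε * μ * (x * v) +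
        (v * (r + ε * b) - x * (κ * b + ε * r)) := by
    rw [hFeq, hgeq]
    ring
  have h2 : ε * μ * (x * v) ≤ ε / 2 * v ^ 2 + ε * μ ^ 2 / 2 * x ^ 2 := by
    nlinarith [mul_nonneg hεpos.le (sq_nonneg (v - μ * x))]
  have h3 : v * (r + ε * b) ≤ ε / 4 * v ^ 2 + C ^ 2 * (1 + ε) ^ 2 / ε := by
    have h4 : |r + ε * b| ≤ C * (1 + ε) := by
      refine (abs_add_le _ _).trans ?_
      rw [abs_mul, abs_of_pos hεpos]
      nlinarith
    have h5 : (r + ε * b) ^ 2 ≤ C ^ 2 * (1 + ε) ^ 2 := by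
      rw [← mul_pow, ← sq_abs]
      gcongr
    have h6 : ε / 4 * v ^ 2 + C ^ 2 * (1 + ε) ^ 2 / ε - v * (r + ε * b) =
        (ε * v / 2 - (r + ε * b)) ^ 2 / ε + (C ^ 2 * (1 + ε) ^ 2 - (r + ε * b) ^ 2) / ε := by
      field_simp
      ring
    have : 0 ≤ (ε * v / 2 - (r + ε * b)) ^ 2 / ε + (C ^ 2 * (1 + ε) ^ 2 - (r + ε * b) ^ 2) / ε :=
      add_nonneg (by positivity) (div_nonneg (sub_nonneg.2 h5) hεpos.le)
    linarith
  have h4 : -(x * (κ * b + ε * r)) ≤ κ * μ / 4 * x ^ 2 + C ^ 2 * (κ + ε) ^ 2 / (κ * μ) := by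
    have hκμ : 0 < κ * μ := mul_pos hκ hμ
    have h4 : |κ * b + ε * r| ≤ C * (κ + ε) := by
      refine (abs_add_le _ _).trans ?_
      rw [abs_mul, abs_mul, abs_of_pos hεpos, abs_of_pos hκ]
      nlinarith
    have h5 : (κ * b + ε * r) ^ 2 ≤ C ^ 2 * (κ + ε) ^ 2 := by
      rw [← mul_pow, ← sq_abs]
      gcongr
    have h6 : κ * μ / 4 * x ^ 2 + C ^ 2 * (κ + ε) ^ 2 / (κ * μ) + x * (κ * b + ε * r) =
        (κ * μ * x / 2 + (κ * b + ε * r)) ^ 2 / (κ * μ) +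
          (C ^ 2 * (κ + ε) ^ 2 - (κ * b + ε * r) ^ 2) / (κ * μ) := by
      field_simp
      ring
    have : 0 ≤ (κ * μ * x / 2 + (κ * b + ε * r)) ^ 2 / (κ * μ) +
          (C ^ 2 * (κ + ε) ^ 2 - (κ * b + ε * r) ^ 2) / (κ * μ) :=
      add_nonneg (by positivity) (div_nonneg (sub_nonneg.2 h5) hκμ.le)
    linarith
  -- the quadratic form dominates
  have h5 : κ * (μ - ε) * x ^ 2 - ε * μ ^ 2 / 2 * x ^ 2 = κ * μ / 2 * x ^ 2 := by
    linear_combination (-(1 : ℝ) / 2) * x ^ 2 * hεeq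
  set A := κ * μ / 4 * x ^ 2 + ε / 4 * v ^ 2 with hA
  have h6 : v ^ 2 / 2 + κ * x ^ 2 / 2 - ε * (x * v) ≤ m * A := by
    have h7 : v ^ 2 / 2 + κ * x ^ 2 / 2 - ε * (x * v) ≤
        (1 + ε) / 2 * v ^ 2 + (κ + ε) / 2 * x ^ 2 := by
      nlinarith [mul_nonneg hεpos.le (sq_nonneg (x + v))]
    have h8 : (2 * (1 + ε) / ε) * (ε / 4 * v ^ 2) = (1 + ε) / 2 * v ^ 2 := by
      field_simp
      ring
    have h9 : (2 * (κ + ε) / (κ * μ)) * (κ * μ / 4 * x ^ 2) = (κ + ε) / 2 * x ^ 2 := by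
      field_simp
      ring
    have h10 : 0 ≤ (2 * (1 + ε) / ε) * (κ * μ / 4 * x ^ 2) := by positivity
    have h11 : 0 ≤ (2 * (κ + ε) / (κ * μ)) * (ε / 4 * v ^ 2) := by positivity
    have h12 : m * A = (2 * (1 + ε) / ε) * (κ * μ / 4 * x ^ 2) +
        (2 * (1 + ε) / ε) * (ε / 4 * v ^ 2) + ((2 * (κ + ε) / (κ * μ)) * (κ * μ / 4 * x ^ 2) +
        (2 * (κ + ε) / (κ * μ)) * (ε / 4 * v ^ 2)) := by
      rw [hm, hA]
      ring
    linarith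
  have h7 : N < A := lt_of_mul_lt_mul_left (hW.trans_le h6) (by positivity)
  rw [h1]
  linarith

variable {μ k α τ₀ : ℝ}

theorem hasDerivAt_dissipation {F g : ℝ → ℝ} (κ ε : ℝ) {γ : ℝ → ℝ × ℝ} {t : ℝ}
    (hγ : HasDerivAt γ (planeField F g (γ t)) t) :
    HasDerivAt (fun t => (γ t).2 ^ 2 / 2 + κ * (γ t).1 ^ 2 / 2 - ε * ((γ t).1 * (γ t).2))
      ((γ t).2 * -g (γ t).1 + κ * (γ t).1 * ((γ t).2 - F (γ t).1) -
        ε * (((γ t).2 - F (γ t).1) * (γ t).2 + (γ t).1 * -g (γ t).1)) t := by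
  have h1 := (hγ.hasDerivWithinAt (s := univ)).fst'.hasDerivAt univ_mem
  have h2 := (hγ.hasDerivWithinAt (s := univ)).snd'.hasDerivAt univ_mem
  refine ((((h2.fun_pow 2).div_const 2).fun_add (((h1.fun_pow 2).const_mul κ).div_const 2)).fun_sub
    ((h1.fun_mul h2).const_mul ε)).congr_deriv ?_
  simp only [planeField]
  push_cast
  ring

/-- Half-orbits of large amplitude shrink. -/
theorem exists_amplitude_bound (hμ : 0 < μ) (hα : 0 < α) (hk : 0 < k + α) {K : ℝ}
    {φ : ℝ → ℝ × ℝ → ℝ × ℝ}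
    (h : IsFlow (planeField (dampingPrimitive μ α τ₀) (restoringForce k α τ₀)) K φ) :
    ∃ B, ∀ T v p, LienardSystem.HalfOrbit φ T v p → B < v → p < v := by
  obtain ⟨ε, hε, -, R, hR, hneg⟩ := exists_dissipation
    (C := remainderBound μ k α τ₀) hμ hk
  -- On the axis the form reduces to half the squared height, so it compares `v` with `p` directly;
  -- `v > R + 1` gives `v² / 2 > R`.
  refine ⟨R + 1, fun T v p H hv => ?_⟩
  set u := fun t => (φ t (0, v)).2 ^ 2 / 2 + (k + α) * (φ t (0, v)).1 ^ 2 / 2 -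
    ε * ((φ t (0, v)).1 * (φ t (0, v)).2) with hu
  have hd := fun t => hasDerivAt_dissipation (k + α) ε (h.hasDerivAt (0, v) t)
  have hlt := fun t (ht : R < u t) => hneg (φ t (0, v)).1 (φ t (0, v)).2 _ _
    (abs_dampingPrimitive_sub_le (τ₀ := τ₀) hμ hα hk _)
    (abs_sub_restoringForce_le (τ₀ := τ₀) hμ hα hk _) ht
  have hu0 : u 0 = v ^ 2 / 2 := by simp [hu, h.zero]
  have huT : u T = p ^ 2 / 2 := by simp [hu, H.flow_T]
  have hR0 : R < u 0 := by
    rw [hu0]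
    nlinarith
  -- For strictness: just after time `0` the form is below `v² / 2` and still above `R`. Its value
  -- there is a barrier for all later times.
  have h1 := eventually_pos_of_hasDerivAt_pos (u := fun t => v ^ 2 / 2 - u t)
    ((hd 0).const_sub (v ^ 2 / 2)) (neg_pos.2 (hlt 0 hR0)) (by simp [hu0])
  have h2 : ∀ᶠ t in 𝓝[>] (0 : ℝ), R < u t :=
    ((hd 0).continuousAt.eventually (lt_mem_nhds hR0)).filter_mono nhdsWithin_le_nhds
  obtain ⟨t, ⟨ht1, ht2⟩, ht3⟩ := ((h1.and h2).and (Ioo_mem_nhdsGT H.T_pos)).exists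
  have h3 := le_barrier_of_hasDerivAt hd (B := u t) (t₀ := t) le_rfl
    (fun s _ hs => hlt s (by rw [hu]; simp only at hs ⊢; rw [hs]; exact ht2)) ht3.2.le
  have h4 : u T ≤ u t := h3
  rw [huT] at h4
  exact lt_of_pow_lt_pow_left₀ 2 H.v_pos.le (by linarith)

/-- All cycles are bounded, uniformly for bounded delays. -/
theorem exists_cycle_bound (hμ : 0 < μ) (hα : 0 < α) (hk : 0 < k + α) (L : ℝ) :
    ∃ R, ∀ τ₀, |τ₀| ≤ L → ∀ Γ, IsCycle (oscillatorField μ k α τ₀) Γ →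
      Γ ⊆ Metric.closedBall 0 R := by
  set C := remainderBound μ k α L with hC
  obtain ⟨ε, hε, hεκ, R, hR, hneg⟩ := exists_dissipation (C := C) hμ hk
  -- The form equals `(v - ε x)² / 2 + (k + α - ε²) x² / 2`. `X` bounds `x` where the form is at
  -- most `R`, and `Y` then bounds `y = v - F(x)`, using `|F(x)| ≤ μ |x| + C`.
  set X := √(2 * R / (k + α - ε ^ 2)) with hX
  set Y := √(2 * R) + ε * X + (μ * X + C) with hY
  refine ⟨max X Y, fun τ₀ hτ₀ Γ => ?_⟩
  have hle := remainderBound_le hμ hα hk hτ₀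
  rintro ⟨γ, T, hT, hγ, hper, -, rfl⟩
  set F := dampingPrimitive μ α τ₀ with hF
  set g := restoringForce k α τ₀ with hg
  set H := shear F (continuous_dampingPrimitive hα) with hH
  set β := fun t => H (γ t) with hβ
  have hβd : ∀ t, HasDerivAt β (planeField F g (β t)) t := fun t =>
    (hasDerivWithinAt_shear _ (hasDerivAt_dampingPrimitive hα)
      ((hγ t).hasDerivWithinAt (s := univ))).hasDerivAt univ_mem
  set u := fun t => (β t).2 ^ 2 / 2 + (k + α) * (β t).1 ^ 2 / 2 - ε * ((β t).1 * (β t).2) with hu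
  have hd := fun t => hasDerivAt_dissipation (k + α) ε (hβd t)
  have huc : Continuous u := continuous_iff_continuousAt.2 fun t => (hd t).continuousAt
  have huper : Function.Periodic u T := fun t => by simp only [hu, hβ, hper t]
  -- At its maximum over a period the form has zero derivative, so that maximum cannot exceed `R`.
  have huR : ∀ t, u t ≤ R := by
    obtain ⟨t₀, -, hmax⟩ := isCompact_Icc.exists_isMaxOn (nonempty_Icc.2 hT.le)
      huc.continuousOn (s := Icc 0 T)
    have hmax' : ∀ t, u t ≤ u t₀ := fun t => by
      obtain ⟨s, hs, hst⟩ := huper.exists_mem_Ico₀ hT t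
      rw [hst]
      exact hmax (Ico_subset_Icc_self hs)
    have hloc : IsLocalMax u t₀ := Eventually.of_forall hmax'
    have hzero := hloc.hasDerivAt_eq_zero (hd t₀)
    intro t
    refine (hmax' t).trans ?_
    by_contra! hlt
    exact (hneg (β t₀).1 (β t₀).2 _ _
      ((abs_dampingPrimitive_sub_le (τ₀ := τ₀) hμ hα hk _).trans hle)
      ((abs_sub_restoringForce_le (τ₀ := τ₀) hμ hα hk _).trans hle) hlt).ne hzero
  rintro _ ⟨t, rfl⟩
  have hut := huR t
  set x := (γ t).1 with hx
  set v := (γ t).2 + F x with hv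
  have hut' : v ^ 2 / 2 + (k + α) * x ^ 2 / 2 - ε * (x * v) ≤ R := hut
  have hκε : 0 < k + α - ε ^ 2 := sub_pos.2 hεκ
  have hxX : |x| ≤ X := by
    apply Real.abs_le_sqrt
    rw [le_div_iff₀ hκε]
    nlinarith [sq_nonneg (v - ε * x)]
  have hvx : |v - ε * x| ≤ √(2 * R) := by
    apply Real.abs_le_sqrt
    nlinarith [mul_nonneg hκε.le (sq_nonneg x)]
  have hFx := (abs_dampingPrimitive_sub_le (τ₀ := τ₀) hμ hα hk x).trans hle
  have hy : (γ t).2 = (v - ε * x) + ε * x - ((F x - μ * x) + μ * x) := by rw [hv]; ring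
  have hyY : |(γ t).2| ≤ Y := by
    rw [hy]
    have e1 := abs_sub (v - ε * x + ε * x) ((F x - μ * x) + μ * x)
    have e2 := abs_add_le (v - ε * x) (ε * x)
    have e3 := abs_add_le (F x - μ * x) (μ * x)
    rw [abs_mul, abs_of_pos hε] at e2
    rw [abs_mul, abs_of_pos hμ] at e3
    have e4 := mul_le_mul_of_nonneg_left hxX hε.le
    have e5 := mul_le_mul_of_nonneg_left hxX hμ.le
    linarith
  rw [mem_closedBall_zero_iff, Prod.norm_def]
  exact max_le_max hxX hyY

theorem exists_unique_limitCycle (hμ : 0 < μ) (hα : 0 < α) (hk : 0 < k + α)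
    (hτ : criticalDelay μ α < τ₀) :
    ∃ Γ : Set (ℝ × ℝ), IsLimitCycle (oscillatorField μ k α τ₀) Γ ∧
      IsAsymptoticallyStable (oscillatorField μ k α τ₀) Γ ∧
      ∀ Γ' : Set (ℝ × ℝ), IsCycle (oscillatorField μ k α τ₀) Γ' → Γ' = Γ := by
  obtain ⟨a, c, M, S⟩ := exists_lienardSystem hμ hα hk hτ
  obtain ⟨K, φ, h⟩ := exists_isFlow_oscillator hμ hα hk τ₀
  obtain ⟨B, hB⟩ := exists_amplitude_bound hμ hα hk h
  exact S.exists_limitCycle h hB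

end Dissipation

/-! ### Stability of the equilibrium -/

section Origin

/-- A quadratic Lyapunov function of a damped oscillator, stable under small perturbations. -/
theorem exists_quadratic_lyapunov {β κ : ℝ} (hβ : 0 < β) (hκ : 0 < κ) :
    ∃ e > 0, e ^ 2 < κ ∧ ∃ c > 0, ∃ δ > 0, ∀ x y f g : ℝ, |f - β| ≤ δ → |g - κ * x| ≤ δ * |x| →
      y * (-f * y - g) + κ * x * y + e * (y * y + x * (-f * y - g)) ≤ -c * (x ^ 2 + y ^ 2) := by
  have hden : 0 < 2 * κ + β ^ 2 := by positivity
  -- Chosen so that `β / 2 - e = e β² / (2 κ)`, which lets the cross term be absorbed in the square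
  -- of `κ x + β y`.
  set e := κ * β / (2 * κ + β ^ 2) with he
  have hepos : 0 < e := by positivity
  have heeq : e * (2 * κ + β ^ 2) = κ * β := div_mul_cancel₀ _ hden.ne'
  have hesq : e ^ 2 < κ := by
    have h1 : e * β < κ := by
      nlinarith [mul_pos hepos hκ, mul_pos hepos hβ]
    have h2 : e * 2 ≤ β := by
      have : 0 ≤ e * β ^ 2 := by positivity
      nlinarith
    nlinarith
  set c := min (β / 2) (e * κ / 2) with hc
  have hcpos : 0 < c := lt_min (by positivity) (by positivity)
  -- The perturbation terms add up to at most `2 (1 + e) δ (x² + y²)`; this `δ` lets them consume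
  -- half of the decay rate `c`.
  refine ⟨e, hepos, hesq, c / 2, by positivity, c / 2 / (2 * (1 + e)), by positivity,
    fun x y f g hf hg => ?_⟩
  set δ := c / 2 / (2 * (1 + e)) with hδ
  have hδpos : 0 < δ := by positivity
  have hδeq : δ * (2 * (1 + e)) = c / 2 := div_mul_cancel₀ _ (by positivity)
  set b := f - β with hb
  set r := g - κ * x with hr
  have hfeq : f = β + b := by rw [hb]; ring
  have hgeq : g = κ * x + r := by rw [hr]; ring
  have h1 : y * (-f * y - g) + κ * x * y + e * (y * y + x * (-f * y - g)) =
      -((β - e) * y ^ 2 + e * κ * x ^ 2 + e * β * (x * y)) -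
        (b * y ^ 2 + r * y + e * (b * (x * y)) + e * (r * x)) := by
    rw [hfeq, hgeq]
    ring
  have h2 : c * (x ^ 2 + y ^ 2) ≤ (β - e) * y ^ 2 + e * κ * x ^ 2 + e * β * (x * y) := by
    have h3 : 0 ≤ e / (2 * κ) * (κ * x + β * y) ^ 2 := by positivity
    have h4 : e / (2 * κ) * (κ * x + β * y) ^ 2 =
        e * κ / 2 * x ^ 2 + e * β * (x * y) + (β / 2 - e) * y ^ 2 := by
      have : e * β ^ 2 / (2 * κ) = β / 2 - e := by
        rw [div_eq_iff (by positivity)]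
        linear_combination heeq
      rw [← this]
      field_simp
      ring
    have h5 : c * x ^ 2 ≤ e * κ / 2 * x ^ 2 :=
      mul_le_mul_of_nonneg_right (min_le_right _ _) (sq_nonneg _)
    have h6 : c * y ^ 2 ≤ β / 2 * y ^ 2 :=
      mul_le_mul_of_nonneg_right (min_le_left _ _) (sq_nonneg _)
    linarith
  have hxy : |x| * |y| ≤ x ^ 2 + y ^ 2 := by
    nlinarith [sq_nonneg (|x| - |y|), sq_abs x, sq_abs y, sq_nonneg x, sq_nonneg y]
  have h3 : -(b * y ^ 2) ≤ δ * y ^ 2 := by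
    rw [← neg_mul]
    exact mul_le_mul_of_nonneg_right ((neg_le_abs b).trans hf) (sq_nonneg _)
  have h4 : -(r * y) ≤ δ * (x ^ 2 + y ^ 2) := by
    refine (neg_le_abs _).trans ?_
    rw [abs_mul]
    calc |r| * |y| ≤ δ * |x| * |y| := by gcongr
      _ = δ * (|x| * |y|) := by ring
      _ ≤ _ := by gcongr
  have h5 : -(b * (x * y)) ≤ δ * (x ^ 2 + y ^ 2) := by
    refine (neg_le_abs _).trans ?_
    rw [abs_mul, abs_mul]
    gcongr
  have h6 : -(r * x) ≤ δ * x ^ 2 := by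
    refine (neg_le_abs _).trans ?_
    rw [abs_mul, ← sq_abs x]
    calc |r| * |x| ≤ δ * |x| * |x| := by gcongr
      _ = δ * |x| ^ 2 := by ring
  have h7 := mul_le_mul_of_nonneg_left h5 hepos.le
  have h8 := mul_le_mul_of_nonneg_left h6 hepos.le
  have h9 : 0 ≤ δ * x ^ 2 := by positivity
  have h10 : 0 ≤ e * (δ * y ^ 2) := by positivity
  have h11 : c / 2 * (x ^ 2 + y ^ 2) = δ * (2 * (1 + e)) * (x ^ 2 + y ^ 2) := by rw [hδeq]
  rw [h1]
  linarith

theorem hasDerivAt_quadratic {f g : ℝ → ℝ} (κ e : ℝ) {γ : ℝ → ℝ × ℝ} {t : ℝ}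
    (hγ : HasDerivAt γ (lienardField f g (γ t)) t) :
    HasDerivAt (fun t => (γ t).2 ^ 2 / 2 + κ * (γ t).1 ^ 2 / 2 + e * ((γ t).1 * (γ t).2))
      ((γ t).2 * (-f (γ t).1 * (γ t).2 - g (γ t).1) + κ * (γ t).1 * (γ t).2 +
        e * ((γ t).2 * (γ t).2 + (γ t).1 * (-f (γ t).1 * (γ t).2 - g (γ t).1))) t := by
  have h1 := (hγ.hasDerivWithinAt (s := univ)).fst'.hasDerivAt univ_mem
  have h2 := (hγ.hasDerivWithinAt (s := univ)).snd'.hasDerivAt univ_mem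
  refine ((((h2.fun_pow 2).div_const 2).fun_add (((h1.fun_pow 2).const_mul κ).div_const 2)).fun_add
    ((h1.fun_mul h2).const_mul e)).congr_deriv ?_
  simp only [lienardField]
  push_cast
  ring

/-- A positive definite quadratic form is comparable with the square of the norm. -/
theorem exists_quadratic_bounds {κ e : ℝ} (he : e ^ 2 < κ) :
    ∃ m > 0, ∃ M > 0, ∀ x y : ℝ, m * (x ^ 2 + y ^ 2) ≤ y ^ 2 / 2 + κ * x ^ 2 / 2 + e * (x * y) ∧
      y ^ 2 / 2 + κ * x ^ 2 / 2 + e * (x * y) ≤ M * (x ^ 2 + y ^ 2) := by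
  have hκ : 0 < κ := (sq_nonneg e).trans_lt he
  have hd : 0 < κ - e ^ 2 := sub_pos.2 he
  refine ⟨(κ - e ^ 2) / (2 * (1 + κ)), by positivity, (1 + κ) / 2 + |e|, by positivity,
    fun x y => ⟨?_, ?_⟩⟩
  · rw [div_mul_eq_mul_div, div_le_iff₀ (by positivity)]
    nlinarith [sq_nonneg (e * y + κ * x), sq_nonneg (y + e * x)]
  · have h1 : e * (x * y) ≤ |e| * (x ^ 2 + y ^ 2) := by
      refine (le_abs_self _).trans ?_
      rw [abs_mul, abs_mul]
      gcongr
      nlinarith [sq_nonneg (|x| - |y|), sq_abs x, sq_abs y, sq_nonneg x, sq_nonneg y]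
    have h2 : 0 ≤ κ * y ^ 2 := by positivity
    nlinarith [sq_nonneg x]

theorem sq_norm_le_sq_add_sq (p : ℝ × ℝ) : ‖p‖ ^ 2 ≤ p.1 ^ 2 + p.2 ^ 2 := by
  rw [Prod.norm_def, Real.norm_eq_abs, Real.norm_eq_abs]
  rcases max_cases |p.1| |p.2| with ⟨h, -⟩ | ⟨h, -⟩ <;> rw [h, sq_abs]
  · linarith [sq_nonneg p.2]
  · linarith [sq_nonneg p.1]

theorem sq_add_sq_le (p : ℝ × ℝ) : p.1 ^ 2 + p.2 ^ 2 ≤ 2 * ‖p‖ ^ 2 := by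
  have h1 := norm_fst_le p
  have h2 := norm_snd_le p
  rw [Real.norm_eq_abs] at h1 h2
  have h3 := pow_le_pow_left₀ (abs_nonneg _) h1 2
  have h4 := pow_le_pow_left₀ (abs_nonneg _) h2 2
  rw [sq_abs] at h3 h4
  linarith

theorem exists_radius_linearization {f g : ℝ → ℝ} {κ δ : ℝ} (hf : ContinuousAt f 0)
    (hg : HasDerivAt g κ 0) (hg0 : g 0 = 0) (hδ : 0 < δ) :
    ∃ r > 0, ∀ x, |x| < r → |f x - f 0| ≤ δ ∧ |g x - κ * x| ≤ δ * |x| := by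
  have h1 : ∀ᶠ x in 𝓝 (0 : ℝ), |f x - f 0| ≤ δ := by
    filter_upwards [Metric.tendsto_nhds.1 hf δ hδ] with x hx
    exact hx.le
  have h2 : ∀ᶠ x in 𝓝 (0 : ℝ), |g x - κ * x| ≤ δ * |x| := by
    have := (hasDerivAt_iff_isLittleO.1 hg).def hδ
    filter_upwards [this] with x hx
    simpa [hg0, mul_comm] using hx
  obtain ⟨r, hr, h⟩ := Metric.eventually_nhds_iff.1 (h1.and h2)
  exact ⟨r, hr, fun x hx => h (by simpa using hx)⟩

variable {f g : ℝ → ℝ} {ψ : ℝ → ℝ × ℝ → ℝ × ℝ} {κ : ℝ}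

/-- With positive damping, the equilibrium at the origin is asymptotically stable. -/
theorem IsPhaseFlow.isAsymptoticallyStable_zero (hψ : IsPhaseFlow f g ψ) (hf : ContinuousAt f 0)
    (hf0 : 0 < f 0) (hg : HasDerivAt g κ 0) (hg0 : g 0 = 0) (hκ : 0 < κ) :
    IsAsymptoticallyStable (lienardField f g) {0} := by
  obtain ⟨e, he, heκ, c, hc, δ, hδ, hneg⟩ := exists_quadratic_lyapunov hf0 hκ
  obtain ⟨m, hm, M, hM, hW⟩ := exists_quadratic_bounds heκ
  obtain ⟨r₀, hr₀, hlin⟩ := exists_radius_linearization hf hg hg0 hδ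
  set u := fun p t => (ψ t p).2 ^ 2 / 2 + κ * (ψ t p).1 ^ 2 / 2 +
    e * ((ψ t p).1 * (ψ t p).2) with hu
  have hd := fun p t => hasDerivAt_quadratic κ e (hψ.isIntegralCurve p t)
  have hd' : ∀ p t, ‖ψ t p‖ < r₀ → _ ≤ _ := fun p t ht => by
    have := hlin (ψ t p).1 ((norm_fst_le (ψ t p)).trans_lt ht)
    exact hneg (ψ t p).1 (ψ t p).2 _ _ this.1 this.2
  -- trapping
  have htrap : ∀ r, 0 < r → r < r₀ → ∃ ρ > 0, ∀ p, ‖p‖ < ρ → ∀ t, 0 ≤ t → ‖ψ t p‖ ≤ r := by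
    intro r hr hr'
    have hnorm : ∀ p t, u p t ≤ m * r ^ 2 → ‖ψ t p‖ ≤ r := fun p t ht => by
      have h1 := (hW (ψ t p).1 (ψ t p).2).1.trans ht
      have h2 := (sq_norm_le_sq_add_sq (ψ t p)).trans (le_of_mul_le_mul_left h1 hm)
      exact (pow_le_pow_iff_left₀ (norm_nonneg _) hr.le two_ne_zero).1 h2
    -- With this radius the Lyapunov function starts at or below `m r²`, and this level set lies in
    -- the ball of radius `r`.
    refine ⟨√(m / (2 * M)) * r, by positivity, fun p hp t ht => hnorm p t ?_⟩
    refine le_barrier_of_hasDerivAt (hd p) (t₀ := 0) ?_ (fun s hs heq => ?_) ht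
    · refine (hW _ _).2.trans ?_
      rw [hψ.zero]
      have h1 := pow_le_pow_left₀ (norm_nonneg p) hp.le 2
      rw [mul_pow, Real.sq_sqrt (by positivity)] at h1
      calc M * (p.1 ^ 2 + p.2 ^ 2) ≤ M * (2 * (m / (2 * M) * r ^ 2)) := by
            have := sq_add_sq_le p
            gcongr
            linarith
        _ = m * r ^ 2 := by field_simp
    · refine (hd' p s ((hnorm p s heq.le).trans_lt hr')).trans_lt ?_
      have h1 := (hW (ψ s p).1 (ψ s p).2).2
      have h2 : 0 < m * r ^ 2 := by positivity
      have h3 : 0 < (ψ s p).1 ^ 2 + (ψ s p).2 ^ 2 :=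
        pos_of_mul_pos_right (h2.trans_le (heq.symm.le.trans h1)) hM.le
      rw [neg_mul]
      exact neg_neg_of_pos (mul_pos hc h3)
  refine ⟨fun ε hε => ?_, ?_⟩
  · obtain ⟨ρ, hρ, h⟩ := htrap (min ε r₀ / 2) (by positivity)
      ((half_lt_self (by positivity)).trans_le (min_le_right _ _))
    refine ⟨ρ, hρ, fun p hp => ⟨⟨_, hψ.isForwardTrajectory p⟩, fun γ hγ t ht => ?_⟩⟩
    rw [Metric.thickening_singleton, mem_ball_zero_iff] at hp ⊢
    rw [hψ.eq_of_forward γ hγ.2 t ht, hγ.1]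
    exact (h p hp t ht).trans_lt ((half_lt_self (by positivity)).trans_le (min_le_left _ _))
  · obtain ⟨ρ, hρ, h⟩ := htrap (r₀ / 2) (by positivity) (half_lt_self hr₀)
    refine ⟨ρ, hρ, fun p hp γ hγ => ?_⟩
    rw [Metric.thickening_singleton, mem_ball_zero_iff] at hp
    -- The derivative is at most `-c (x² + y²) ≤ -(c / M) u`, so `u` times `exp (c t / M)` does not
    -- increase.
    have hu0 : ∀ t, 0 ≤ t → u p t ≤ u p 0 * Real.exp (-(c / M * t)) := by
      have hd2 : ∀ t, HasDerivAt (fun t => u p t * Real.exp (c / M * t)) _ t := fun t =>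
        (hd p t).fun_mul ((((hasDerivAt_id' t).const_mul (c / M))).exp)
      intro t ht
      have := le_sub_mul_of_hasDerivAt_le (m := 0) hd2 (fun s hs => by
        have h1 := hd' p s ((h p hp s hs).trans_lt (half_lt_self hr₀))
        have h2 := (hW (ψ s p).1 (ψ s p).2).2
        have h3 := mul_le_mul_of_nonneg_left h2 (by positivity : 0 ≤ c / M)
        rw [← mul_assoc (c / M) M, div_mul_cancel₀ _ hM.ne'] at h3
        have h4 := mul_nonpos_of_nonpos_of_nonneg ((add_le_add h1 h3).trans
          (by rw [neg_mul, neg_add_cancel])) (Real.exp_pos (c / M * s)).le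
        linarith) ht
      simp only [mul_zero, zero_mul, sub_zero, Real.exp_zero, mul_one] at this
      rw [Real.exp_neg, ← div_eq_mul_inv, le_div_iff₀ (Real.exp_pos _)]
      exact this
    have hlim : Tendsto (fun t => u p 0 * Real.exp (-(c / M * t)) / m) atTop (𝓝 0) := by
      have h1 : Tendsto (fun t => c / M * t) atTop atTop :=
        tendsto_id.const_mul_atTop (by positivity)
      have h2 := ((Real.tendsto_exp_neg_atTop_nhds_zero.comp h1).const_mul (u p 0)).div_const m
      simpa using h2
    have hlim2 := (Real.continuous_sqrt.tendsto 0).comp hlim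
    rw [Real.sqrt_zero] at hlim2
    refine squeeze_zero' (Eventually.of_forall fun t => Metric.infDist_nonneg) ?_ hlim2
    filter_upwards [eventually_ge_atTop 0] with t ht
    rw [Metric.infDist_singleton, dist_zero_right, hψ.eq_of_forward γ hγ.2 t ht, hγ.1]
    apply Real.le_sqrt_of_sq_le
    refine (sq_norm_le_sq_add_sq _).trans ?_
    rw [le_div_iff₀ hm, mul_comm]
    exact (hW _ _).1.trans (hu0 t ht)

/-- With negative damping, the equilibrium at the origin is unstable. -/
theorem IsPhaseFlow.not_isLyapunovStable_zero (hψ : IsPhaseFlow f g ψ) (hf : ContinuousAt f 0)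
    (hf0 : f 0 < 0) (hg : HasDerivAt g κ 0) (hg0 : g 0 = 0) (hκ : 0 < κ) :
    ¬ IsLyapunovStable (lienardField f g) {0} := by
  obtain ⟨e, he, heκ, c, hc, δ, hδ, hneg⟩ := exists_quadratic_lyapunov (neg_pos.2 hf0) hκ
  obtain ⟨m, hm, M, hM, hW⟩ := exists_quadratic_bounds (e := -e) (by rwa [neg_sq])
  obtain ⟨r₀, hr₀, hlin⟩ := exists_radius_linearization hf hg hg0 hδ
  intro hst
  obtain ⟨ρ, hρ, hst⟩ := hst r₀ hr₀
  set p : ℝ × ℝ := (ρ / 2, 0) with hp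
  have hpρ : p ∈ Metric.thickening ρ {(0 : ℝ × ℝ)} := by
    rw [Metric.thickening_singleton, mem_ball_zero_iff, hp, Prod.norm_def]
    simp [abs_of_pos hρ, hρ]
  have hball : ∀ t, 0 ≤ t → ‖ψ t p‖ < r₀ := fun t ht => by
    have := (hst p hpρ).2 _ (hψ.isForwardTrajectory p) t ht
    rwa [Metric.thickening_singleton, mem_ball_zero_iff] at this
  set u := fun t => (ψ t p).2 ^ 2 / 2 + κ * (ψ t p).1 ^ 2 / 2 +
    -e * ((ψ t p).1 * (ψ t p).2) with hu
  have hd := fun t => (hasDerivAt_quadratic κ (-e) (hψ.isIntegralCurve p t)).fun_neg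
  have hd' : ∀ t, 0 ≤ t → -((ψ t p).2 * (-f (ψ t p).1 * (ψ t p).2 - g (ψ t p).1) +
      κ * (ψ t p).1 * (ψ t p).2 + -e * ((ψ t p).2 * (ψ t p).2 +
        (ψ t p).1 * (-f (ψ t p).1 * (ψ t p).2 - g (ψ t p).1))) ≤ -(c / M * u t) := fun t ht => by
    have h1 := hlin (ψ t p).1 ((norm_fst_le (ψ t p)).trans_lt (hball t ht))
    -- Reversing time and replacing `x` by `-x` turns the system into one with damping `-f`,
    -- positive at the origin; the Lyapunov estimate is applied to that one, and `u` grows in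
    -- forward time.
    have h2 := hneg (-(ψ t p).1) (ψ t p).2 (-f (ψ t p).1) (-g (ψ t p).1)
      (by rw [← neg_sub', abs_neg]; exact h1.1)
      (by
        have : -g (ψ t p).1 - κ * -(ψ t p).1 = -(g (ψ t p).1 - κ * (ψ t p).1) := by ring
        rw [this, abs_neg, abs_neg]
        exact h1.2)
    have h3 := mul_le_mul_of_nonneg_left (hW (ψ t p).1 (ψ t p).2).2 (by positivity : 0 ≤ c / M)
    rw [← mul_assoc (c / M) M, div_mul_cancel₀ _ hM.ne'] at h3
    have h4 : c / M * u t ≤ c * ((-(ψ t p).1) ^ 2 + (ψ t p).2 ^ 2) := by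
      rw [neg_sq]
      exact h3
    refine le_trans (le_of_eq ?_) (h2.trans (by linarith))
    ring
  have hu0 : 0 < u 0 := by
    simp only [hu, hψ.zero, hp]
    have : 0 < κ * (ρ / 2) ^ 2 / 2 := by positivity
    simpa using this
  have hpos : ∀ t, 0 ≤ t → 0 ≤ u t := fun t _ =>
    le_trans (by positivity) (hW (ψ t p).1 (ψ t p).2).1
  have hge : ∀ t, 0 ≤ t → u 0 ≤ u t := fun t ht => by
    have := le_sub_mul_of_hasDerivAt_le (m := 0) hd (fun s hs => (hd' s hs).trans (by
      rw [neg_zero]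
      exact neg_nonpos.2 (mul_nonneg (by positivity) (hpos s hs)))) ht
    rw [zero_mul, sub_zero] at this
    exact neg_le_neg_iff.1 this
  -- `u' ≥ (c / M) u ≥ (c / M) u 0`: linear growth already contradicts boundedness.
  have hlin' : ∀ t, 0 ≤ t → c / M * u 0 * t ≤ u t := fun t ht => by
    have := le_sub_mul_of_hasDerivAt_le (m := c / M * u 0) hd (fun s hs => (hd' s hs).trans
      (neg_le_neg (mul_le_mul_of_nonneg_left (hge s hs) (by positivity)))) ht
    have h2 : -u t ≤ -u 0 - c / M * u 0 * (t - 0) := this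
    linarith
  have hbdd : ∀ t, 0 ≤ t → u t ≤ M * (2 * r₀ ^ 2) := fun t ht => by
    refine (hW (ψ t p).1 (ψ t p).2).2.trans ?_
    gcongr
    refine (sq_add_sq_le _).trans ?_
    have := (hball t ht).le
    gcongr
  have hpos' : 0 < c / M * u 0 := by positivity
  have h1 : 0 ≤ (M * (2 * r₀ ^ 2) + 1) / (c / M * u 0) := by positivity
  have h2 := (hlin' _ h1).trans (hbdd _ h1)
  rw [mul_div_cancel₀ _ hpos'.ne'] at h2
  linarith

end Origin

/-! ### Energy in the phase plane -/

section Energy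

variable {f g : ℝ → ℝ} {γ : ℝ → ℝ × ℝ} {t : ℝ}

theorem hasDerivAt_integral_of_continuous (hg : Continuous g) (x : ℝ) :
    HasDerivAt (fun x => ∫ s in (0 : ℝ)..x, g s) (g x) x :=
  intervalIntegral.integral_hasDerivAt_right (hg.intervalIntegrable _ _)
    hg.aestronglyMeasurable.stronglyMeasurableAtFilter hg.continuousAt

/-- The potential is built on `h`, not on the restoring force `g`, so that the energy of the
critical system can be followed along solutions at nearby delays. -/
theorem hasDerivAt_energy {h : ℝ → ℝ} (hh : Continuous h)
    (hγ : HasDerivAt γ (lienardField f g (γ t)) t) :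
    HasDerivAt (fun t => (γ t).2 ^ 2 / 2 + ∫ s in (0 : ℝ)..(γ t).1, h s)
      ((γ t).2 * (-f (γ t).1 * (γ t).2 - g (γ t).1) + h (γ t).1 * (γ t).2) t := by
  have h1 := (hγ.hasDerivWithinAt (s := univ)).fst'.hasDerivAt univ_mem
  have h2 := (hγ.hasDerivWithinAt (s := univ)).snd'.hasDerivAt univ_mem
  refine (((h2.fun_pow 2).div_const 2).fun_add
    ((hasDerivAt_integral_of_continuous hh (γ t).1).comp t h1)).congr_deriv ?_
  simp only [lienardField]
  push_cast
  ring

theorem integral_pos_of_mul_pos (hg : Continuous g) (hpos : ∀ x, x ≠ 0 → 0 < x * g x) {x : ℝ}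
    (hx : x ≠ 0) : 0 < ∫ s in (0 : ℝ)..x, g s := by
  rcases hx.lt_or_gt with hx | hx
  · rw [intervalIntegral.integral_symm, ← intervalIntegral.integral_neg]
    refine intervalIntegral.intervalIntegral_pos_of_pos_on (hg.neg.intervalIntegrable _ _)
      (fun s hs => ?_) hx
    exact neg_pos.2 (neg_of_mul_pos_right (hpos s hs.2.ne) hs.2.le)
  · exact intervalIntegral.intervalIntegral_pos_of_pos_on (hg.intervalIntegrable _ _)
      (fun s hs => pos_of_mul_pos_right (hpos s hs.1.ne') hs.1.le) hx

/-- A system with positive damping away from `x = 0` has no cycle. -/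
theorem not_isCycle_of_damping_pos (hg : Continuous g) (hf : ∀ x, x ≠ 0 → 0 < f x)
    (hf0 : 0 ≤ f 0) (Γ : Set (ℝ × ℝ)) : ¬ IsCycle (lienardField f g) Γ := by
  rintro ⟨γ, T, hT, hγ, hper, ⟨t₁, ht₁⟩, -⟩
  have hfnn : ∀ x, 0 ≤ f x := fun x => by
    rcases eq_or_ne x 0 with rfl | hx
    · exact hf0
    · exact (hf x hx).le
  have hd : ∀ t, HasDerivAt (fun t => (γ t).2 ^ 2 / 2 + ∫ s in (0 : ℝ)..(γ t).1, g s)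
      (-(f (γ t).1 * (γ t).2 ^ 2)) t := fun t =>
    (hasDerivAt_energy hg (hγ t)).congr_deriv (by ring)
  have hper' : Function.Periodic (fun t => (γ t).2 ^ 2 / 2 + ∫ s in (0 : ℝ)..(γ t).1, g s) T :=
    fun t => by simp only [hper t]
  have hanti := antitone_of_hasDerivAt_nonpos hd fun t =>
    neg_nonpos.2 (mul_nonneg (hfnn _) (sq_nonneg _))
  -- A nonincreasing periodic function is constant.
  have hconst : ∀ s t, s ≤ t → (γ s).2 ^ 2 / 2 + ∫ r in (0 : ℝ)..(γ s).1, g r =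
      (γ t).2 ^ 2 / 2 + ∫ r in (0 : ℝ)..(γ t).1, g r := by
    intro s t hst
    refine le_antisymm ?_ (hanti hst)
    obtain ⟨n, hn⟩ := exists_nat_gt ((t - s) / T)
    rw [div_lt_iff₀ hT] at hn
    have h1 := hper'.nat_mul n s
    rw [← h1]
    exact hanti (by linarith)
  have hzero : ∀ t, f (γ t).1 * (γ t).2 ^ 2 = 0 := fun t => by
    have h1 : HasDerivAt (fun t => (γ t).2 ^ 2 / 2 + ∫ s in (0 : ℝ)..(γ t).1, g s) 0 t := by
      refine (hasDerivAt_const t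
        ((γ t).2 ^ 2 / 2 + ∫ s in (0 : ℝ)..(γ t).1, g s)).congr_of_eventuallyEq (Eventually.of_forall fun s => ?_)
      rcases le_total s t with hst | hst
      · exact hconst s t hst
      · exact (hconst t s hst).symm
    exact neg_eq_zero.1 ((hd t).unique h1)
  have hx := fun t => (((hγ t).hasDerivWithinAt (s := univ)).fst').hasDerivAt univ_mem
  have hy := fun t => (((hγ t).hasDerivWithinAt (s := univ)).snd').hasDerivAt univ_mem
  -- Where `y ≠ 0`, vanishing dissipation forces `x = 0` on a whole time interval, hence `y = x' =
  -- 0` there.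
  have hy0 : ∀ t, (γ t).2 = 0 := by
    intro t
    by_contra hne
    have h1 : (fun s => (γ s).1) =ᶠ[𝓝 t] fun _ => 0 := by
      filter_upwards [(hy t).continuousAt.eventually_ne hne] with s hs
      by_contra hxs
      exact (mul_pos (hf _ hxs) (pow_pos (abs_pos.2 hs) 2)).ne' (by rw [sq_abs]; exact hzero s)
    exact hne ((hx t).unique ((hasDerivAt_const t (0 : ℝ)).congr_of_eventuallyEq h1))
  have hxc : (γ t₁).1 = (γ 0).1 :=
    is_const_of_deriv_eq_zero (fun t => (hx t).differentiableAt)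
      (fun t => (hx t).deriv.trans (hy0 t)) _ _
  exact ht₁ (Prod.ext hxc ((hy0 t₁).trans (hy0 0).symm))

end Energy

/-! ### Cycles of small amplitude -/

section Shrinking

/-- Where `B < 0` there is nothing to prove. On the compact part where `B ≥ 0`, `A` is bounded away
from `0` and `B` is bounded. A correction with negative derivative on the degenerate set thus makes
a semidefinite derivative definite. -/
theorem IsCompact.exists_add_mul_neg {X : Type*} [TopologicalSpace X] {s : Set X}
    (hs : IsCompact s) {A B : X → ℝ} (hA : Continuous A) (hB : Continuous B)
    (hle : ∀ p ∈ s, A p ≤ 0) (hneg : ∀ p ∈ s, A p = 0 → B p < 0) :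
    ∃ η₀ > 0, ∀ η, 0 < η → η ≤ η₀ → ∀ p ∈ s, A p + η * B p < 0 := by
  have hc : IsCompact (s ∩ {p | 0 ≤ B p}) :=
    hs.inter_right (isClosed_le continuous_const hB)
  have hneg' : ∀ p ∈ s, 0 ≤ B p → A p < 0 := fun p hp h0 =>
    lt_of_le_of_ne (hle p hp) fun h => (hneg p hp h).not_ge h0
  rcases (s ∩ {p | 0 ≤ B p}).eq_empty_or_nonempty with he | hne
  · refine ⟨1, one_pos, fun η hη _ p hp => ?_⟩
    have : B p < 0 := by
      by_contra! h
      exact (he ▸ (⟨hp, h⟩ : p ∈ s ∩ {p | 0 ≤ B p}) : p ∈ (∅ : Set X))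
    exact add_neg_of_nonpos_of_neg (hle p hp) (mul_neg_of_pos_of_neg hη this)
  · obtain ⟨q, hq, hqmax⟩ := hc.exists_isMaxOn hne hA.continuousOn
    obtain ⟨r, hr, hrmax⟩ := hc.exists_isMaxOn hne hB.continuousOn
    have hAq : A q < 0 := hneg' q hq.1 hq.2
    have hBr : 0 ≤ B r := hr.2
    refine ⟨-A q / (B r + 1), div_pos (neg_pos.2 hAq) (by linarith), fun η hη hle' p hp => ?_⟩
    rcases lt_or_ge (B p) 0 with h | h
    · exact add_neg_of_nonpos_of_neg (hle p hp) (mul_neg_of_pos_of_neg hη h)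
    · have h1 : A p ≤ A q := hqmax ⟨hp, h⟩
      have h2 : B p ≤ B r := hrmax ⟨hp, h⟩
      rw [le_div_iff₀ (by linarith)] at hle'
      have h3 := mul_le_mul_of_nonneg_left h2 hη.le
      linarith

/-- The quartic `x³ y - x y³` is chosen for its derivative on the two lines where the energy
dissipation `f(x) y²` can vanish: `-y⁴` on `x = 0` and `-x³ g(x)` on `y = 0`. -/
theorem hasDerivAt_quartic {f g : ℝ → ℝ} {γ : ℝ → ℝ × ℝ} {t : ℝ}
    (hγ : HasDerivAt γ (lienardField f g (γ t)) t) :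
    HasDerivAt (fun t => (γ t).1 ^ 3 * (γ t).2 - (γ t).1 * (γ t).2 ^ 3)
      ((3 * (γ t).1 ^ 2 * (γ t).2 - (γ t).2 ^ 3) * (γ t).2 +
        ((γ t).1 ^ 3 - 3 * (γ t).1 * (γ t).2 ^ 2) * (-f (γ t).1 * (γ t).2 - g (γ t).1)) t := by
  have h1 := (hγ.hasDerivWithinAt (s := univ)).fst'.hasDerivAt univ_mem
  have h2 := (hγ.hasDerivWithinAt (s := univ)).snd'.hasDerivAt univ_mem
  refine (((h1.fun_pow 3).fun_mul h2).fun_sub (h1.fun_mul (h2.fun_pow 3))).congr_deriv ?_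
  simp only [lienardField]
  push_cast
  ring

/-- If the damping is positive away from `x = 0` at a parameter `τ₁`, then the cycles in a given
ball are arbitrarily small at nearby parameters. -/
theorem eventually_isCycle_subset_ball {f g : ℝ → ℝ → ℝ} {τ₁ : ℝ}
    (hf : Continuous fun p : ℝ × ℝ => f p.1 p.2) (hg : Continuous fun p : ℝ × ℝ => g p.1 p.2)
    (hfpos : ∀ x, x ≠ 0 → 0 < f τ₁ x) (hf0 : 0 ≤ f τ₁ 0) (hgpos : ∀ x, x ≠ 0 → 0 < x * g τ₁ x)
    {R ε : ℝ} (hε : 0 < ε) :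
    ∀ᶠ τ in 𝓝 τ₁, ∀ Γ, IsCycle (lienardField (f τ) (g τ)) Γ → Γ ⊆ Metric.closedBall 0 R →
      Γ ⊆ Metric.ball 0 ε := by
  have hgc : Continuous (g τ₁) := hg.comp (f := fun x => (τ₁, x)) (by fun_prop)
  set H : ℝ × ℝ → ℝ := fun p => p.2 ^ 2 / 2 + ∫ s in (0 : ℝ)..p.1, g τ₁ s with hH
  set Q : ℝ × ℝ → ℝ := fun p => p.1 ^ 3 * p.2 - p.1 * p.2 ^ 3 with hQ
  set A : ℝ → ℝ × ℝ → ℝ := fun τ p => p.2 * (-f τ p.1 * p.2 - g τ p.1) + g τ₁ p.1 * p.2 with hA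
  set B : ℝ → ℝ × ℝ → ℝ := fun τ p => (3 * p.1 ^ 2 * p.2 - p.2 ^ 3) * p.2 +
    (p.1 ^ 3 - 3 * p.1 * p.2 ^ 2) * (-f τ p.1 * p.2 - g τ p.1) with hB
  have hf' : Continuous fun q : ℝ × ℝ × ℝ => f q.1 q.2.1 :=
    hf.comp (f := fun q : ℝ × ℝ × ℝ => (q.1, q.2.1)) (by fun_prop)
  have hg' : Continuous fun q : ℝ × ℝ × ℝ => g q.1 q.2.1 :=
    hg.comp (f := fun q : ℝ × ℝ × ℝ => (q.1, q.2.1)) (by fun_prop)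
  have hgc' : Continuous fun q : ℝ × ℝ × ℝ => g τ₁ q.2.1 := hgc.comp (by fun_prop)
  have hAc : Continuous fun q : ℝ × ℝ × ℝ => A q.1 q.2 := by
    simp only [hA]
    fun_prop
  have hBc : Continuous fun q : ℝ × ℝ × ℝ => B q.1 q.2 := by
    simp only [hB]
    fun_prop
  have hG : Continuous fun x => ∫ s in (0 : ℝ)..x, g τ₁ s :=
    continuous_iff_continuousAt.2 fun x => (hasDerivAt_integral_of_continuous hgc x).continuousAt
  have hHc : Continuous H := by
    have : Continuous fun p : ℝ × ℝ => ∫ s in (0 : ℝ)..p.1, g τ₁ s := hG.comp continuous_fst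
    simp only [hH]
    fun_prop
  have hQc : Continuous Q := by
    simp only [hQ]
    fun_prop
  have hHpos : ∀ p, p ≠ 0 → 0 < H p := by
    rintro ⟨x, y⟩ hp
    simp only [hH]
    rcases eq_or_ne x 0 with rfl | hx
    · have hy : y ≠ 0 := fun h => hp (by rw [h]; rfl)
      rw [intervalIntegral.integral_same]
      positivity
    · have := integral_pos_of_mul_pos hgc hgpos hx
      positivity
  -- levels of the energy
  obtain ⟨m, hm, hHm⟩ : ∃ m > 0, ∀ p ∈ Metric.closedBall (0 : ℝ × ℝ) R, ε ≤ ‖p‖ → m ≤ H p := by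
    have hc : IsCompact (Metric.closedBall (0 : ℝ × ℝ) R ∩ {p | ε ≤ ‖p‖}) :=
      (isCompact_closedBall _ _).inter_right (isClosed_le continuous_const continuous_norm)
    rcases (Metric.closedBall (0 : ℝ × ℝ) R ∩ {p | ε ≤ ‖p‖}).eq_empty_or_nonempty with he | hne
    · refine ⟨1, one_pos, fun p hp hpε => ?_⟩
      exact absurd (he ▸ (⟨hp, hpε⟩ : p ∈ _ ∩ {p : ℝ × ℝ | ε ≤ ‖p‖})) (notMem_empty p)
    · obtain ⟨q, hq, hmin⟩ := hc.exists_isMinOn hne hHc.continuousOn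
      have hq0 : q ≠ 0 := norm_pos_iff.1 (hε.trans_le hq.2)
      exact ⟨H q, hHpos q hq0, fun p hp hpε => hmin ⟨hp, hpε⟩⟩
  obtain ⟨r, hr, hHr⟩ : ∃ r > 0, ∀ p : ℝ × ℝ, ‖p‖ < r → H p < m / 3 := by
    have hH0 : H 0 = 0 := by simp [hH]
    have := hHc.continuousAt.eventually (gt_mem_nhds (by rw [hH0]; positivity : H 0 < m / 3))
    obtain ⟨r, hr, h⟩ := Metric.eventually_nhds_iff.1 this
    exact ⟨r, hr, fun p hp => h (by rwa [dist_zero_right])⟩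
  obtain ⟨N, hN⟩ := (isCompact_closedBall (0 : ℝ × ℝ) R).exists_bound_of_continuousOn
    hQc.continuousOn
  set K := Metric.closedBall (0 : ℝ × ℝ) R ∩ {p | r ≤ ‖p‖} with hK
  have hKc : IsCompact K :=
    (isCompact_closedBall _ _).inter_right (isClosed_le continuous_const continuous_norm)
  have hfnn : ∀ x, 0 ≤ f τ₁ x := fun x => by
    rcases eq_or_ne x 0 with rfl | hx
    · exact hf0
    · exact (hfpos x hx).le
  have hAeq : ∀ p, A τ₁ p = -(f τ₁ p.1 * p.2 ^ 2) := fun p => by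
    simp only [hA]
    ring
  obtain ⟨η₀, hη₀, hη⟩ := hKc.exists_add_mul_neg (A := A τ₁) (B := B τ₁)
    (hAc.comp (f := fun p => (τ₁, p)) (by fun_prop))
    (hBc.comp (f := fun p => (τ₁, p)) (by fun_prop))
    (fun p _ => by
      rw [hAeq]
      exact neg_nonpos.2 (mul_nonneg (hfnn _) (sq_nonneg _)))
    (by
      rintro ⟨x, y⟩ hp h0
      have hne : ((x, y) : ℝ × ℝ) ≠ 0 := norm_pos_iff.1 (hr.trans_le hp.2)
      rw [hAeq, neg_eq_zero, mul_eq_zero] at h0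
      simp only [hB]
      rcases eq_or_ne x 0 with rfl | hx
      · have hy : y ≠ 0 := fun h => hne (by rw [h]; rfl)
        have : 0 < y ^ 4 := by positivity
        linarith
      · have hy : y = 0 := by
          rcases h0 with h0 | h0
          · exact absurd h0 (hfpos x hx).ne'
          · exact pow_eq_zero_iff two_ne_zero |>.1 h0
        subst hy
        have h1 : 0 < x ^ 2 * (x * g τ₁ x) := mul_pos (by positivity) (hgpos x hx)
        linarith)
  -- Small enough also for `|η Q| < m / 3` on the ball, so the correction cannot close the gap
  -- between the energy levels `m / 3` and `m`.
  set η := min η₀ (m / (3 * (|N| + 1))) with hηdef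
  have hηpos : 0 < η := by positivity
  have hηQ : ∀ p ∈ Metric.closedBall (0 : ℝ × ℝ) R, |η * Q p| < m / 3 := fun p hp => by
    rw [abs_mul, abs_of_pos hηpos]
    have h1 : |Q p| < |N| + 1 := ((hN p hp).trans (le_abs_self N)).trans_lt (lt_add_one _)
    calc η * |Q p| < η * (|N| + 1) := by gcongr
      _ ≤ m / (3 * (|N| + 1)) * (|N| + 1) := by
        gcongr
        exact min_le_right _ _
      _ = m / 3 := by field_simp
  have hKneg : ∀ᶠ τ in 𝓝 τ₁, ∀ p ∈ K, A τ p + η * B τ p < 0 := by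
    refine hKc.eventually_forall_of_forall_eventually fun p hp => ?_
    have hcont : Continuous fun q : ℝ × ℝ × ℝ => A q.1 q.2 + η * B q.1 q.2 :=
      hAc.add (continuous_const.mul hBc)
    exact hcont.continuousAt.eventually (gt_mem_nhds (hη η hηpos (min_le_left _ _) p hp))
  filter_upwards [hKneg] with τ hτ
  rintro Γ ⟨γ, T, hT, hγ, hper, -, rfl⟩ hR
  have hd := fun t => (hasDerivAt_energy hgc (hγ t)).fun_add
    ((hasDerivAt_quartic (hγ t)).const_mul η)
  have hγc : Continuous γ := continuous_iff_continuousAt.2 fun t => (hγ t).continuousAt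
  -- At the maximum of `H + η Q` on the cycle the derivative vanishes, so this point lies within `r`
  -- of the origin, where `H < m / 3`. Then `H < m` on the whole cycle, which keeps it inside the
  -- `ε`-ball.
  obtain ⟨q, ⟨t₀, rfl⟩, hmax⟩ := (hper.compact_of_continuous hT.ne' hγc).exists_isMaxOn
    (range_nonempty γ) (f := fun p => H p + η * Q p) (by fun_prop)
  have hloc : IsLocalMax (fun t => H (γ t) + η * Q (γ t)) t₀ :=
    Eventually.of_forall fun t => hmax (mem_range_self t)
  have hzero := hloc.hasDerivAt_eq_zero (hd t₀)
  have hlt : ‖γ t₀‖ < r := by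
    by_contra! hge
    exact (hτ (γ t₀) ⟨hR (mem_range_self _), hge⟩).ne hzero
  rintro _ ⟨t, rfl⟩
  rw [mem_ball_zero_iff]
  by_contra! hge
  have h1 : H (γ t) + η * Q (γ t) ≤ H (γ t₀) + η * Q (γ t₀) := hmax (mem_range_self t)
  have h2 := hHm (γ t) (hR (mem_range_self _)) hge
  have h3 := hHr (γ t₀) hlt
  have h4 := (abs_lt.1 (hηQ (γ t) (hR (mem_range_self _)))).1
  have h5 := (abs_lt.1 (hηQ (γ t₀) (hR (mem_range_self _)))).2
  linarith

end Shrinking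

/-! ### The truncated oscillator -/

section Oscillator

variable {μ k α τ₀ : ℝ}

theorem dampingCoeff_zero : dampingCoeff μ α τ₀ 0 = (μ - α * τ₀) / (1 + α * τ₀ ^ 2 / 2) := by
  rw [dampingCoeff, delay_zero]

theorem dampingCoeff_zero_pos (hα : 0 < α) (h : τ₀ < criticalDelay μ α) :
    0 < dampingCoeff μ α τ₀ 0 := by
  refine div_pos ?_ (mass_pos hα τ₀ 0)
  rw [delay_zero, sub_pos, mul_comm]
  exact (lt_div_iff₀ hα).1 h

theorem dampingCoeff_zero_neg (hα : 0 < α) (h : criticalDelay μ α < τ₀) :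
    dampingCoeff μ α τ₀ 0 < 0 := by
  refine div_neg_of_neg_of_pos ?_ (mass_pos hα τ₀ 0)
  rw [delay_zero, sub_neg, mul_comm]
  exact (div_lt_iff₀ hα).1 h

theorem dampingCoeff_pos (hμ : 0 < μ) (hα : 0 < α) (h0 : 0 ≤ τ₀) (h : τ₀ ≤ criticalDelay μ α)
    {x : ℝ} (hx : x ≠ 0) : 0 < dampingCoeff μ α τ₀ x := by
  refine div_pos (sub_pos.2 ?_) (mass_pos hα τ₀ x)
  have h1 : τ₀ * α ≤ μ := (le_div_iff₀ hα).1 h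
  have h2 : Real.exp (-x ^ 2) < 1 := by
    rw [← Real.exp_zero, Real.exp_lt_exp]
    exact neg_lt_zero.2 (by positivity)
  rcases h0.eq_or_lt with rfl | h0
  · simpa [delay] using hμ
  · calc α * delay τ₀ x < α * (τ₀ * 1) := by
          unfold delay
          gcongr
      _ ≤ μ := by linarith

theorem dampingCoeff_zero_nonneg (hα : 0 < α) (h : τ₀ ≤ criticalDelay μ α) :
    0 ≤ dampingCoeff μ α τ₀ 0 := by
  refine div_nonneg ?_ (mass_pos hα τ₀ 0).le
  rw [delay_zero, sub_nonneg, mul_comm]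
  exact (le_div_iff₀ hα).1 h

theorem hasDerivAt_restoringForce_zero (hα : 0 < α) :
    HasDerivAt (restoringForce k α τ₀) ((k + α) / (1 + α * τ₀ ^ 2 / 2)) 0 := by
  refine (hasDerivAt_restoringForce hα 0).congr_deriv ?_
  have h := (mass_pos hα τ₀ 0).ne'
  rw [delay_zero] at h ⊢
  field_simp
  ring

theorem stiffness_pos (hα : 0 < α) (hk : 0 < k + α) : 0 < (k + α) / (1 + α * τ₀ ^ 2 / 2) := by
  positivity

theorem exists_isPhaseFlow_oscillator (hμ : 0 < μ) (hα : 0 < α) (hk : 0 < k + α) (τ₀ : ℝ) :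
    ∃ ψ, IsPhaseFlow (dampingCoeff μ α τ₀) (restoringForce k α τ₀) ψ := by
  obtain ⟨K, φ, h⟩ := exists_isFlow_oscillator hμ hα hk τ₀
  exact ⟨_, h.isPhaseFlow (hasDerivAt_dampingPrimitive hα) (continuous_dampingPrimitive hα)⟩

theorem not_isLyapunovStable_origin (hμ : 0 < μ) (hα : 0 < α) (hk : 0 < k + α)
    (hτ : criticalDelay μ α < τ₀) : ¬ IsLyapunovStable (oscillatorField μ k α τ₀) {0} := by
  obtain ⟨ψ, hψ⟩ := exists_isPhaseFlow_oscillator hμ hα hk τ₀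
  exact hψ.not_isLyapunovStable_zero (continuous_dampingCoeff hα).continuousAt
    (dampingCoeff_zero_neg hα hτ) (hasDerivAt_restoringForce_zero hα) restoringForce_zero
    (stiffness_pos hα hk)

theorem isAsymptoticallyStable_origin (hμ : 0 < μ) (hα : 0 < α) (hk : 0 < k + α)
    (hτ : τ₀ < criticalDelay μ α) : IsAsymptoticallyStable (oscillatorField μ k α τ₀) {0} := by
  obtain ⟨ψ, hψ⟩ := exists_isPhaseFlow_oscillator hμ hα hk τ₀
  exact hψ.isAsymptoticallyStable_zero (continuous_dampingCoeff hα).continuousAt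
    (dampingCoeff_zero_pos hα hτ) (hasDerivAt_restoringForce_zero hα) restoringForce_zero
    (stiffness_pos hα hk)

theorem not_isCycle_oscillator (hμ : 0 < μ) (hα : 0 < α) (h0 : 0 ≤ τ₀)
    (h : τ₀ ≤ criticalDelay μ α) (Γ : Set (ℝ × ℝ)) : ¬ IsCycle (oscillatorField μ k α τ₀) Γ :=
  not_isCycle_of_damping_pos (continuous_restoringForce hα)
    (fun _ hx => dampingCoeff_pos hμ hα h0 h hx) (dampingCoeff_zero_nonneg hα h) Γ

/-- `exists_cycle_bound` first confines all cycles at nearby delays to one ball; at the critical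
delay the damping is positive off `x = 0`, so the shrinking argument applies in that ball. -/
theorem eventually_isCycle_oscillator_subset_ball (hμ : 0 < μ) (hα : 0 < α) (hk : 0 < k + α)
    {ε : ℝ} (hε : 0 < ε) : ∀ᶠ τ₀ in 𝓝 (criticalDelay μ α), ∀ Γ,
      IsCycle (oscillatorField μ k α τ₀) Γ → Γ ⊆ Metric.ball 0 ε := by
  have hc : 0 < criticalDelay μ α := div_pos hμ hα
  obtain ⟨R, hR⟩ := exists_cycle_bound hμ hα hk (criticalDelay μ α + 1)
  have h1 : ∀ᶠ τ₀ in 𝓝 (criticalDelay μ α), |τ₀| ≤ criticalDelay μ α + 1 := by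
    filter_upwards [continuous_abs.continuousAt.eventually
      (gt_mem_nhds (by rw [abs_of_pos hc]; linarith :
        |criticalDelay μ α| < criticalDelay μ α + 1))] with τ₀ h using h.le
  filter_upwards [h1, eventually_isCycle_subset_ball (f := dampingCoeff μ α)
    (g := restoringForce k α) (τ₁ := criticalDelay μ α) (R := R)
    (continuous_dampingCoeff_uncurry hα) (continuous_restoringForce_uncurry hα)
    (fun x hx => dampingCoeff_pos hμ hα hc.le le_rfl hx) (dampingCoeff_zero_nonneg hα le_rfl)
    (fun x hx => mul_restoringForce_pos hα hk hx) hε] with τ₀ h2 h3 Γ hΓ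
  exact h3 Γ hΓ (hR τ₀ h2 Γ hΓ)

/-! ### The truncated equation -/

theorem taylorWithinEval_two_univ {x : ℝ → ℝ} (t s : ℝ) :
    taylorWithinEval x 2 univ t s =
      x t + deriv x t * (s - t) + deriv (deriv x) t / 2 * (s - t) ^ 2 := by
  rw [taylorWithinEval_succ, taylorWithinEval_succ, taylor_within_zero_eval,
    iteratedDerivWithin_univ, iteratedDerivWithin_univ, iteratedDeriv_succ (n := 0 + 1),
    zero_add, iteratedDeriv_one]
  norm_num [Nat.factorial]
  ring

/-- The quadratic Taylor term adds `α τ² / 2` to the coefficient of `x''`; dividing by this total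
mass, which is at least `1`, gives the Liénard form. -/
theorem truncatedEquation_eq (hα : 0 < α) (x : ℝ → ℝ) (t : ℝ) :
    truncatedEquation μ k α τ₀ x t = (1 + α * delay τ₀ (x t) ^ 2 / 2) *
      (deriv (deriv x) t + dampingCoeff μ α τ₀ (x t) * deriv x t +
        restoringForce k α τ₀ (x t)) := by
  have h := (mass_pos hα τ₀ (x t)).ne'
  rw [truncatedEquation, taylorWithinEval_two_univ, dampingCoeff, restoringForce]
  field_simp
  ring

theorem truncatedEquation_eq_zero_iff (hα : 0 < α) (x : ℝ → ℝ) (t : ℝ) :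
    truncatedEquation μ k α τ₀ x t = 0 ↔
      deriv (deriv x) t + dampingCoeff μ α τ₀ (x t) * deriv x t +
        restoringForce k α τ₀ (x t) = 0 := by
  rw [truncatedEquation_eq hα, mul_eq_zero, or_iff_right (mass_pos hα τ₀ (x t)).ne']

theorem lienard_iff_hasDerivAt {f g x : ℝ → ℝ} (hx : ContDiff ℝ 2 x) (t : ℝ) :
    deriv (deriv x) t + f (x t) * deriv x t + g (x t) = 0 ↔
      HasDerivAt (fun s => (x s, deriv x s)) (lienardField f g (x t, deriv x t)) t := by
  have h1 : HasDerivAt x (deriv x t) t :=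
    (hx.differentiable (by norm_num) t).hasDerivAt
  have h2 : HasDerivAt (deriv x) (deriv (deriv x) t) t :=
    ((contDiff_succ_iff_deriv (n := 1)).1 hx).2.2.differentiable (by norm_num) t |>.hasDerivAt
  have h3 := h1.prodMk h2
  constructor
  · intro h
    refine h3.congr_deriv ?_
    rw [lienardField, Prod.mk.injEq]
    exact ⟨rfl, by linarith⟩
  · intro h
    have := congrArg Prod.snd (h3.unique h)
    simp only [lienardField] at this
    linarith

theorem oscillatorField_eq_zero_iff (hα : 0 < α) (hk : 0 < k + α) (p : ℝ × ℝ) :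
    oscillatorField μ k α τ₀ p = 0 ↔ p = 0 := by
  obtain ⟨x, y⟩ := p
  simp only [oscillatorField, lienardField, Prod.mk_eq_zero]
  constructor
  · rintro ⟨rfl, h⟩
    refine ⟨?_, rfl⟩
    by_contra hx
    have := mul_restoringForce_pos (τ₀ := τ₀) hα hk hx
    have h0 : restoringForce k α τ₀ x = 0 := by linarith
    rw [h0, mul_zero] at this
    exact this.false
  · rintro ⟨rfl, rfl⟩
    simp [restoringForce_zero]

/-! ### Eigenvalues of the linearization -/

/-- The characteristic polynomial is `X² + f(0) X + κ`; `hdisc` says that its discriminant is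
nonpositive, so its roots are conjugate. -/
theorem roots_map_charpoly_fderiv_lienardField {f g : ℝ → ℝ} {f' κ : ℝ} (hf : HasDerivAt f f' 0)
    (hg : HasDerivAt g κ 0) (hdisc : (f 0 / 2) ^ 2 ≤ κ) :
    linearizationEigenvalues (lienardField f g) 0 =
      {⟨-(f 0 / 2), √(κ - (f 0 / 2) ^ 2)⟩, conj ⟨-(f 0 / 2), √(κ - (f 0 / 2) ^ 2)⟩} := by
  set lam : ℂ := ⟨-(f 0 / 2), √(κ - (f 0 / 2) ^ 2)⟩ with hlam
  have hd : HasFDerivAt (lienardField f g)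
      ((ContinuousLinearMap.snd ℝ ℝ ℝ).prod
        (-(f 0 • ContinuousLinearMap.snd ℝ ℝ ℝ) - κ • ContinuousLinearMap.fst ℝ ℝ ℝ)) 0 := by
    have h1 : HasFDerivAt (fun p : ℝ × ℝ => f p.1) (f' • ContinuousLinearMap.fst ℝ ℝ ℝ) 0 :=
      HasDerivAt.comp_hasFDerivAt (0 : ℝ × ℝ) hf hasFDerivAt_fst
    have h2 : HasFDerivAt (fun p : ℝ × ℝ => g p.1) (κ • ContinuousLinearMap.fst ℝ ℝ ℝ) 0 :=
      HasDerivAt.comp_hasFDerivAt (0 : ℝ × ℝ) hg hasFDerivAt_fst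
    have h3 := hasFDerivAt_snd.prodMk ((h1.fun_neg.fun_mul hasFDerivAt_snd).fun_sub h2)
    refine h3.congr_fderiv ?_
    ext <;> simp
  have hpoly : LinearMap.charpoly (fderiv ℝ (lienardField f g) 0 : ℝ × ℝ →ₗ[ℝ] ℝ × ℝ) =
      Polynomial.X ^ 2 - Polynomial.C (-f 0) * Polynomial.X + Polynomial.C κ := by
    rw [hd.fderiv, ← LinearMap.charpoly_toMatrix _ (Module.Basis.finTwoProd ℝ),
      Matrix.charpoly_fin_two, Matrix.trace_fin_two, Matrix.det_fin_two]
    simp [LinearMap.toMatrix_apply]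
  have h1 : lam + conj lam = ((-f 0 : ℝ) : ℂ) := by
    rw [Complex.add_conj, hlam]
    push_cast
    ring
  have h2 : lam * conj lam = (κ : ℂ) := by
    rw [hlam, Complex.mul_conj, Complex.normSq_mk]
    rw [Real.mul_self_sqrt (sub_nonneg.2 hdisc)]
    norm_cast
    ring
  have h3 : (Polynomial.X ^ 2 - Polynomial.C (-f 0) * Polynomial.X + Polynomial.C κ).map
      (algebraMap ℝ ℂ) = (Polynomial.X - Polynomial.C lam) *
        (Polynomial.X - Polynomial.C (conj lam)) := by
    simp only [Polynomial.map_add, Polynomial.map_sub, Polynomial.map_mul, Polynomial.map_pow,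
      Polynomial.map_X, Polynomial.map_C, Complex.coe_algebraMap]
    rw [← h1, ← h2, Polynomial.C_add, Polynomial.C_mul]
    ring
  rw [linearizationEigenvalues, hpoly, h3, Polynomial.roots_mul
    (mul_ne_zero (Polynomial.X_sub_C_ne_zero _) (Polynomial.X_sub_C_ne_zero _)),
    Polynomial.roots_X_sub_C, Polynomial.roots_X_sub_C]
  rfl

theorem differentiableAt_dampingCoeff (hα : 0 < α) (x : ℝ) :
    DifferentiableAt ℝ (dampingCoeff μ α τ₀) x := by
  unfold dampingCoeff delay
  exact DifferentiableAt.div (by fun_prop) (by fun_prop) (mass_pos hα τ₀ x).ne'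

/-- At the critical delay a pair of complex conjugate eigenvalues crosses the imaginary axis. -/
theorem exists_eigenvalues_crossing (hα : 0 < α) (hk : 0 < k + α) :
    ∃ (lam : ℝ → ℂ) (c : ℝ),
      (∀ᶠ τ₀ in 𝓝 (criticalDelay μ α),
        linearizationEigenvalues (oscillatorField μ k α τ₀) 0 = {lam τ₀, conj (lam τ₀)}) ∧
      (lam (criticalDelay μ α)).re = 0 ∧ 0 < (lam (criticalDelay μ α)).im ∧
      0 < c ∧ HasDerivAt (fun τ₀ => (lam τ₀).re) c (criticalDelay μ α) := by
  set τ₁ := criticalDelay μ α with hτ₁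
  have hτα : α * τ₁ = μ := mul_div_cancel₀ _ hα.ne'
  have hm : 0 < 1 + α * τ₁ ^ 2 / 2 := by positivity
  have hzero : dampingCoeff μ α τ₁ 0 = 0 := by rw [dampingCoeff_zero, hτα, sub_self, zero_div]
  have hcont : Continuous fun τ₀ => (k + α) / (1 + α * τ₀ ^ 2 / 2) :=
    continuous_const.div (by fun_prop) fun τ₀ => by positivity
  have hcont' : Continuous fun τ₀ => dampingCoeff μ α τ₀ 0 :=
    (continuous_dampingCoeff_uncurry hα).comp (f := fun τ₀ => (τ₀, (0 : ℝ))) (by fun_prop)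
  refine ⟨fun τ₀ => ⟨-(dampingCoeff μ α τ₀ 0 / 2),
    √((k + α) / (1 + α * τ₀ ^ 2 / 2) - (dampingCoeff μ α τ₀ 0 / 2) ^ 2)⟩,
    α / (1 + α * τ₁ ^ 2 / 2) / 2, ?_, ?_, ?_, by positivity, ?_⟩
  · have : ∀ᶠ τ₀ in 𝓝 τ₁,
        0 < (k + α) / (1 + α * τ₀ ^ 2 / 2) - (dampingCoeff μ α τ₀ 0 / 2) ^ 2 := by
      refine (hcont.sub ((hcont'.div_const 2).pow 2)).continuousAt.eventually (lt_mem_nhds ?_)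
      have := stiffness_pos (τ₀ := τ₁) hα hk
      simpa [hzero] using this
    filter_upwards [this] with τ₀ h
    exact roots_map_charpoly_fderiv_lienardField (differentiableAt_dampingCoeff hα 0).hasDerivAt
      (hasDerivAt_restoringForce_zero hα) (sub_nonneg.1 h.le)
  · simp only [hzero]
    norm_num
  · simp only [hzero]
    rw [zero_div, zero_pow two_ne_zero, sub_zero]
    exact Real.sqrt_pos.2 (stiffness_pos hα hk)
  · simp only [dampingCoeff_zero]
    have h1 : HasDerivAt (fun τ₀ => μ - α * τ₀) (-α) τ₁ := by
      simpa using ((hasDerivAt_id' τ₁).const_mul α).const_sub μ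
    have h2 : HasDerivAt (fun τ₀ => 1 + α * τ₀ ^ 2 / 2) (α * τ₁) τ₁ := by
      refine ((((hasDerivAt_id' τ₁).fun_pow 2).const_mul α).div_const 2).const_add 1
        |>.congr_deriv ?_
      push_cast
      ring
    -- The numerator `μ - α τ₀` vanishes at the critical delay, so the derivative of the denominator
    -- does not contribute.
    refine ((h1.fun_div h2 hm.ne').div_const 2).fun_neg.congr_deriv ?_
    rw [hτα, sub_self]
    field_simp
    ring

end Oscillator

/-! ### The main theorem -/

theorem mainTheorem1 (μ k α : ℝ) (hμ : 0 < μ) (hα : 0 < α) (hk : 0 < k + α) :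
    -- the second-order truncation is the Liénard equation, and the latter is the planar system
    (∀ (τ₀ : ℝ) (x : ℝ → ℝ), ContDiff ℝ 2 x → ∀ t : ℝ,
      (truncatedEquation μ k α τ₀ x t = 0 ↔
        deriv (deriv x) t + dampingCoeff μ α τ₀ (x t) * deriv x t
          + restoringForce k α τ₀ (x t) = 0) ∧
      (truncatedEquation μ k α τ₀ x t = 0 ↔
        HasDerivAt (fun s => (x s, deriv x s))
          (oscillatorField μ k α τ₀ (x t, deriv x t)) t)) ∧
    -- the origin is the only equilibrium
    (∀ (τ₀ : ℝ) (p : ℝ × ℝ), oscillatorField μ k α τ₀ p = 0 ↔ p = 0) ∧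
    -- the slope of `F` at the origin, and the range of validity of Liénard's hypotheses
    (∀ τ₀ : ℝ, deriv (dampingPrimitive μ α τ₀) 0 = (μ - α * τ₀) / (1 + α * τ₀ ^ 2 / 2)) ∧
    (∀ τ₀ : ℝ, LienardHypotheses (dampingPrimitive μ α τ₀) (restoringForce k α τ₀) ↔
      criticalDelay μ α < τ₀) ∧
    -- above the critical delay: unstable rest state, exactly one limit cycle, and it is stable
    (∀ τ₀ : ℝ, criticalDelay μ α < τ₀ →
      ¬ IsLyapunovStable (oscillatorField μ k α τ₀) {0} ∧
      ∃ Γ : Set (ℝ × ℝ), IsLimitCycle (oscillatorField μ k α τ₀) Γ ∧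
        IsAsymptoticallyStable (oscillatorField μ k α τ₀) Γ ∧
        ∀ Γ' : Set (ℝ × ℝ), IsCycle (oscillatorField μ k α τ₀) Γ' → Γ' = Γ) ∧
    -- up to the critical delay there is no cycle, and below it the rest state is stable
    (∀ τ₀ : ℝ, 0 ≤ τ₀ → τ₀ ≤ criticalDelay μ α →
      ∀ Γ : Set (ℝ × ℝ), ¬ IsCycle (oscillatorField μ k α τ₀) Γ) ∧
    (∀ τ₀ : ℝ, 0 ≤ τ₀ → τ₀ < criticalDelay μ α →
      IsAsymptoticallyStable (oscillatorField μ k α τ₀) {0}) ∧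
    -- Hopf onset: a conjugate pair of eigenvalues crosses the imaginary axis transversally
    (∃ (lam : ℝ → ℂ) (c : ℝ),
      (∀ᶠ τ₀ in 𝓝 (criticalDelay μ α),
        linearizationEigenvalues (oscillatorField μ k α τ₀) 0 = {lam τ₀, conj (lam τ₀)}) ∧
      (lam (criticalDelay μ α)).re = 0 ∧ 0 < (lam (criticalDelay μ α)).im ∧
      0 < c ∧ HasDerivAt (fun τ₀ => (lam τ₀).re) c (criticalDelay μ α)) ∧
    -- and the limit cycle emerges from the rest state
    (∀ ε > 0, ∀ᶠ τ₀ in 𝓝[>] (criticalDelay μ α), ∀ Γ : Set (ℝ × ℝ),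
      IsCycle (oscillatorField μ k α τ₀) Γ → Γ ⊆ Metric.ball 0 ε) ∧
    -- the numerical value for `μ = 0.1`, `α = 1/2`
    criticalDelay (1 / 10) (1 / 2) = 1 / 5 := by
  refine ⟨fun τ₀ x hx t => ⟨truncatedEquation_eq_zero_iff hα x t,
      (truncatedEquation_eq_zero_iff hα x t).trans (lienard_iff_hasDerivAt hx t)⟩,
    fun τ₀ => oscillatorField_eq_zero_iff hα hk,
    fun τ₀ => deriv_dampingPrimitive_zero hα,
    fun τ₀ => lienardHypotheses_iff hμ hα hk,
    fun τ₀ hτ => ⟨not_isLyapunovStable_origin hμ hα hk hτ,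
      exists_unique_limitCycle hμ hα hk hτ⟩,
    fun τ₀ h0 hτ => not_isCycle_oscillator hμ hα h0 hτ,
    fun τ₀ _ hτ => isAsymptoticallyStable_origin hμ hα hk hτ,
    exists_eigenvalues_crossing hα hk,
    fun ε hε => (eventually_isCycle_oscillator_subset_ball hμ hα hk hε).filter_mono
      nhdsWithin_le_nhds, ?_⟩
  norm_num [criticalDelay]
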